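/- A number field $K$ is called primitive if it has no subfields other than $\mathbb{Q}$ and $K$, and imprimitive otherwise. A curve over $\mathbb{Q}$ is a smooth projective geometrically irreducible variety of dimension $1$ over $\mathbb{Q}$; it is called hyperelliptic if its genus is at least $2$ and it admits a degree $2$ morphism to $\mathbb{P}^1$ defined over $\mathbb{Q}$. Theorem. Let $C$ be a hyperelliptic curve over $\mathbb{Q}$ of genus $g$ with Jacobian $J$, and suppose that $g=2$ or $g=3$. Suppose that the Mordell--Weil group $J(\mathbb{Q})$ is trivial. Then $C(K)=C(\mathbb{Q})$ for every primitive number field $K$ of degree $4$. However, there are infinitely many imprimitive number fields $K$ of degree $4$ such that $C(K)\neq C(\mathbb{Q})$. -/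

import Mathlib

open CategoryTheory Limits AlgebraicGeometry

universe u

noncomputable section

namespace CurvePoints

/-! ### Curves over a field -/

/-- A curve over a field `k`: a smooth, proper, geometrically integral `k`-scheme of dimension `1`.
Smooth `k`-schemes are geometrically reduced and proper curves are projective, so these are exactly
the smooth projective geometrically irreducible varieties of dimension `1` over `k`. -/
class IsCurve {k : Type u} [Field k] {C : Scheme.{u}} (s : C ⟶ Spec (.of k)) : Prop where
  smooth : SmoothOfRelativeDimension 1 s
  proper : IsProper s
  geometricallyIntegral : GeometricallyIntegral s

attribute [instance] IsCurve.smooth IsCurve.proper IsCurve.geometricallyIntegral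

section Curve

variable {k : Type u} [Field k] {C : Scheme.{u}} (s : C ⟶ Spec (.of k))

/-- The structure morphism `Spec R ⟶ Spec k` of a `k`-algebra `R`. -/
def specMap (k : Type u) [Field k] (R : Type u) [CommRing R] [Algebra k R] :
    Spec (.of R) ⟶ Spec (.of k) :=
  Spec.map (CommRingCat.ofHom (algebraMap k R))

/-- `C(R)`: the `R`-valued points of the `k`-scheme `C`, for a `k`-algebra `R`. -/
def Points (R : Type u) [CommRing R] [Algebra k R] : Type u :=
  { P : Spec (.of R) ⟶ C // P ≫ s = specMap k R }

/-- The map `C(R) → C(S)` induced by a homomorphism `R → S` of `k`-algebras. -/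
def Points.map {R S : Type u} [CommRing R] [CommRing S] [Algebra k R] [Algebra k S]
    (φ : R →ₐ[k] S) (P : Points s R) : Points s S :=
  ⟨Spec.map (CommRingCat.ofHom φ.toRingHom) ≫ P.1, by
    rw [Category.assoc, P.2, specMap, specMap, ← Spec.map_comp, ← CommRingCat.ofHom_comp]
    congr 2
    exact φ.comp_algebraMap⟩

/-- The statement `C(K) = C(k)`: every `K`-point of `C` comes from a `k`-point. -/
def PointsEqBase (K : Type u) [Field K] [Algebra k K] : Prop :=
  Function.Surjective (Points.map s (Algebra.ofId k K))

theorem isIntegral_of_isCurve [IsCurve s] : IsIntegral C :=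
  GeometricallyIntegral.isIntegral_of_subsingleton s

/-! ### Genus -/

/-- The `k`-algebra structure on the local ring of `C` at a point. -/
@[reducible] def stalkAlgebra (x : C) : Algebra k (C.presheaf.stalk x) :=
  ((Scheme.ΓSpecIso (.of k)).inv ≫ s.appTop ≫ C.presheaf.germ ⊤ x trivial).hom.toAlgebra

/-- `H⁰(C, Ω)`: the global regular differentials on the curve `C`, i.e. those Kähler differentials
of the function field `k(C)` over `k` which at every point `x` of `C` can be written in the form
`∑ aᵢ dbᵢ` with `aᵢ, bᵢ` in the local ring of `C` at `x`. -/
def regularDifferentials [IsCurve s] :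
    haveI := isIntegral_of_isCurve s
    letI := stalkAlgebra s (genericPoint C)
    Submodule k (Ω[C.functionField⁄k]) :=
  haveI := isIntegral_of_isCurve s
  letI := stalkAlgebra s (genericPoint C)
  ⨅ x : C, Submodule.span k
    { ω : Ω[C.functionField⁄k] | ∃ a b : C.presheaf.stalk x,
        ω = algebraMap (C.presheaf.stalk x) C.functionField a •
          KaehlerDifferential.D k C.functionField
            (algebraMap (C.presheaf.stalk x) C.functionField b) }

/-- The genus of a curve `C` over `k`: the dimension over `k` of the space `H⁰(C, Ω)`. -/
def genus [IsCurve s] : ℕ :=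
  Module.finrank k (regularDifferentials s)

/-! ### Hyperelliptic curves -/

attribute [local instance] MvPolynomial.gradedAlgebra

/-- The projective line over `k`, as `Proj k[X₀, X₁]`. -/
def projectiveLine (k : Type u) [Field k] : Scheme.{u} :=
  Proj (MvPolynomial.homogeneousSubmodule (Fin 2) k)

/-- The structure morphism of the projective line. -/
def projectiveLineStr (k : Type u) [Field k] : projectiveLine k ⟶ Spec (.of k) :=
  Proj.toSpecZero (MvPolynomial.homogeneousSubmodule (Fin 2) k) ≫
    Spec.map (CommRingCat.ofHom
      (algebraMap k (MvPolynomial.homogeneousSubmodule (Fin 2) k 0)))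

/-- A curve `C` over `k` is hyperelliptic if its genus is at least `2` and there is a `k`-morphism
`π : C ⟶ ℙ¹` of degree `2`. The degree of `π` is the degree of the extension of residue fields at
the generic point of `C`; for non-constant `π` this is the degree of the extension of function
fields `[k(C) : k(ℙ¹)]`, and for constant `π` it takes the value `0`, since `k(C)` has infinite
degree over the residue field of a closed point. -/
def IsHyperelliptic [IsCurve s] : Prop :=
  haveI := isIntegral_of_isCurve s
  2 ≤ genus s ∧
    ∃ π : C ⟶ projectiveLine k, π ≫ projectiveLineStr k = s ∧ π.residueDegree (genericPoint C) = 2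

end Curve

/-! ### The Mordell–Weil group of the Jacobian -/

section Jacobian

variable {k : Type u} [Field k] {C : Scheme.{u}} (s : C ⟶ Spec (.of k))

/-- The base change of `C` to the algebraic closure of `k`. -/
abbrev geometricFiber : Scheme.{u} :=
  pullback s (specMap k (AlgebraicClosure k))

instance [IsCurve s] : IsIntegral (geometricFiber s) :=
  GeometricallyIntegral.geometrically_isIntegral (f := s) _ _ _ (.of_hasPullback _ _)

instance [IsCurve s] : IsLocallyNoetherian (geometricFiber s) :=
  LocallyOfFiniteType.isLocallyNoetherian (pullback.snd s (specMap k (AlgebraicClosure k)))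

/-- The closed point of the base change of `C` given by an algebraic point of `C`. -/
def geometricPoint (P : Points s (AlgebraicClosure k)) : geometricFiber s :=
  pullback.lift P.1 (𝟙 _) (by rw [P.2, Category.id_comp])
    (IsLocalRing.closedPoint (AlgebraicClosure k) : PrimeSpectrum (AlgebraicClosure k))

/-- Divisors over the algebraic closure: finite formal integral linear combinations of algebraic
points of `C`. -/
abbrev GeometricDivisor : Type u := Points s (AlgebraicClosure k) →₀ ℤ

/-- The action of an automorphism of the algebraic closure on divisors. -/
def galoisAct (σ : AlgebraicClosure k ≃ₐ[k] AlgebraicClosure k) :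
    GeometricDivisor s →+ GeometricDivisor s :=
  Finsupp.mapDomain.addMonoidHom (Points.map s σ.toAlgHom)

/-- The subgroup of principal divisors `div f`, for `f` a nonzero rational function on the base
change of `C`. -/
def principalDivisors [IsCurve s] : AddSubgroup (GeometricDivisor s) where
  carrier := { D | ∃ f : (geometricFiber s).functionField, f ≠ 0 ∧
    ∀ P, D P = Scheme.ord f (geometricPoint s P) }
  zero_mem' := by
    refine ⟨1, one_ne_zero, fun P => ?_⟩
    have h := Scheme.ord_mul (x := geometricPoint s P)
      (one_ne_zero (α := (geometricFiber s).functionField)) one_ne_zero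
    rw [mul_one] at h
    rw [Finsupp.zero_apply]
    omega
  add_mem' := by
    rintro D E ⟨f, hf, hD⟩ ⟨g, hg, hE⟩
    exact ⟨f * g, mul_ne_zero hf hg, fun P => by
      rw [Finsupp.add_apply, hD, hE, Scheme.ord_mul hf hg]⟩
  neg_mem' := by
    rintro D ⟨f, hf, hD⟩
    refine ⟨f⁻¹, inv_ne_zero hf, fun P => ?_⟩
    have h := Scheme.ord_mul (x := geometricPoint s P) hf (inv_ne_zero hf)
    have h1 := Scheme.ord_mul (x := geometricPoint s P)
      (one_ne_zero (α := (geometricFiber s).functionField)) one_ne_zero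
    rw [mul_one] at h1
    rw [mul_inv_cancel₀ hf] at h
    rw [Finsupp.neg_apply, hD]
    omega

/-- The group of divisor classes over the algebraic closure. -/
abbrev GeometricPic [IsCurve s] : Type u := GeometricDivisor s ⧸ principalDivisors s

/-- The group `J(k)` of `k`-rational points of the Jacobian of `C`, for `k` of characteristic `0`:
the group of those classes of divisors of degree `0` on `C` over the algebraic closure which are
fixed by the absolute Galois group of `k`, `J(k) = Pic⁰(C_{k̄})^{Gal(k̄/k)}`. -/
def jacobianPoints [IsCurve s] [CharZero k] : AddSubgroup (GeometricPic s) :=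
  let cl : GeometricDivisor s →+ GeometricPic s := QuotientAddGroup.mk' (principalDivisors s)
  AddSubgroup.map cl
    ((Finsupp.degree : GeometricDivisor s →+ ℤ).ker ⊓
      ⨅ σ : AlgebraicClosure k ≃ₐ[k] AlgebraicClosure k, (cl.comp (galoisAct s σ) - cl).ker)

end Jacobian

/-! ### Primitive number fields -/

/-- A number field `K` is primitive if its only subfields are `ℚ` and `K`; it is imprimitive
otherwise. -/
def IsPrimitiveField (K : Type*) [Field K] [NumberField K] : Prop :=
  ∀ L : IntermediateField ℚ K, L = ⊥ ∨ L = ⊤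

end CurvePoints

end

noncomputable section

/-! Write the curve as y² = f(x) with f squarefree of degree 2n. If n ≤ 2, every regular
differential is a constant multiple of dx/y, so genus at least 2 forces n ≥ 3
(`exists_forall_mem_span_singleton`, `IsHyperelliptic.exists_model`). Over the algebraic closure x
has exactly two poles A and B, and they form a Galois-stable pair.

Let P be a point away from infinity over a field K of degree 2j, where j < n. The sum of the
conjugates of P minus j(A + B) is Galois-invariant of degree 0, so triviality of J(ℚ) makes it the
divisor of a function h. The poles of h are at A and B, of order at most j, while y has poles of
order n there; hence h = a(x) with deg a ≤ j, and a vanishes at every conjugate of x(P). If x(P)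
generated K, then a would have 2j distinct roots. So x(P) never generates K
(`exists_polynomial_of_subsingleton`, `adjoin_value_ne_top`).

Take j = 2 and K primitive. Then x(P) is rational, or P lies at infinity. If P were not rational,
its four conjugates would be distinct, yet all of them would lie in one fibre of x, which has at
most two points (`pointsEqBase_of_forall_intermediateField`).

Conversely let x₀² = d with d not a square, and y₀² = f(x₀). The case j = 1 shows that y₀ is not in
ℚ(x₀), so ℚ(x₀, y₀) is quartic, has a quadratic subfield, and carries a point that is not rational
(`exists_quartic_not_pointsEqBase`). Letting d run over the primes gives infinitely many fields,
because finitely many number fields have only finitely many subfields.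

No Riemann–Roch is needed. Geometric points are identified with the nontrivial valuation rings of
the geometric function field (`HasNonconstant.isPlaceFamily`), functions with prescribed poles are
computed by hand in terms of x and y (`HyperellipticModel.eq_aeval_add_of_pole_le`), and
`exists_value` compares the values of a rational function at the conjugates of a point. -/

/-- In a principal ideal domain, a common factor can be removed from three elements so that they
generate the unit ideal. -/
theorem IsPrincipalIdealRing.exists_eq_mul_and_sum_eq_one {R : Type*} [CommRing R] [IsDomain R]
    [IsPrincipalIdealRing R] {a b c : R} (ha : a ≠ 0) :
    ∃ g a' b' c' u v w : R, g ≠ 0 ∧ a = g * a' ∧ b = g * b' ∧ c = g * c' ∧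
      u * a' + v * b' + w * c' = 1 := by
  obtain ⟨g, hg⟩ := IsPrincipalIdealRing.principal (Ideal.span {a, b, c})
  have hm : ∀ z ∈ ({a, b, c} : Set R), ∃ z', z = g * z' := fun z hz => by
    have : z ∈ Ideal.span {a, b, c} := Ideal.subset_span hz
    rw [hg] at this
    exact Ideal.mem_span_singleton.mp this
  obtain ⟨a', ha'⟩ := hm a (by simp)
  obtain ⟨b', hb'⟩ := hm b (by simp)
  obtain ⟨c', hc'⟩ := hm c (by simp)
  have hg0 : g ≠ 0 := by
    rintro rfl
    exact ha (by simpa using ha')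
  have : g ∈ Ideal.span {a, b, c} := by
    rw [hg]
    exact Ideal.mem_span_singleton_self g
  obtain ⟨u, v, w, h⟩ := Submodule.mem_span_triple.mp this
  refine ⟨g, a', b', c', u, v, w, hg0, ha', hb', hc', mul_left_cancel₀ hg0 ?_⟩
  simp only [smul_eq_mul] at h
  linear_combination h - u * ha' - v * hb' - w * hc'

/-! ### Valuation rings over a ground field -/

section ValuationSubring

variable {F : Type*} [Field F]

/-- Integral closedness in degree two: when z⁻¹ lies in `V`, dividing the equation by z gives z = -b
- c z⁻¹. -/
theorem ValuationSubring.mem_of_sq_add_mul_add_eq_zero (V : ValuationSubring F) {z b c : F}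
    (hb : b ∈ V) (hc : c ∈ V) (h : z ^ 2 + b * z + c = 0) : z ∈ V := by
  rcases eq_or_ne z 0 with rfl | hz
  · exact V.zero_mem
  rcases V.mem_or_inv_mem z with h1 | h1
  · exact h1
  · have : z = -b - c * z⁻¹ := by
      field_simp
      linear_combination h
    rw [this]
    exact _root_.sub_mem (NegMemClass.neg_mem hb) (MulMemClass.mul_mem hc h1)

theorem ValuationSubring.mem_of_sq_mem (V : ValuationSubring F) {z : F} (h : z ^ 2 ∈ V) : z ∈ V :=
  V.mem_of_sq_add_mul_add_eq_zero V.zero_mem (NegMemClass.neg_mem h) (by ring : z ^ 2 + 0 * z + -z ^ 2 = 0)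

theorem ValuationSubring.nonunits_mul_mem (V : ValuationSubring F) {a b : F} (ha : a ∈ V.nonunits)
    (hb : b ∈ V) : a * b ∈ V.nonunits := by
  rw [V.mem_nonunits_iff] at ha ⊢
  rw [map_mul]
  calc _ ≤ V.valuation a * 1 := mul_le_mul_right ((V.valuation_le_one_iff b).mpr hb) _
    _ < 1 := by simpa using ha

theorem ValuationSubring.mem_nonunits_of_mul_mem (V : ValuationSubring F) {a b : F} (ha : a ∉ V.nonunits)
    (hb : a * b ∈ V.nonunits) : b ∈ V.nonunits := by
  rw [V.mem_nonunits_iff] at hb ha ⊢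
  rw [map_mul] at hb
  by_contra h
  push Not at h ha
  exact absurd hb (not_lt.mpr (by simpa using mul_le_mul' ha h))

theorem ValuationSubring.inv_mem_of_notMem_nonunits (V : ValuationSubring F) {a : F}
    (ha : a ∉ V.nonunits) : a⁻¹ ∈ V := by
  by_contra h
  exact ha (V.mem_nonunits_iff_or.mpr (Or.inr h))

theorem ValuationSubring.one_notMem_nonunits (V : ValuationSubring F) : (1 : F) ∉ V.nonunits := by
  simp [V.mem_nonunits_iff]

theorem ValuationSubring.inv_mem_nonunits_of_notMem (V : ValuationSubring F) {a : F}
    (ha : a ∉ V) : a⁻¹ ∈ V.nonunits :=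
  V.inv_mem_nonunits_iff.mpr (Or.inr ha)

variable {k : Type*} [Field k] [Algebra k F]

theorem ValuationSubring.aeval_mem (V : ValuationSubring F) (hV : ∀ c : k, algebraMap k F c ∈ V)
    {x : F} (hx : x ∈ V) (p : Polynomial k) : Polynomial.aeval x p ∈ V := by
  rw [Polynomial.aeval_eq_sum_range]
  refine _root_.sum_mem fun i _ => ?_
  rw [Algebra.smul_def]
  exact MulMemClass.mul_mem (hV _) (_root_.pow_mem hx i)

theorem ValuationSubring.algebraMap_notMem_nonunits (V : ValuationSubring F)
    (hV : ∀ c : k, algebraMap k F c ∈ V) {c : k} (hc : c ≠ 0) : algebraMap k F c ∉ V.nonunits := by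
  intro h
  have := V.nonunits_mul_mem h (hV c⁻¹)
  rw [← map_mul, mul_inv_cancel₀ hc, map_one] at this
  exact V.one_notMem_nonunits this

/-- Nonzero constants are units of `V`, so a function has at most one constant value at a place. -/
theorem ValuationSubring.algebraMap_eq_of_sub_mem (V : ValuationSubring F)
    (hV : ∀ c : k, algebraMap k F c ∈ V) {h : F} {c d : k} (hc : h - algebraMap k F c ∈ V.nonunits)
    (hd : h - algebraMap k F d ∈ V.nonunits) : c = d := by
  by_contra hne
  apply V.algebraMap_notMem_nonunits hV (sub_ne_zero.mpr hne)
  have := V.nonunits.sub_mem hd hc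
  rw [map_sub]
  convert this using 1
  ring

/-- X - x₀ divides p - p(x₀): a polynomial in x takes the expected value at a place where x has
value x₀. -/
theorem ValuationSubring.aeval_sub_mem_nonunits (V : ValuationSubring F)
    (hV : ∀ c : k, algebraMap k F c ∈ V) {x : F} {x₀ : k} (hx : x - algebraMap k F x₀ ∈ V.nonunits)
    (p : Polynomial k) : Polynomial.aeval x p - algebraMap k F (p.eval x₀) ∈ V.nonunits := by
  have hxV : x ∈ V := by
    have := AddMemClass.add_mem (V.nonunits_subset hx) (hV x₀)
    simpa using this
  obtain ⟨q, hq⟩ := Polynomial.X_sub_C_dvd_sub_C_eval (a := x₀) (p := p)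
  have := congrArg (Polynomial.aeval x) hq
  simp only [map_sub, map_mul, Polynomial.aeval_X, Polynomial.aeval_C] at this
  rw [this]
  exact V.nonunits_mul_mem hx (V.aeval_mem hV hxV q)

/-- A proper ideal of the polynomials in a transcendental element lies in the maximal ideal of some
valuation ring. -/
theorem Transcendental.exists_valuationSubring_aeval_mem_nonunits {x : F} (hx : Transcendental k x)
    {q : Polynomial k} (hq : ¬ IsUnit q) :
    ∃ V : ValuationSubring F, (∀ c : k, algebraMap k F c ∈ V) ∧ x ∈ V ∧
      Polynomial.aeval x q ∈ V.nonunits := by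
  set A : Subring F := (Polynomial.aeval (R := k) x).range.toSubring with hA
  let qA : A := ⟨Polynomial.aeval x q, q, rfl⟩
  have hI : Ideal.span {qA} ≠ ⊤ := by
    intro h
    rw [Ideal.span_singleton_eq_top] at h
    obtain ⟨⟨b, r, hr⟩, hb⟩ := isUnit_iff_exists_inv.mp h
    apply hq
    refine isUnit_iff_exists_inv.mpr ⟨r, ?_⟩
    apply transcendental_iff_injective.mp hx
    rw [map_mul, map_one]
    exact (congrArg (_ * ·) hr).trans (congrArg Subtype.val hb)
  -- The existence theorem for valuation rings, applied to the ideal generated by q(x) in k[x]; that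
  -- ideal is proper because k[x] is a polynomial ring.
  obtain ⟨V, hV, hIV⟩ := Ideal.image_subset_nonunits_valuationSubring _ hI
  refine ⟨V, fun c => hV ⟨Polynomial.C c, by simp⟩, hV ⟨Polynomial.X, by simp⟩, hIV ?_⟩
  exact ⟨qA, Ideal.subset_span rfl, rfl⟩

/-- A quotient of polynomials in a transcendental element which lies in all valuation rings
containing that element is a polynomial. -/
theorem Transcendental.exists_aeval_eq_of_forall_mem {x : F} (hx : Transcendental k x) {s : F}
    {p q : Polynomial k} (hq : q ≠ 0) (h : s * Polynomial.aeval x q = Polynomial.aeval x p)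
    (hs : ∀ V : ValuationSubring F, (∀ c : k, algebraMap k F c ∈ V) → x ∈ V → s ∈ V) :
    ∃ r : Polynomial k, s = Polynomial.aeval x r := by
  have hinj := transcendental_iff_injective.mp hx
  obtain ⟨g, q', p', c, b, a, w, hg, hq', hp', hc, hab⟩ :=
    IsPrincipalIdealRing.exists_eq_mul_and_sum_eq_one (b := p) (c := (0 : Polynomial k)) hq
  obtain rfl : c = 0 := by simpa [hg] using hc
  rw [mul_zero, add_zero] at hab
  have hg0 : Polynomial.aeval x g ≠ 0 := fun h => hg (hinj (by simpa using h))
  have h' : s * Polynomial.aeval x q' = Polynomial.aeval x p' := by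
    rw [hp', hq', map_mul, map_mul] at h
    apply mul_left_cancel₀ hg0
    linear_combination h
  by_cases hu : IsUnit q'
  · obtain ⟨r, hr⟩ := isUnit_iff_exists_inv.mp hu
    refine ⟨p' * r, ?_⟩
    rw [map_mul, ← h', mul_assoc, ← map_mul, hr, map_one, mul_one]
  -- If the reduced denominator q' were not constant, it would vanish at some place where x is
  -- finite. There Bézout gives 1 = q'(x)(a s + b) with s regular, which is absurd.
  · exfalso
    obtain ⟨V, hV, hxV, hn⟩ := hx.exists_valuationSubring_aeval_mem_nonunits hu
    apply V.one_notMem_nonunits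
    have := congrArg (Polynomial.aeval x) hab
    simp only [map_add, map_mul, map_one] at this
    rw [← this, ← h']
    have := V.nonunits_mul_mem hn
      (AddMemClass.add_mem (MulMemClass.mul_mem (V.aeval_mem hV hxV a) (hs V hV hxV)) (V.aeval_mem hV hxV b))
    convert this using 1
    ring

theorem Transcendental.inv {x : F} (hx : Transcendental k x) : Transcendental k x⁻¹ := by
  intro h
  exact hx (by simpa using h.inv)

theorem Polynomial.aeval_reverse_inv_mul_pow {x : F} (hx : x ≠ 0) (p : Polynomial k) :
    Polynomial.aeval x⁻¹ p.reverse * x ^ p.natDegree = Polynomial.aeval x p := by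
  let := invertibleOfNonzero hx
  have := Polynomial.eval₂_reverse_mul_pow (algebraMap k F) x p
  rwa [invOf_eq_inv] at this

/-- At a pole of x the function x⁻¹ has value 0, so the reversed polynomial takes the leading
coefficient of p as its value. -/
theorem ValuationSubring.aeval_reverse_notMem_nonunits (V : ValuationSubring F)
    (hV : ∀ c : k, algebraMap k F c ∈ V) {x : F} (hx : x ∉ V) {p : Polynomial k} (hp : p ≠ 0) :
    Polynomial.aeval x⁻¹ p.reverse ∉ V.nonunits := by
  intro h
  have h0 : x⁻¹ - algebraMap k F 0 ∈ V.nonunits := by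
    simpa using V.inv_mem_nonunits_of_notMem hx
  have := V.aeval_sub_mem_nonunits hV h0 p.reverse
  have h2 := V.nonunits.sub_mem h this
  rw [sub_sub_cancel] at h2
  refine V.algebraMap_notMem_nonunits hV ?_ h2
  rw [← Polynomial.coeff_zero_eq_eval_zero, Polynomial.coeff_zero_reverse]
  simpa using hp

/-- At a pole of x, p(x) is a unit times x to the power deg p. If deg p = j + d + 1, cancelling the
unit would put x^(d+1), and then x itself, in `V`. -/
theorem ValuationSubring.natDegree_le_of_mul_inv_pow_mem (V : ValuationSubring F)
    (hV : ∀ c : k, algebraMap k F c ∈ V) {x : F} (hx : x ∉ V) {p : Polynomial k} (hp : p ≠ 0) {j : ℕ}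
    (h : Polynomial.aeval x p * x⁻¹ ^ j ∈ V) : p.natDegree ≤ j := by
  by_contra! hj
  have hx0 : x ≠ 0 := fun h => hx (h ▸ V.zero_mem)
  obtain ⟨d, hd⟩ := Nat.exists_eq_add_of_lt hj
  have h1 := V.inv_mem_of_notMem_nonunits (V.aeval_reverse_notMem_nonunits hV hx hp)
  have hr0 : Polynomial.aeval x⁻¹ p.reverse ≠ 0 := by
    intro h0
    apply V.aeval_reverse_notMem_nonunits hV hx hp
    rw [h0]
    exact V.nonunits.zero_mem
  rw [← Polynomial.aeval_reverse_inv_mul_pow hx0, hd] at h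
  have h2 := MulMemClass.mul_mem h h1
  have h3 : x ^ (d + 1) ∈ V := by
    convert h2 using 1
    rw [show j + d + 1 = (d + 1) + j by ring, pow_add x (d + 1) j, inv_pow]
    generalize Polynomial.aeval x⁻¹ p.reverse = r at hr0
    field_simp
  have h4 : x⁻¹ ^ d ∈ V := _root_.pow_mem (V.nonunits_subset (V.inv_mem_nonunits_of_notMem hx)) d
  apply hx
  convert MulMemClass.mul_mem h3 h4 using 1
  rw [inv_pow, pow_succ]
  field_simp

theorem Transcendental.exists_valuationSubring_notMem {x : F} (hx : Transcendental k x) :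
    ∃ V : ValuationSubring F, (∀ c : k, algebraMap k F c ∈ V) ∧ x ∉ V := by
  obtain ⟨V, hV, -, h⟩ := hx.inv.exists_valuationSubring_aeval_mem_nonunits
    (q := Polynomial.X) Polynomial.not_isUnit_X
  refine ⟨V, hV, ?_⟩
  rw [Polynomial.aeval_X, V.inv_mem_nonunits_iff] at h
  exact h.resolve_left fun h0 => hx (h0 ▸ isAlgebraic_zero)

end ValuationSubring

/-! ### Arithmetic of the model y² = f(x) -/

open Polynomial in
/-- The field `F` is generated over `k` by a transcendental element `x` and an element `y` outside
`k(x)` with `y² = f(x)`, where `f` is a squarefree polynomial. -/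
structure HyperellipticModel (k : Type*) {F : Type*} [Field k] [Field F] [Algebra k F] (x y : F)
    (f : k[X]) : Prop where
  transcendental : Transcendental k x
  y_sq : y ^ 2 = aeval x f
  squarefree : Squarefree f
  notMem : y ∉ IntermediateField.adjoin k {x}
  adjoin_eq_top : IntermediateField.adjoin k {x, y} = ⊤

namespace HyperellipticModel

open Polynomial

variable {k F : Type*} [Field k] [Field F] [Algebra k F] {x y : F} {f : k[X]}

theorem mem_of_mem (E : IntermediateField k F) (hx : x ∈ E) (p : k[X]) : aeval x p ∈ E := by
  rw [aeval_eq_sum_range]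
  exact sum_mem fun i _ => E.smul_mem (pow_mem hx i)

theorem comap_involution_mem (σ : F ≃ₐ[k] F) (V : ValuationSubring F)
    (hV : ∀ c : k, algebraMap k F c ∈ V) (c : k) :
    algebraMap k F c ∈ V.comap σ.toAlgHom.toRingHom := by
  rw [ValuationSubring.mem_comap]
  simpa using hV c

section

variable (m : HyperellipticModel k x y f)

include m

theorem aeval_injective : Function.Injective (aeval (R := k) x) :=
  transcendental_iff_injective.mp m.transcendental

theorem aeval_ne_zero {p : k[X]} (hp : p ≠ 0) : aeval x p ≠ 0 :=
  fun h => hp (m.aeval_injective (by simpa using h))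

theorem x_ne_zero : x ≠ 0 := fun h => m.transcendental (h ▸ isAlgebraic_zero)

theorem y_ne_zero : y ≠ 0 := fun h => m.notMem (h ▸ zero_mem _)

theorem ne_zero : f ≠ 0 := m.squarefree.ne_zero

theorem eq_zero_of_add_mul_eq_zero {a b : k[X]} (h : aeval x a + aeval x b * y = 0) :
    a = 0 ∧ b = 0 := by
  have hmem : ∀ p : k[X], aeval x p ∈ IntermediateField.adjoin k {x} := fun p =>
    mem_of_mem _ (IntermediateField.mem_adjoin_simple_self k x) p
  have hb : b = 0 := by
    by_contra hb
    apply m.notMem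
    have : y = -aeval x a / aeval x b := by
      rw [eq_div_iff (m.aeval_ne_zero hb)]
      linear_combination h
    rw [this]
    exact div_mem (neg_mem (hmem a)) (hmem b)
  subst hb
  refine ⟨m.aeval_injective ?_, rfl⟩
  simpa using h

theorem sq_sub_ne_zero {a b : k[X]} (h : aeval x a + aeval x b * y ≠ 0) :
    a ^ 2 - b ^ 2 * f ≠ 0 := by
  intro h0
  have h1 := congrArg (aeval x) h0
  simp only [map_sub, map_mul, map_pow, ← m.y_sq, map_zero] at h1
  have h2 : (aeval x a + aeval x b * y) * (aeval x a + aeval x (-b) * y) = 0 := by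
    rw [map_neg]
    linear_combination h1
  obtain ⟨ha, hb⟩ := m.eq_zero_of_add_mul_eq_zero ((mul_eq_zero.mp h2).resolve_left h)
  apply h
  rw [ha, neg_eq_zero.mp hb]
  simp

/-- F = k(x) + k(x)y. Closure under inversion comes from multiplying by the conjugate, with the norm
a² - b²f as new denominator. -/
theorem exists_mul_eq (h : F) :
    ∃ a b c : k[X], c ≠ 0 ∧ h * aeval x c = aeval x a + aeval x b * y := by
  have hh : h ∈ IntermediateField.adjoin k {x, y} := by
    rw [m.adjoin_eq_top]
    trivial
  induction hh using IntermediateField.adjoin_induction with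
  | mem z hz =>
    rcases hz with rfl | rfl
    · exact ⟨X, 0, 1, one_ne_zero, by simp⟩
    · exact ⟨0, 1, 1, one_ne_zero, by simp⟩
  | algebraMap c => exact ⟨C c, 0, 1, one_ne_zero, by simp⟩
  | add z w hz hw ihz ihw =>
    obtain ⟨a, b, c, hc, h1⟩ := ihz
    obtain ⟨a', b', c', hc', h2⟩ := ihw
    refine ⟨a * c' + a' * c, b * c' + b' * c, c * c', mul_ne_zero hc hc', ?_⟩
    simp only [map_add, map_mul]
    linear_combination aeval x c' * h1 + aeval x c * h2
  | inv z hz ih =>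
    obtain ⟨a, b, c, hc, h1⟩ := ih
    rcases eq_or_ne z 0 with rfl | hz0
    · exact ⟨0, 0, 1, one_ne_zero, by simp⟩
    have hne : aeval x a + aeval x b * y ≠ 0 := by
      rw [← h1]
      exact mul_ne_zero hz0 (m.aeval_ne_zero hc)
    refine ⟨a * c, -b * c, a ^ 2 - b ^ 2 * f, m.sq_sub_ne_zero hne, ?_⟩
    simp only [map_sub, map_mul, map_pow, ← m.y_sq, map_neg]
    rw [inv_mul_eq_iff_eq_mul₀ hz0]
    linear_combination (-aeval x a + aeval x b * y) * h1
  | mul z w hz hw ihz ihw =>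
    obtain ⟨a, b, c, hc, h1⟩ := ihz
    obtain ⟨a', b', c', hc', h2⟩ := ihw
    refine ⟨a * a' + b * b' * f, a * b' + a' * b, c * c', mul_ne_zero hc hc', ?_⟩
    simp only [map_add, map_mul, ← m.y_sq]
    linear_combination (w * aeval x c') * h1 + (aeval x a + aeval x b * y) * h2

/-- The hyperelliptic involution. -/
theorem exists_involution [CharZero k] : ∃ σ : F ≃ₐ[k] F, σ x = x ∧ σ y = -y := by
  set E := IntermediateField.adjoin k {x} with hE
  have hxE : x ∈ E := IntermediateField.mem_adjoin_simple_self k x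
  have hfE : aeval x f ∈ E := mem_of_mem _ hxE f
  have hy2 : aeval y (X ^ 2 - C (⟨aeval x f, hfE⟩ : E)) = 0 := by
    simp only [map_sub, map_pow, aeval_X, aeval_C, m.y_sq]
    exact sub_self _
  have hint : IsIntegral E y := ⟨_, monic_X_pow_sub_C _ two_ne_zero, by
    simpa only [aeval_def] using hy2⟩
  have htop : IntermediateField.adjoin E {y} = ⊤ := by
    rw [eq_top_iff]
    intro z _
    obtain ⟨a, b, c, hc, h⟩ := m.exists_mul_eq z
    have hmem : ∀ p : k[X], aeval x p ∈ IntermediateField.adjoin E {y} := fun p =>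
      (IntermediateField.adjoin E {y}).algebraMap_mem ⟨aeval x p, mem_of_mem _ hxE p⟩
    rw [← eq_div_iff (m.aeval_ne_zero hc)] at h
    rw [h]
    exact div_mem (add_mem (hmem a)
      (mul_mem (hmem b) (IntermediateField.mem_adjoin_simple_self E y))) (hmem c)
  have hle : (minpoly E y).natDegree ≤ 2 := by
    have := natDegree_le_of_dvd (minpoly.dvd E y hy2) (monic_X_pow_sub_C _ two_ne_zero).ne_zero
    rwa [natDegree_X_pow_sub_C] at this
  have hge : 2 ≤ (minpoly E y).natDegree := by
    rw [minpoly.two_le_natDegree_iff hint]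
    rintro ⟨z, hz⟩
    exact m.notMem (hz ▸ z.2)
  have hfin : Module.finrank E F = 2 := by
    rw [← IntermediateField.finrank_top', ← htop, IntermediateField.adjoin.finrank hint]
    omega
  have : Algebra.IsQuadraticExtension E F := { finrank_eq_two' := hfin }
  have : FiniteDimensional E F := Module.finite_of_finrank_eq_succ hfin
  have : CharZero E := charZero_of_injective_algebraMap (algebraMap k E).injective
  have hgal : IsGalois E F := inferInstance
  -- F is quadratic, hence Galois, over k(x); an automorphism that moves y must send it to the other
  -- square root of f(x).
  obtain ⟨σ, hσ⟩ : ∃ σ : F ≃ₐ[E] F, σ y ≠ y := by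
    by_contra! h
    have := (IsGalois.mem_bot_iff_fixed (F := E) y).mpr h
    obtain ⟨z, hz⟩ := IntermediateField.mem_bot.mp this
    exact m.notMem (hz ▸ z.2)
  refine ⟨σ.restrictScalars k, σ.commutes ⟨x, hxE⟩, ?_⟩
  have h1 : σ y ^ 2 = y ^ 2 := by
    rw [← map_pow, m.y_sq]
    exact σ.commutes ⟨aeval x f, hfE⟩
  exact (sq_eq_sq_iff_eq_or_eq_neg.mp h1).resolve_left hσ

theorem y_mem {V : ValuationSubring F} (hV : ∀ c : k, algebraMap k F c ∈ V) (hx : x ∈ V) : y ∈ V :=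
  V.mem_of_sq_mem (m.y_sq ▸ V.aeval_mem hV hx f)

/-- This says that k[x] + k[x]y is integrally closed. With h = (a + by)/c, both h + σh = 2a/c and (h
- σh)² = 4b²f/c² are regular wherever x is, so they are polynomials in x. As f is squarefree, the
second forces c to divide b, and the first then makes a/c a polynomial. -/
theorem eq_aeval_add_of_forall_mem [CharZero k] {h : F}
    (hfin : ∀ V : ValuationSubring F, (∀ c : k, algebraMap k F c ∈ V) → x ∈ V → h ∈ V) :
    ∃ a b : k[X], h = aeval x a + aeval x b * y := by
  obtain ⟨σ, hσx, hσy⟩ := m.exists_involution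
  obtain ⟨a, b, c, hc, hh⟩ := m.exists_mul_eq h
  have hσp : ∀ p : k[X], σ (aeval x p) = aeval x p := fun p => by
    rw [← aeval_algHom_apply, hσx]
  have hσh : σ h * aeval x c = aeval x a - aeval x b * y := by
    have := congrArg σ hh
    simp only [map_mul, map_add, hσp, hσy] at this
    linear_combination this
  have hfin' : ∀ V : ValuationSubring F, (∀ c : k, algebraMap k F c ∈ V) → x ∈ V → σ h ∈ V := by
    intro V hV hx
    have := hfin (V.comap σ.toAlgHom.toRingHom) (comap_involution_mem σ V hV)
      (by rw [ValuationSubring.mem_comap]; simpa [hσx] using hx)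
    rw [ValuationSubring.mem_comap] at this
    exact this
  obtain ⟨r, hr⟩ := m.transcendental.exists_aeval_eq_of_forall_mem (s := h + σ h)
    (p := 2 * a) (q := c) hc (by simp only [map_mul, map_ofNat]; linear_combination hh + hσh)
    fun V hV hx => V.add_mem _ _ (hfin V hV hx) (hfin' V hV hx)
  obtain ⟨t, ht⟩ := m.transcendental.exists_aeval_eq_of_forall_mem (s := (h - σ h) ^ 2)
    (p := 4 * b ^ 2 * f) (q := c ^ 2) (pow_ne_zero 2 hc) (by
      simp only [map_mul, map_ofNat, map_pow, ← m.y_sq]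
      linear_combination ((h - σ h) * aeval x c + 2 * aeval x b * y) * (hh - hσh))
    fun V hV hx => pow_mem (sub_mem (hfin V hV hx) (hfin' V hV hx)) 2
  have hpoly : c ^ 2 * t = 4 * b ^ 2 * f := by
    apply m.aeval_injective
    simp only [map_mul, map_pow, ← ht, map_ofNat, ← m.y_sq]
    linear_combination ((h - σ h) * aeval x c + 2 * aeval x b * y) * (hh - hσh)
  have hdvd : c ∣ b := by
    obtain ⟨g, c', b', z, u, v, w, hg, hc', hb', hz, huv⟩ :=
      IsPrincipalIdealRing.exists_eq_mul_and_sum_eq_one (b := b) (c := (0 : k[X])) hc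
    obtain rfl : z = 0 := (mul_eq_zero.mp hz.symm).resolve_left hg
    have hcop : IsCoprime c' b' := ⟨u, v, by rwa [mul_zero, add_zero] at huv⟩
    have h4 : IsUnit (4 : k[X]) := by
      rw [← map_ofNat C]
      exact isUnit_C.mpr (isUnit_iff_ne_zero.mpr (OfNat.ofNat_ne_zero 4))
    have h1 : c' ^ 2 * t = b' ^ 2 * (4 * f) := by
      apply mul_left_cancel₀ (pow_ne_zero 2 hg)
      rw [hc', hb'] at hpoly
      linear_combination hpoly
    have h2 : c' * c' ∣ f := by
      rw [← sq]
      have : c' ^ 2 ∣ 4 * f := (hcop.pow : IsCoprime (c' ^ 2) (b' ^ 2)).dvd_of_dvd_mul_left ⟨t, h1.symm⟩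
      exact (h4.dvd_mul_left).mp this
    have h3 : IsUnit c' := m.squarefree c' h2
    rw [hc', hb']
    exact mul_dvd_mul_left g (h3.dvd)
  obtain ⟨d, hd⟩ := hdvd
  have hc0 := m.aeval_ne_zero hc
  refine ⟨C (2⁻¹) * r, d, ?_⟩
  have e1 : 2 * aeval x a = aeval x r * aeval x c := by
    rw [← hr]
    linear_combination -hh - hσh
  have : CharZero F := charZero_of_injective_algebraMap (algebraMap k F).injective
  have h2 : (2 : F) ≠ 0 := two_ne_zero
  have e2 : aeval x (C (2⁻¹ : k) * r) * 2 = aeval x r := by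
    rw [map_mul, aeval_C, map_inv₀, map_ofNat]
    field_simp
  apply mul_right_cancel₀ hc0
  apply mul_right_cancel₀ h2
  rw [hd, map_mul] at hh
  linear_combination 2 * hh + e1 - aeval x c * e2

/-- Functions with poles only at infinity, of bounded order. -/
theorem eq_aeval_add_of_pole_le [CharZero k] {h : F} {j : ℕ}
    (hfin : ∀ V : ValuationSubring F, (∀ c : k, algebraMap k F c ∈ V) → x ∈ V → h ∈ V)
    (hinf : ∀ V : ValuationSubring F, (∀ c : k, algebraMap k F c ∈ V) → x ∉ V → h * x⁻¹ ^ j ∈ V) :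
    ∃ a b : k[X], h = aeval x a + aeval x b * y ∧ a.natDegree ≤ j ∧
      (b ≠ 0 → 2 * b.natDegree + f.natDegree ≤ 2 * j) := by
  obtain ⟨σ, hσx, hσy⟩ := m.exists_involution
  obtain ⟨a, b, hh⟩ := m.eq_aeval_add_of_forall_mem hfin
  have hσp : ∀ p : k[X], σ (aeval x p) = aeval x p := fun p => by
    rw [← aeval_algHom_apply, hσx]
  -- One pole of x and its image under the involution suffice: the degree bounds are read off at `V`
  -- from h + σh = 2a and (h - σh)² = 4b²f.
  obtain ⟨V, hV, hxV⟩ := m.transcendental.exists_valuationSubring_notMem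
  have hσh : σ h = aeval x a - aeval x b * y := by
    rw [hh]
    simp only [map_mul, map_add, hσp, hσy]
    ring
  have h1 := hinf V hV hxV
  have h2 : σ h * x⁻¹ ^ j ∈ V := by
    have := hinf (V.comap σ.toAlgHom.toRingHom) (comap_involution_mem σ V hV)
      (by rw [ValuationSubring.mem_comap]; simpa [hσx] using hxV)
    rw [ValuationSubring.mem_comap] at this
    simpa [hσx] using this
  have h2k : (2 : k) ≠ 0 := two_ne_zero
  have h4k : (4 : k) ≠ 0 := (OfNat.ofNat_ne_zero 4)
  refine ⟨a, b, hh, ?_, fun hb => ?_⟩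
  · rcases eq_or_ne a 0 with rfl | ha
    · simp
    rw [← natDegree_C_mul h2k]
    refine V.natDegree_le_of_mul_inv_pow_mem hV hxV (mul_ne_zero (by simp) ha) ?_
    convert V.add_mem _ _ h1 h2 using 1
    rw [hσh, hh, map_mul, aeval_C, map_ofNat]
    ring
  · have hbf : b ^ 2 * f ≠ 0 := mul_ne_zero (pow_ne_zero 2 hb) m.ne_zero
    have : (C 4 * (b ^ 2 * f)).natDegree ≤ j + j := by
      refine V.natDegree_le_of_mul_inv_pow_mem hV hxV (mul_ne_zero (by simp) hbf) ?_
      convert pow_mem (sub_mem h1 h2) 2 using 1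
      rw [hσh, hh, map_mul, aeval_C, map_ofNat, map_mul, map_pow, ← m.y_sq]
      ring
    rw [natDegree_C_mul h4k, natDegree_mul (pow_ne_zero 2 hb) m.ne_zero, natDegree_pow] at this
    omega

/-- An element of a valuation ring containing `x` is a quotient of elements of `k[x, y]`, with a
denominator which is a unit. -/
theorem exists_mul_eq_of_mem [CharZero k] {V : ValuationSubring F}
    (hV : ∀ c : k, algebraMap k F c ∈ V) (hx : x ∈ V) {h : F} (hh : h ∈ V) :
    ∃ a b c d : k[X], aeval x c + aeval x d * y ∉ V.nonunits ∧
      h * (aeval x c + aeval x d * y) = aeval x a + aeval x b * y := by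
  obtain ⟨a, b, c, hc, e⟩ := m.exists_mul_eq h
  -- α, β, γ are the coefficients c², -2ac, a² - b²f of the quadratic equation of h over k[x], with
  -- their common factor removed.
  obtain ⟨g, α, β, γ, u, v, w, hg, hα, hβ, hγ, huv⟩ :=
    IsPrincipalIdealRing.exists_eq_mul_and_sum_eq_one (b := -2 * a * c) (c := a ^ 2 - b ^ 2 * f)
      (pow_ne_zero 2 hc)
  have hquad : aeval x α * h ^ 2 + aeval x β * h + aeval x γ = 0 := by
    apply ((mul_eq_zero (a := aeval x g)).mp ?_).resolve_left (m.aeval_ne_zero hg)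
    have h1 := congrArg (aeval x) hα
    have h2 := congrArg (aeval x) hβ
    have h3 := congrArg (aeval x) hγ
    simp only [map_mul, map_pow, map_sub, map_neg, map_ofNat, ← m.y_sq] at h1 h2 h3
    linear_combination -h ^ 2 * h1 - h * h2 - h3 +
      (h * aeval x c - aeval x a + aeval x b * y) * e
  -- αh is a root of T² + βT + αγ, hence integral over k[x].
  obtain ⟨a₁, b₁, e₁⟩ := m.eq_aeval_add_of_forall_mem (h := aeval x α * h) fun W hW hxW =>
    W.mem_of_sq_add_mul_add_eq_zero (W.aeval_mem hW hxW β) (W.aeval_mem hW hxW (α * γ)) (by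
      rw [map_mul]
      linear_combination aeval x α * hquad)
  -- Either α is a unit at `V` and serves as denominator, or h = -γ/(αh + β). In the second case αh
  -- + β must be a unit: otherwise α, β and γ would all vanish at `V`, although they generate the
  -- unit ideal.
  by_cases hs : aeval x α ∈ V.nonunits
  · refine ⟨-γ, 0, a₁ + β, b₁, fun hs' => ?_, ?_⟩
    · apply V.one_notMem_nonunits
      have e2 := congrArg (aeval x) huv
      simp only [map_add, map_mul, map_one] at e2
      rw [← e2]
      have h1 : aeval x α * h + aeval x β ∈ V.nonunits := by
        convert hs' using 1
        rw [e₁, map_add]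
        ring
      have h2 : aeval x β ∈ V.nonunits := by
        have := V.nonunits.sub_mem h1 (V.nonunits_mul_mem hs hh)
        simpa using this
      have h3 : aeval x γ ∈ V.nonunits := by
        have := V.nonunits.neg_mem (V.nonunits_mul_mem h1 hh)
        convert this using 1
        linear_combination hquad
      have key : ∀ p q : k[X], aeval x q ∈ V.nonunits → aeval x p * aeval x q ∈ V.nonunits :=
        fun p q hq => by
          rw [mul_comm]
          exact V.nonunits_mul_mem hq (V.aeval_mem hV hx p)
      exact V.nonunits.add_mem (V.nonunits.add_mem (key _ _ hs) (key _ _ h2)) (key _ _ h3)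
    · simp only [map_neg, map_add, map_zero]
      linear_combination hquad - h * e₁
  · refine ⟨a₁, b₁, α, 0, by simpa using hs, ?_⟩
    rw [← e₁]
    simp [mul_comm]

/-- Every element of `V` is a fraction over k[x, y] with denominator a unit of `V`; the hypothesis
makes that denominator a unit of `W` as well. -/
theorem le_of_nonunits [CharZero k] {V W : ValuationSubring F}
    (hV : ∀ c : k, algebraMap k F c ∈ V) (hW : ∀ c : k, algebraMap k F c ∈ W)
    (hxV : x ∈ V) (hxW : x ∈ W)
    (h : ∀ a b : k[X], aeval x a + aeval x b * y ∈ W.nonunits →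
      aeval x a + aeval x b * y ∈ V.nonunits) : V ≤ W := by
  intro z hz
  obtain ⟨a, b, c, d, hs, e⟩ := m.exists_mul_eq_of_mem hV hxV hz
  have hs' := W.inv_mem_of_notMem_nonunits (mt (h c d) hs)
  have hs0 : aeval x c + aeval x d * y ≠ 0 := fun h0 => hs (h0 ▸ V.nonunits.zero_mem)
  have hnum : aeval x a + aeval x b * y ∈ W :=
    W.add_mem _ _ (W.aeval_mem hW hxW a) (W.mul_mem _ _ (W.aeval_mem hW hxW b) (m.y_mem hW hxW))
  rw [← e] at hnum
  have := W.mul_mem _ _ hnum hs'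
  rwa [mul_inv_cancel_right₀ hs0] at this

/-- A rational point of the affine curve lies in the centre of at most one valuation ring. -/
theorem valuationSubring_eq [CharZero k] {V W : ValuationSubring F}
    (hV : ∀ c : k, algebraMap k F c ∈ V) (hW : ∀ c : k, algebraMap k F c ∈ W) {x₀ y₀ : k}
    (hxV : x - algebraMap k F x₀ ∈ V.nonunits) (hyV : y - algebraMap k F y₀ ∈ V.nonunits)
    (hxW : x - algebraMap k F x₀ ∈ W.nonunits) (hyW : y - algebraMap k F y₀ ∈ W.nonunits) :
    V = W := by
  have mem : ∀ U : ValuationSubring F, (∀ c : k, algebraMap k F c ∈ U) → ∀ z c,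
      z - algebraMap k F c ∈ U.nonunits → z ∈ U := fun U hU z c hz => by
    have := U.add_mem _ _ (U.nonunits_subset hz) (hU c)
    simpa using this
  -- Whether a + by vanishes at such a place depends only on the number a(x₀) + b(x₀)y₀, so the two
  -- places have the same centre on the affine curve.
  have value : ∀ U : ValuationSubring F, (∀ c : k, algebraMap k F c ∈ U) →
      x - algebraMap k F x₀ ∈ U.nonunits → y - algebraMap k F y₀ ∈ U.nonunits → ∀ a b : k[X],
      (aeval x a + aeval x b * y) - algebraMap k F (a.eval x₀ + b.eval x₀ * y₀) ∈ U.nonunits := by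
    intro U hU h1 h2 a b
    have h3 := U.nonunits.add_mem (U.aeval_sub_mem_nonunits hU h1 a)
      (U.nonunits.add_mem (U.nonunits_mul_mem (U.aeval_sub_mem_nonunits hU h1 b) (mem U hU _ _ h2))
        (U.nonunits_mul_mem h2 (hU (b.eval x₀))))
    convert h3 using 1
    rw [map_add, map_mul]
    ring
  have key : ∀ U U' : ValuationSubring F, (∀ c : k, algebraMap k F c ∈ U) →
      (∀ c : k, algebraMap k F c ∈ U') →
      x - algebraMap k F x₀ ∈ U.nonunits → y - algebraMap k F y₀ ∈ U.nonunits →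
      x - algebraMap k F x₀ ∈ U'.nonunits → y - algebraMap k F y₀ ∈ U'.nonunits → U ≤ U' := by
    intro U U' hU hU' h1 h2 h3 h4
    refine m.le_of_nonunits hU hU' (mem U hU _ _ h1) (mem U' hU' _ _ h3) fun a b hab => ?_
    have e : a.eval x₀ + b.eval x₀ * y₀ = 0 := by
      by_contra hne
      apply U'.algebraMap_notMem_nonunits hU' hne
      have := U'.nonunits.sub_mem hab (value U' hU' h3 h4 a b)
      simpa using this
    have := value U hU h1 h2 a b
    rwa [e, map_zero, sub_zero] at this
  exact le_antisymm (key V W hV hW hxV hyV hxW hyW) (key W V hW hV hxW hyW hxV hyV)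

end

end HyperellipticModel

/-! ### Squarefree parts and reversal of polynomials -/

namespace Polynomial

variable {k : Type*} [Field k]

theorem exists_eq_sq_mul_squarefree {p : k[X]} (hp : p ≠ 0) :
    ∃ s f : k[X], s ≠ 0 ∧ Squarefree f ∧ p = s ^ 2 * f := by
  induction hn : p.natDegree using Nat.strong_induction_on generalizing p with
  | _ n ih =>
    by_cases hsq : Squarefree p
    · exact ⟨1, p, one_ne_zero, hsq, by ring⟩
    · simp only [Squarefree, not_forall] at hsq
      obtain ⟨q, ⟨r, hr⟩, hq⟩ := hsq
      have hq0 : q ≠ 0 := by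
        rintro rfl
        exact hp (by simpa using hr)
      have hr0 : r ≠ 0 := by
        rintro rfl
        exact hp (by simpa using hr)
      have hdeg : 0 < q.natDegree := by
        rw [Nat.pos_iff_ne_zero]
        intro h
        exact hq (isUnit_iff_degree_eq_zero.mpr (by
          rw [degree_eq_natDegree hq0, h, Nat.cast_zero]))
      have hd : p.natDegree = q.natDegree + q.natDegree + r.natDegree := by
        rw [hr, natDegree_mul (mul_ne_zero hq0 hq0) hr0, natDegree_mul hq0 hq0]
      obtain ⟨s, f, hs, hf, e⟩ := ih r.natDegree (by omega) hr0 rfl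
      exact ⟨q * s, f, mul_ne_zero hq0 hs, hf, by rw [hr, e]; ring⟩

/-- Reversing twice only strips the powers of X, so p² dividing the reversal makes the square of
p.reverse divide f. Since the reversal has nonzero constant term, p(0) ≠ 0 and p has the same degree
as p.reverse, which is a unit. -/
theorem squarefree_reverse {f : k[X]} (hf : Squarefree f) : Squarefree f.reverse := by
  have hf0 : f ≠ 0 := hf.ne_zero
  rintro p ⟨q, hq⟩
  have hq' := congrArg reverse hq
  rw [reverse_mul_of_domain, reverse_mul_of_domain] at hq'
  have hp0 : p.coeff 0 ≠ 0 := by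
    intro h
    have := congrArg (coeff · 0) hq
    simp only [coeff_zero_reverse, mul_coeff_zero, h, zero_mul] at this
    exact hf0 (by simpa using this)
  have hrr : f.reverse.reverse * X ^ f.natTrailingDegree = f := by
    have h1 : f.natTrailingDegree ≤ f.natDegree := natTrailingDegree_le_natDegree f
    ext i
    rw [coeff_mul_X_pow', coeff_reverse, coeff_reverse, reverse_natDegree]
    split_ifs with hi
    · by_cases hi' : i ≤ f.natDegree
      · have e : revAt (f.natDegree - f.natTrailingDegree) (i - f.natTrailingDegree) =
            f.natDegree - i := by
          rw [revAt_le (by omega)]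
          omega
        rw [e, revAt_le (by omega)]
        congr 1
        omega
      · have e : revAt (f.natDegree - f.natTrailingDegree) (i - f.natTrailingDegree) =
            i - f.natTrailingDegree := revAt_eq_self_of_lt (by omega)
        rw [coeff_eq_zero_of_natDegree_lt (p := f) (n := i) (by omega), e]
        by_cases h3 : i - f.natTrailingDegree ≤ f.natDegree
        · rw [revAt_le h3]
          exact coeff_eq_zero_of_lt_natTrailingDegree (by omega)
        · rw [revAt_eq_self_of_lt (by omega)]
          exact coeff_eq_zero_of_natDegree_lt (by omega)
    · exact (coeff_eq_zero_of_lt_natTrailingDegree (by omega)).symm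
  have hdvd : p.reverse * p.reverse ∣ f := by
    rw [← hrr, hq']
    rw [mul_assoc]
    exact dvd_mul_right _ _
  have hu := hf _ hdvd
  have h0 : p.natTrailingDegree = 0 := natTrailingDegree_eq_zero.mpr (Or.inr hp0)
  have hd := natDegree_eq_zero_of_isUnit hu
  rw [reverse_natDegree, h0, tsub_zero] at hd
  rw [eq_C_of_natDegree_eq_zero hd]
  exact isUnit_C.mpr (isUnit_iff_ne_zero.mpr hp0)

end Polynomial

/-! ### The model at infinity and models of even degree -/

namespace HyperellipticModel

open Polynomial

variable {k F : Type*} [Field k] [Field F] [Algebra k F] {x y : F} {f : k[X]}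

/-- The model in the coordinates at infinity. -/
theorem reverse (m : HyperellipticModel k x y f) {n : ℕ} (hn : f.natDegree = 2 * n) :
    HyperellipticModel k x⁻¹ (y * x⁻¹ ^ n) f.reverse where
  transcendental := m.transcendental.inv
  y_sq := by
    have h0 := m.x_ne_zero
    rw [mul_pow, m.y_sq, ← aeval_reverse_inv_mul_pow h0, hn]
    rw [mul_assoc, ← pow_mul, mul_comm n 2, ← mul_pow, mul_inv_cancel₀ h0, one_pow, mul_one]
  squarefree := squarefree_reverse m.squarefree
  notMem h := by
    apply m.notMem
    have hx := IntermediateField.mem_adjoin_simple_self k x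
    have hle : IntermediateField.adjoin k {x⁻¹} ≤ IntermediateField.adjoin k {x} := by
      rw [IntermediateField.adjoin_simple_le_iff]
      exact inv_mem hx
    have := mul_mem (hle h) (pow_mem hx n)
    rwa [mul_assoc, ← mul_pow, inv_mul_cancel₀ m.x_ne_zero, one_pow, mul_one] at this
  adjoin_eq_top := by
    rw [eq_top_iff, ← m.adjoin_eq_top, IntermediateField.adjoin_le_iff]
    have hx : x ∈ IntermediateField.adjoin k {x⁻¹, y * x⁻¹ ^ n} := by
      have : x⁻¹ ∈ IntermediateField.adjoin k {x⁻¹, y * x⁻¹ ^ n} :=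
        IntermediateField.subset_adjoin _ _ (by simp)
      simpa using inv_mem this
    have hy : y * x⁻¹ ^ n ∈ IntermediateField.adjoin k {x⁻¹, y * x⁻¹ ^ n} :=
      IntermediateField.subset_adjoin _ _ (by simp)
    rintro z (rfl | rfl)
    · exact hx
    · have := mul_mem hy (pow_mem hx n)
      rwa [mul_assoc, ← mul_pow, inv_mul_cancel₀ m.x_ne_zero, one_pow, mul_one] at this

/-- A quadratic extension of a rational function field has a model of even degree. -/
theorem exists_of_finrank_eq_two [CharZero k] {x : F} (hx : Transcendental k x)
    (h2 : Module.finrank (IntermediateField.adjoin k {x}) F = 2) :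
    ∃ (x y : F) (f : k[X]) (n : ℕ), HyperellipticModel k x y f ∧ f.natDegree = 2 * n := by
  set E := IntermediateField.adjoin k {x} with hE
  have hxE : x ∈ E := IntermediateField.mem_adjoin_simple_self k x
  have hfd : FiniteDimensional E F := Module.finite_of_finrank_eq_succ h2
  have : CharZero F := charZero_of_injective_algebraMap (algebraMap k F).injective
  obtain ⟨α, hα⟩ : ∃ α : F, α ∉ E := by
    by_contra! h
    have hs : Function.Surjective (algebraMap E F) := fun z => ⟨⟨z, h z⟩, rfl⟩
    have := LinearEquiv.finrank_eq (LinearEquiv.ofBijective (Algebra.linearMap E F)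
      ⟨(algebraMap E F).injective, hs⟩)
    rw [Module.finrank_self, h2] at this
    omega
  -- Completing the square: if α² + bα + c = 0, then y₀ = 2α + b has square b² - 4c.
  obtain ⟨y₀, hy₀, d, hd⟩ : ∃ y₀ : F, y₀ ∉ E ∧ ∃ d ∈ E, y₀ ^ 2 = d := by
    have hint : IsIntegral E α := .of_finite E α
    have hle : (minpoly E α).natDegree ≤ 2 := h2 ▸ minpoly.natDegree_le α
    have hge : 2 ≤ (minpoly E α).natDegree := by
      rw [minpoly.two_le_natDegree_iff hint]
      rintro ⟨z, hz⟩
      exact hα (hz ▸ z.2)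
    have hdeg : (minpoly E α).natDegree = 2 := le_antisymm hle hge
    have h0 := minpoly.aeval E α
    have hlead : (minpoly E α).coeff 2 = 1 := by
      rw [← hdeg]
      exact minpoly.monic hint
    rw [aeval_eq_sum_range, hdeg] at h0
    simp only [Finset.sum_range_succ, Finset.sum_range_zero, hlead, zero_add, pow_zero, pow_one,
      Algebra.smul_def, mul_one] at h0
    set b : E := (minpoly E α).coeff 1
    set c : E := (minpoly E α).coeff 0
    have h0' : (c : F) + b * α + α ^ 2 = 0 := by
      rw [map_one, one_mul] at h0
      exact h0
    refine ⟨2 * α + b, fun h => hα ?_, (b : F) ^ 2 - 4 * c, ?_, by linear_combination 4 * h0'⟩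
    · have h3 : (2 : F)⁻¹ * (2 * α + b - b) ∈ E :=
        mul_mem (inv_mem (ofNat_mem E 2)) (sub_mem h b.2)
      rwa [add_sub_cancel_right, inv_mul_cancel_left₀ two_ne_zero] at h3
    · exact sub_mem (pow_mem b.2 2) (mul_mem (ofNat_mem E 4) c.2)
  obtain ⟨hdE, hd⟩ := hd
  have hinj := transcendental_iff_injective.mp hx
  obtain ⟨p, q, hpq⟩ := (IntermediateField.mem_adjoin_simple_iff k d).mp hdE
  have hy0 : y₀ ≠ 0 := fun h => hy₀ (h ▸ zero_mem _)
  have hd0 : d ≠ 0 := hd ▸ pow_ne_zero 2 hy0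
  have hp : p ≠ 0 := by
    rintro rfl
    exact hd0 (by simpa using hpq)
  have hq : q ≠ 0 := by
    rintro rfl
    exact hd0 (by simpa using hpq)
  have ne : ∀ {r : k[X]}, r ≠ 0 → aeval x r ≠ 0 := fun hr h => hr (hinj (by simpa using h))
  set g := p * q with hg
  have hg0 : g ≠ 0 := mul_ne_zero hp hq
  -- With d = p(x)/q(x), the square of q(x)y₀ is g(x). A point c that is not a zero of g is moved to
  -- infinity by x' = 1/(x - c); infinity is then unramified, and this makes the degree even.
  obtain ⟨c, hc⟩ : ∃ c : k, g.eval c ≠ 0 := by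
    by_contra! h
    exact hg0 (Polynomial.funext fun r => by simpa using h r)
  have hxc : x - algebraMap k F c ≠ 0 := by
    intro h
    apply hx
    rw [sub_eq_zero.mp h]
    exact isAlgebraic_algebraMap c
  set g₁ := g.comp (X + C c) with hg₁
  have hg₁0 : g₁.coeff 0 ≠ 0 := by
    rw [coeff_zero_eq_eval_zero, hg₁, eval_comp]
    simpa using hc
  have hy₁ : (aeval x q * y₀) ^ 2 = aeval (x - algebraMap k F c) g₁ := by
    rw [hg₁, aeval_comp, map_add, aeval_X, aeval_C, sub_add_cancel, mul_pow, hd, hpq, hg, map_mul]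
    have := ne hq
    field_simp
  set x' := (x - algebraMap k F c)⁻¹ with hx'
  set N := g₁.natDegree with hN
  -- This polynomial in x' is the square of q(x)y₀x'^N. Its degree is exactly 2N because g₁(0) ≠ 0,
  -- and removing a square factor keeps the degree even.
  have hg₂0 : g₁.reverse * X ^ N ≠ 0 := by
    refine mul_ne_zero ?_ (pow_ne_zero _ X_ne_zero)
    rw [Ne, reverse_eq_zero]
    intro h
    rw [h] at hg₁0
    simp at hg₁0
  obtain ⟨s, f, hs, hf, hsf⟩ := exists_eq_sq_mul_squarefree hg₂0
  have htr : Transcendental k x' := by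
    apply Transcendental.inv
    intro h
    apply hx
    have := h.add (isAlgebraic_algebraMap c)
    simpa using this
  have hs' : aeval x' s ≠ 0 := fun h =>
    hs (transcendental_iff_injective.mp htr (by simpa using h))
  have hx'0 : x' ≠ 0 := inv_ne_zero hxc
  have hdeg : f.natDegree = 2 * (N - s.natDegree) := by
    have h1 := congrArg natDegree hsf
    rw [natDegree_mul (left_ne_zero_of_mul hg₂0) (right_ne_zero_of_mul hg₂0), reverse_natDegree,
      natTrailingDegree_eq_zero.mpr (Or.inr hg₁0), natDegree_X_pow,
      natDegree_mul (pow_ne_zero 2 hs) hf.ne_zero, natDegree_pow] at h1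
    omega
  have hx'E : x' ∈ E := inv_mem (sub_mem hxE (E.algebraMap_mem c))
  have hyE : aeval x q * y₀ * x' ^ N / aeval x' s ∉ E := by
    intro h
    apply hy₀
    have h1 := mul_mem (mul_mem h (mem_of_mem E hx'E s))
      (inv_mem (mul_mem (mem_of_mem E hxE q) (pow_mem hx'E N)))
    convert h1 using 1
    have := ne hq
    field_simp
  refine ⟨x', aeval x q * y₀ * x' ^ N / aeval x' s, f, N - s.natDegree,
    ⟨htr, ?_, hf, fun h => hyE ?_, ?_⟩, hdeg⟩
  · have h1 := congrArg (aeval x') hsf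
    simp only [map_mul, map_pow, aeval_X] at h1
    have h3 := aeval_reverse_inv_mul_pow hxc g₁
    rw [div_pow, div_eq_iff (pow_ne_zero 2 hs'), mul_pow, hy₁, ← h3, ← hx', ← hN]
    have h4 : (x - algebraMap k F c) ^ N * x' ^ N = 1 := by
      rw [← mul_pow, hx', mul_inv_cancel₀ hxc, one_pow]
    linear_combination h1 + aeval x' g₁.reverse * x' ^ N * h4
  · have hle : IntermediateField.adjoin k {x'} ≤ E := by
      rw [IntermediateField.adjoin_simple_le_iff]
      exact hx'E
    exact hle h
  · set y := aeval x q * y₀ * x' ^ N / aeval x' s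
    have hx'L : x' ∈ IntermediateField.adjoin k {x', y} :=
      IntermediateField.subset_adjoin _ _ (by simp)
    have hyL : y ∈ IntermediateField.adjoin k {x', y} :=
      IntermediateField.subset_adjoin _ _ (by simp)
    have hEL : E ≤ IntermediateField.adjoin k {x', y} := by
      rw [hE, IntermediateField.adjoin_simple_le_iff]
      have := add_mem (inv_mem hx'L) (IntermediateField.algebraMap_mem _ c)
      rwa [hx', inv_inv, sub_add_cancel] at this
    have : IsSimpleOrder (IntermediateField E F) :=
      IntermediateField.isSimpleOrder_of_finrank_prime E F (by rw [h2]; exact Nat.prime_two)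
    rcases eq_bot_or_eq_top (IntermediateField.extendScalars hEL) with h | h
    · exfalso
      have h1 : y ∈ IntermediateField.extendScalars hEL := hyL
      rw [h] at h1
      obtain ⟨z, hz⟩ := IntermediateField.mem_bot.mp h1
      exact hyE (hz ▸ z.2)
    · rw [eq_top_iff]
      intro z _
      have : z ∈ IntermediateField.extendScalars hEL := by
        rw [h]
        trivial
      exact this

end HyperellipticModel

/-! ### Base change and regular differentials of the model -/

namespace HyperellipticModel

open Polynomial

section BaseChange

variable {k F : Type*} [Field k] [Field F] [Algebra k F] {x y : F} {f : k[X]}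

/-- In lowest terms y = r/s gives s²f = r². Coprimality makes s a unit, then r² divides f and
squarefreeness makes r, and so f, a unit. -/
theorem notMem_of_squarefree {x y : F} {f : k[X]} (hx : Transcendental k x)
    (hy : y ^ 2 = aeval x f) (hf : Squarefree f) (hdeg : 0 < f.natDegree) :
    y ∉ IntermediateField.adjoin k {x} := by
  intro h
  have hinj := transcendental_iff_injective.mp hx
  have ne : ∀ {r : k[X]}, r ≠ 0 → aeval x r ≠ 0 := fun hr h => hr (hinj (by simpa using h))
  obtain ⟨r, s, hrs⟩ := (IntermediateField.mem_adjoin_simple_iff k y).mp h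
  have hy0 : y ≠ 0 := by
    rintro rfl
    exact ne hf.ne_zero (by rw [← hy]; simp)
  have hs : s ≠ 0 := by
    rintro rfl
    exact hy0 (by simpa using hrs)
  obtain ⟨g, s', r', z, u, v, w, hg, hs', hr', hz, huv⟩ :=
    IsPrincipalIdealRing.exists_eq_mul_and_sum_eq_one (b := r) (c := (0 : k[X])) hs
  obtain rfl : z = 0 := (mul_eq_zero.mp hz.symm).resolve_left hg
  have hcop : IsCoprime s' r' := ⟨u, v, by rwa [mul_zero, add_zero] at huv⟩
  have h1 : s' ^ 2 * f = r' ^ 2 := by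
    apply mul_left_cancel₀ (pow_ne_zero 2 hg)
    apply hinj
    have h2 : y * aeval x s = aeval x r := by rw [hrs, div_mul_cancel₀ _ (ne hs)]
    have h3 : (y * aeval x s) ^ 2 = aeval x r ^ 2 := by rw [h2]
    rw [mul_pow, hy, ← map_pow, ← map_pow, ← map_mul, hs', hr'] at h3
    rw [← mul_assoc, ← mul_pow, ← mul_pow, ← h3]
    congr 1
    ring
  have hs'u : IsUnit s' := by
    have : IsUnit (s' ^ 2) := by
      have h2 : IsCoprime (s' ^ 2) (r' ^ 2) := hcop.pow
      rw [← h1] at h2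
      exact h2.isUnit_of_dvd' dvd_rfl (dvd_mul_right _ _)
    exact (isUnit_pow_iff two_ne_zero).mp this
  have hr'u : IsUnit r' := by
    apply hf r'
    rw [← sq, ← h1]
    exact ((hs'u.pow 2).mul_left_dvd).mpr dvd_rfl
  have hfu : IsUnit f := isUnit_of_mul_isUnit_right (h1 ▸ hr'u.pow 2)
  rw [natDegree_eq_zero_of_isUnit hfu] at hdeg
  exact lt_irrefl _ hdeg

/-- In characteristic zero squarefree means separable, which survives field extension; positive
degree then keeps y outside k'(x) even when k' is algebraically closed. -/
theorem baseChange {k' F' : Type*} [Field k'] [Field F'] [Algebra k k'] [Algebra F F']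
    [Algebra k' F'] [Algebra k F'] [IsScalarTower k F F'] [IsScalarTower k k' F']
    [Algebra.IsAlgebraic k k'] [CharZero k]
    (m : HyperellipticModel k x y f) (hdeg : 0 < f.natDegree)
    (hgen : IntermediateField.adjoin k' (Set.range (algebraMap F F')) = ⊤) :
    HyperellipticModel k' (algebraMap F F' x) (algebraMap F F' y) (f.map (algebraMap k k')) := by
  have htr : Transcendental k' (algebraMap F F' x) := by
    intro h
    have h1 : IsAlgebraic k (algebraMap F F' x) := h.restrictScalars k
    exact m.transcendental ((isAlgebraic_algebraMap_iff (algebraMap F F').injective).mp h1)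
  have hsq : Squarefree (f.map (algebraMap k k')) := by
    have h1 : f.Separable := PerfectField.separable_iff_squarefree.mpr m.squarefree
    exact h1.map.squarefree
  have hy : algebraMap F F' y ^ 2 = aeval (algebraMap F F' x) (f.map (algebraMap k k')) := by
    rw [aeval_map_algebraMap, aeval_algebraMap_apply, ← m.y_sq, map_pow]
  refine ⟨htr, hy, hsq, notMem_of_squarefree htr hy hsq (by rwa [natDegree_map]), ?_⟩
  rw [eq_top_iff, ← hgen, IntermediateField.adjoin_le_iff]
  rintro _ ⟨z, rfl⟩
  obtain ⟨a, b, c, hc, h⟩ := m.exists_mul_eq z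
  set L := IntermediateField.adjoin k' {algebraMap F F' x, algebraMap F F' y}
  have hxL : algebraMap F F' x ∈ L := IntermediateField.subset_adjoin _ _ (by simp)
  have hyL : algebraMap F F' y ∈ L := IntermediateField.subset_adjoin _ _ (by simp)
  have hp : ∀ p : k[X], algebraMap F F' (aeval x p) ∈ L := fun p => by
    rw [← aeval_algebraMap_apply, ← aeval_map_algebraMap k']
    exact mem_of_mem L hxL _
  have hc0 : algebraMap F F' (aeval x c) ≠ 0 := (_root_.map_ne_zero _).mpr (m.aeval_ne_zero hc)
  have h' := congrArg (algebraMap F F') h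
  rw [map_mul, map_add, map_mul, ← eq_div_iff hc0] at h'
  rw [SetLike.mem_coe, h']
  exact div_mem (add_mem (hp a) (mul_mem (hp b) hyL)) (hp c)

end BaseChange

section Differentials

variable {k F : Type*} [Field k] [Field F] [Algebra k F] [CharZero k] {x y : F} {f : k[X]}

-- Differentiating y² = f(x) gives 2y dy = f'(x) dx, which settles the elements of k[x, y]. The
-- quotient rule extends this to the local ring, as denominators can be chosen to be units of `V`.
open KaehlerDifferential in
theorem exists_y_smul_D_eq (m : HyperellipticModel k x y f) (V : ValuationSubring F)
    (hV : ∀ c : k, algebraMap k F c ∈ V) (hx : x ∈ V) {h : F} (hh : h ∈ V) :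
    ∃ u ∈ V, y • D k F h = u • D k F x := by
  have : CharZero F := charZero_of_injective_algebraMap (algebraMap k F).injective
  have hy2 : (2 * y) • D k F y = aeval x (derivative f) • D k F x := by
    rw [← Derivation.map_aeval, ← m.y_sq, sq, Derivation.leibniz]
    module
  have key : ∀ a b : k[X], ∃ u ∈ V, y • D k F (aeval x a + aeval x b * y) = u • D k F x := by
    intro a b
    refine ⟨y * aeval x (derivative a) + aeval x (f * derivative b) +
      aeval x (C 2⁻¹ * b * derivative f), add_mem (add_mem
        (mul_mem (m.y_mem hV hx) (V.aeval_mem hV hx _)) (V.aeval_mem hV hx _))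
        (V.aeval_mem hV hx _), ?_⟩
    rw [map_add, Derivation.leibniz, Derivation.map_aeval, Derivation.map_aeval]
    have h2 : y • D k F y = ((2 : F)⁻¹ * aeval x (derivative f)) • D k F x := by
      rw [mul_smul, ← hy2, smul_smul, inv_mul_cancel_left₀ two_ne_zero]
    have e : y • (aeval x (derivative a) • D k F x + (aeval x b • D k F y +
        y • aeval x (derivative b) • D k F x)) =
        (y * aeval x (derivative a) + y ^ 2 * aeval x (derivative b)) • D k F x +
          aeval x b • (y • D k F y) := by module
    rw [e, h2, m.y_sq]
    simp only [map_mul, aeval_C, map_inv₀, map_ofNat]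
    module
  obtain ⟨a, b, c, d, hs, e⟩ := m.exists_mul_eq_of_mem hV hx hh
  obtain ⟨u₁, hu₁, e₁⟩ := key a b
  obtain ⟨u₂, hu₂, e₂⟩ := key c d
  have hs0 : aeval x c + aeval x d * y ≠ 0 := fun h0 => hs (h0 ▸ V.nonunits.zero_mem)
  set s := aeval x c + aeval x d * y
  refine ⟨s⁻¹ * (u₁ - h * u₂),
    mul_mem (V.inv_mem_of_notMem_nonunits hs) (sub_mem hu₁ (mul_mem hh hu₂)), ?_⟩
  rw [← e, Derivation.leibniz] at e₁
  have e₃ : s • (y • D k F h) = (u₁ - h * u₂) • D k F x := by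
    rw [sub_smul, ← e₁, mul_smul, ← e₂]
    module
  rw [mul_smul, ← e₃, inv_smul_smul₀ hs0]

open KaehlerDifferential in
theorem exists_y_smul_eq (m : HyperellipticModel k x y f) (V : ValuationSubring F)
    (hV : ∀ c : k, algebraMap k F c ∈ V) (hx : x ∈ V) {ω : Ω[F⁄k]}
    (hω : ω ∈ Submodule.span k {ω : Ω[F⁄k] | ∃ a ∈ V, ∃ b ∈ V, ω = a • D k F b}) :
    ∃ u ∈ V, y • ω = u • D k F x := by
  induction hω using Submodule.span_induction with
  | mem ω hω =>
    obtain ⟨a, ha, b, hb, rfl⟩ := hω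
    obtain ⟨u, hu, e⟩ := m.exists_y_smul_D_eq V hV hx hb
    exact ⟨a * u, mul_mem ha hu, by rw [smul_comm, e, mul_smul]⟩
  | zero => exact ⟨0, V.zero_mem, by simp⟩
  | add ω₁ ω₂ _ _ h₁ h₂ =>
    obtain ⟨u₁, hu₁, e₁⟩ := h₁
    obtain ⟨u₂, hu₂, e₂⟩ := h₂
    exact ⟨u₁ + u₂, add_mem hu₁ hu₂, by rw [smul_add, e₁, e₂, add_smul]⟩
  | smul c ω _ h =>
    obtain ⟨u, hu, e⟩ := h
    refine ⟨algebraMap k F c * u, mul_mem (hV c) hu, ?_⟩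
    rw [mul_smul, ← e, algebraMap_smul, smul_comm]

open KaehlerDifferential in
/-- A curve with a model of degree at most `4` has genus at most `1`. -/
theorem exists_forall_mem_span_singleton (m : HyperellipticModel k x y f) {n : ℕ}
    (hn : f.natDegree = 2 * n) (hn2 : n ≤ 2) :
    ∃ η : Ω[F⁄k], ∀ ω : Ω[F⁄k], (∀ V : ValuationSubring F, (∀ c : k, algebraMap k F c ∈ V) →
      ω ∈ Submodule.span k {ω : Ω[F⁄k] | ∃ a ∈ V, ∃ b ∈ V, ω = a • D k F b}) →
      ω ∈ Submodule.span k {η} := by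
  obtain ⟨V₀, hV₀, hxV₀, -⟩ := m.transcendental.exists_valuationSubring_aeval_mem_nonunits
    (q := X) not_isUnit_X
  have hx0 := m.x_ne_zero
  have hy0 := m.y_ne_zero
  refine ⟨y⁻¹ • D k F x, fun ω hω => ?_⟩
  obtain ⟨u, -, hu⟩ := m.exists_y_smul_eq V₀ hV₀ hxV₀ (hω V₀ hV₀)
  have hω' : ω = u • y⁻¹ • D k F x := by
    rw [smul_comm, ← hu, inv_smul_smul₀ hy0]
  by_cases hdx : D k F x = 0
  · rw [hω', hdx, smul_zero, smul_zero]
    exact zero_mem _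
  have huniq : ∀ {a b : F}, a • D k F x = b • D k F x → a = b := fun h =>
    smul_left_injective F hdx h
  have hfin : ∀ V : ValuationSubring F, (∀ c : k, algebraMap k F c ∈ V) → x ∈ V → u ∈ V := by
    intro V hV hx
    obtain ⟨u', hu', e⟩ := m.exists_y_smul_eq V hV hx (hω V hV)
    rwa [huniq (hu.symm.trans e)]
  -- The local statement in the coordinates x⁻¹ and y x⁻ⁿ, combined with d(x⁻¹) = -x⁻² dx.
  have hinf : ∀ V : ValuationSubring F, (∀ c : k, algebraMap k F c ∈ V) → x ∉ V →
      u * x ^ (2 - n) ∈ V := by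
    intro V hV hx
    have hxi : x⁻¹ ∈ V := V.nonunits_subset (V.inv_mem_nonunits_of_notMem hx)
    obtain ⟨u', hu', e⟩ := (m.reverse hn).exists_y_smul_eq V hV hxi (hω V hV)
    have h1 : D k F x⁻¹ = (-(x⁻¹ ^ 2)) • D k F x := by
      rw [Derivation.leibniz_inv]
    have h2 : u * x⁻¹ ^ n = u' * -(x⁻¹ ^ 2) := by
      apply huniq
      rw [mul_smul u', ← h1, ← e, mul_comm u, mul_smul, ← hu, smul_smul, mul_comm y]
    have h3 : u * x ^ (2 - n) = -u' := by
      have e2 : x ^ (2 - n) * x ^ n = x ^ 2 := by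
        rw [← pow_add]
        congr 1
        omega
      have hxn : x ^ n ≠ 0 := pow_ne_zero n hx0
      rw [inv_pow, inv_pow] at h2
      field_simp at h2
      apply mul_right_cancel₀ hxn
      linear_combination u * e2 + h2
    rw [h3]
    exact neg_mem hu'
  have hu_const : ∃ c : k, u = algebraMap k F c := by
    obtain ⟨a, b, hab⟩ := m.eq_aeval_add_of_forall_mem hfin
    have hfin' : ∀ V : ValuationSubring F, (∀ c : k, algebraMap k F c ∈ V) → x ∈ V →
        u * x ^ (2 - n) ∈ V := fun V hV hx => mul_mem (hfin V hV hx) (pow_mem hx _)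
    obtain ⟨a', b', hab', ha', hb'⟩ := m.eq_aeval_add_of_pole_le (j := 0) hfin'
      (by simpa using hinf)
    have hsub := m.eq_zero_of_add_mul_eq_zero (a := a * X ^ (2 - n) - a')
      (b := b * X ^ (2 - n) - b') (by
        simp only [map_sub, map_mul, map_pow, aeval_X]
        rw [hab] at hab'
        linear_combination hab')
    obtain ⟨e₁, e₂⟩ := hsub
    rw [sub_eq_zero] at e₁ e₂
    -- A nonzero b would force 2 deg b' + 2n ≤ 0, so n = 0; but then b' = bX² has degree at least 2.
    have hb : b = 0 := by
      by_contra hb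
      have hb'0 : b' ≠ 0 := e₂ ▸ mul_ne_zero hb (pow_ne_zero _ X_ne_zero)
      have h4 := hb' hb'0
      have h5 := congrArg natDegree e₂
      rw [natDegree_mul hb (pow_ne_zero _ X_ne_zero), natDegree_X_pow] at h5
      omega
    have ha : a.natDegree = 0 := by
      by_contra ha
      have ha0 : a ≠ 0 := by
        rintro rfl
        simp at ha
      have h5 := congrArg natDegree e₁
      rw [natDegree_mul ha0 (pow_ne_zero _ X_ne_zero), natDegree_X_pow] at h5
      omega
    refine ⟨a.coeff 0, ?_⟩
    rw [hab, hb, eq_C_of_natDegree_eq_zero ha]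
    simp
  obtain ⟨c, rfl⟩ := hu_const
  rw [hω', algebraMap_smul]
  exact Submodule.smul_mem _ _ (Submodule.mem_span_singleton_self _)

end Differentials

end HyperellipticModel

/-! ### Centres of valuation rings on a proper scheme -/

namespace CurvePoints

open IsLocalRing

section Center

variable {k : Type u} [Field k] {X : Scheme.{u}} (f : X ⟶ Spec (.of k))

/-- The structure homomorphism of the local ring of a `k`-scheme. -/
def stalkHom (x : X) : CommRingCat.of k ⟶ X.presheaf.stalk x :=
  (Scheme.ΓSpecIso (.of k)).inv ≫ f.appTop ≫ X.presheaf.germ ⊤ x trivial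

theorem fromSpecStalk_comp_eq (x : X) : X.fromSpecStalk x ≫ f = Spec.map (stalkHom f x) := by
  have h1 : f = X.toSpecΓ ≫ Spec.map ((Scheme.ΓSpecIso (.of k)).inv ≫ f.appTop) := by
    rw [Spec.map_comp, ← Scheme.toSpecΓ_naturality_assoc]
    simp
  conv_lhs => rw [h1]
  rw [Scheme.fromSpecStalk_toSpecΓ_assoc, ← Spec.map_comp]
  simp [stalkHom]

variable [IsIntegral X]

variable (X) in
theorem genericPoint_specializes' (x : X) : genericPoint X ⤳ x :=
  (genericPoint_spec X).specializes trivial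

theorem algebraMap_stalkHom (x : X) (c : k) :
    algebraMap (X.presheaf.stalk x) X.functionField ((stalkHom f x).hom c) =
      (stalkHom f (genericPoint X)).hom c := by
  have h : stalkHom f x ≫ X.presheaf.stalkSpecializes (genericPoint_specializes' X x) =
      stalkHom f (genericPoint X) := by
    simp only [stalkHom, Category.assoc]
    congr 2
    exact X.presheaf.germ_stalkSpecializes _ _
  exact congrArg (fun φ => φ.hom c) h

/-- The local ring at `x` is dominated by the valuation ring `V`. -/
structure IsCenter (V : ValuationSubring X.functionField) (x : X) : Prop where
  mem (a : X.presheaf.stalk x) : algebraMap _ X.functionField a ∈ V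
  isUnit (a : X.presheaf.stalk x) : algebraMap _ X.functionField a ∉ V.nonunits → IsUnit a

/-- The morphism from the spectrum of a valuation ring to its centre. -/
def IsCenter.toStalk {V : ValuationSubring X.functionField} {x : X} (h : IsCenter V x) :
    X.presheaf.stalk x ⟶ .of V :=
  CommRingCat.ofHom ((algebraMap (X.presheaf.stalk x) X.functionField).codRestrict V.toSubring h.mem)

instance IsCenter.isLocalHom {V : ValuationSubring X.functionField} {x : X} (h : IsCenter V x) :
    IsLocalHom h.toStalk.hom where
  map_nonunit a ha := by
    refine h.isUnit a fun hn => ?_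
    have h2 := V.coe_mem_nonunits_iff.mp (show ((h.toStalk.hom a : V) : X.functionField) ∈ _ from hn)
    exact (mem_maximalIdeal _).mp h2 ha

theorem IsCenter.map_comp {V : ValuationSubring X.functionField} {x : X} (h : IsCenter V x) :
    Spec.map (CommRingCat.ofHom (algebraMap V X.functionField)) ≫ Spec.map h.toStalk ≫
      X.fromSpecStalk x = X.fromSpecStalk (genericPoint X) := by
  rw [← Spec.map_comp_assoc,
    ← Scheme.SpecMap_stalkSpecializes_fromSpecStalk (genericPoint_specializes' X x)]
  rfl

variable (V : ValuationSubring X.functionField)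
  (hV : ∀ c, (stalkHom f (genericPoint X)).hom c ∈ V)

/-- The structure homomorphism of a valuation ring containing the ground field. -/
def valuationSubringHom : CommRingCat.of k ⟶ .of V :=
  CommRingCat.ofHom ((stalkHom f (genericPoint X)).hom.codRestrict V.toSubring hV)

theorem IsCenter.map_comp_comp {x : X} (h : IsCenter V x) :
    (Spec.map h.toStalk ≫ X.fromSpecStalk x) ≫ f = Spec.map (valuationSubringHom f V hV) := by
  rw [Category.assoc, fromSpecStalk_comp_eq, ← Spec.map_comp]
  congr 1
  refine CommRingCat.hom_ext (RingHom.ext fun c => ?_)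
  exact Subtype.ext (algebraMap_stalkHom f x c :)

-- Existence in the valuative criterion extends the generic point to a morphism from Spec V; the
-- image of the closed point is the centre.
include hV in
theorem exists_isCenter [IsProper f] : ∃ x : X, IsCenter V x := by
  have hex : ValuativeCriterion.Existence f := by
    have : UniversallyClosed f := inferInstance
    rw [UniversallyClosed.eq_valuativeCriterion] at this
    exact this.1
  let S : ValuativeCommSq f :=
    { R := V
      K := X.functionField
      i₁ := X.fromSpecStalk (genericPoint X)
      i₂ := Spec.map (valuationSubringHom f V hV)
      commSq := ⟨by
        rw [fromSpecStalk_comp_eq, ← Spec.map_comp]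
        rfl⟩ }
  obtain ⟨l, hl, -⟩ := (hex S).exists_lift
  have hl : Spec.map (CommRingCat.ofHom (algebraMap V X.functionField)) ≫ l =
    X.fromSpecStalk (genericPoint X) := hl
  set x := l (closedPoint V)
  have h1 : Scheme.stalkClosedPointTo l ≫ CommRingCat.ofHom (algebraMap V X.functionField) =
      X.presheaf.stalkSpecializes (genericPoint_specializes' X x) := by
    apply Spec.map_injective
    rw [← cancel_mono (X.fromSpecStalk x), Scheme.SpecMap_stalkSpecializes_fromSpecStalk,
      Spec.map_comp, Category.assoc, Scheme.Spec_stalkClosedPointTo_fromSpecStalk, hl]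
  have h2 : ∀ a : X.presheaf.stalk x, algebraMap _ X.functionField a =
      ((Scheme.stalkClosedPointTo l).hom a : V) := fun a =>
    (congrArg (fun φ => φ.hom a) h1).symm
  refine ⟨x, ⟨fun a => by rw [h2]; exact ((Scheme.stalkClosedPointTo l).hom a : V).2, fun a ha => ?_⟩⟩
  have : IsLocalHom (Scheme.stalkClosedPointTo l).hom := Scheme.isLocalHom_stalkClosedPointTo' l
  apply isUnit_of_map_unit (Scheme.stalkClosedPointTo l).hom
  by_contra hn
  apply ha
  rw [h2]
  exact V.coe_mem_nonunits_iff.mpr ((mem_maximalIdeal _).mpr hn)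

-- Two centres give two lifts of the same valuative square, and separatedness makes these equal.
include hV in
theorem IsCenter.eq [IsProper f] {x y : X} (hx : IsCenter V x) (hy : IsCenter V y) : x = y := by
  have hun : ValuativeCriterion.Uniqueness f := IsSeparated.valuativeCriterion f
  let S : ValuativeCommSq f :=
    { R := V
      K := X.functionField
      i₁ := X.fromSpecStalk (genericPoint X)
      i₂ := Spec.map (valuationSubringHom f V hV)
      commSq := ⟨by
        rw [fromSpecStalk_comp_eq, ← Spec.map_comp]
        rfl⟩ }
  have h := (hun S).elim ⟨_, hx.map_comp, hx.map_comp_comp f V hV⟩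
    ⟨_, hy.map_comp, hy.map_comp_comp f V hV⟩
  have h' : Spec.map hx.toStalk ≫ X.fromSpecStalk x = Spec.map hy.toStalk ≫ X.fromSpecStalk y :=
    congrArg CommSq.LiftStruct.l h
  have key : ∀ {z : X} (hz : IsCenter V z),
      (Spec.map hz.toStalk ≫ X.fromSpecStalk z) (closedPoint V) = z := by
    intro z hz
    have h1 : Spec.map hz.toStalk (closedPoint V) = closedPoint (X.presheaf.stalk z) :=
      comap_closedPoint hz.toStalk.hom
    exact (congrArg (X.fromSpecStalk z) h1).trans Scheme.fromSpecStalk_closedPoint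
  rw [← key hx, ← key hy, h']

end Center

end CurvePoints

/-! ### Smooth rational points have discrete valuation rings -/

section CotangentSpace

open IsLocalRing

variable {k R : Type*} [Field k] [CommRing R] [IsLocalRing R] [Algebra k R]

/-- The derivation `r ↦ r - r(x)` into the cotangent space at a rational point `x`. -/
def IsLocalRing.cotangentDerivation (e : R →ₐ[k] k) [IsLocalHom e.toRingHom] :
    Derivation k R (CotangentSpace R) :=
  have hmem (r : R) : r - algebraMap k R (e r) ∈ maximalIdeal R := by
    rw [mem_maximalIdeal, mem_nonunits_iff]
    intro h
    have := h.map e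
    simp at this
  Derivation.mk'
    { toFun := fun r => (maximalIdeal R).toCotangent ⟨r - algebraMap k R (e r), hmem r⟩
      map_add' := fun a b => by
        rw [← map_add]
        congr 1
        ext
        simp only [map_add, AddMemClass.mk_add_mk]
        ring
      map_smul' := fun c a => by
        rw [RingHom.id_apply, ← algebraMap_smul R c (Ideal.toCotangent _ _), ← map_smul]
        congr 1
        ext
        simp only [smul_eq_mul, map_mul, SetLike.mk_smul_mk, Algebra.smul_def, AlgHom.commutes,
          Algebra.algebraMap_self, RingHom.id_apply]
        ring }
    fun a b => by
      simp only [LinearMap.coe_mk, AddHom.coe_mk]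
      rw [← map_smul, ← map_smul, ← map_add, ← sub_eq_zero, ← map_sub,
        Ideal.toCotangent_eq_zero]
      simp only [map_mul, SetLike.mk_smul_mk, smul_eq_mul, AddMemClass.mk_add_mk,
        AddSubgroupClass.coe_sub]
      have := Ideal.mul_mem_mul (hmem a) (hmem b)
      rw [← sq] at this
      convert (maximalIdeal R ^ 2).neg_mem this using 1
      ring

theorem IsLocalRing.cotangentDerivation_apply (e : R →ₐ[k] k) [IsLocalHom e.toRingHom]
    (m : maximalIdeal R) : cotangentDerivation e m = (maximalIdeal R).toCotangent m := by
  have h : e m = 0 := by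
    by_contra h
    exact (mem_maximalIdeal _).mp m.2 (isUnit_of_map_unit e.toRingHom _ (Ne.isUnit h))
  change (maximalIdeal R).toCotangent _ = _
  congr 1
  ext
  simp [h]

/-- The derivation r ↦ r - r(x) factors through Ω[B/k], which is free of rank one, and is surjective
onto the cotangent space. So that space has dimension at most one, which for a Noetherian local
domain means a principal ideal ring. -/
theorem IsLocalRing.isDiscreteValuationRing_of_isStandardSmoothOfRelativeDimension [IsNoetherianRing R]
    [IsDomain R] (e : R →ₐ[k] k) [IsLocalHom e.toRingHom] (hR : ¬ IsField R) (B : Type*)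
    [CommRing B] [Algebra k B] [Algebra B R] [IsScalarTower k B R] (p : Ideal B) [p.IsPrime]
    [IsLocalization.AtPrime R p] [Algebra.IsStandardSmoothOfRelativeDimension 1 k B] :
    IsDiscreteValuationRing R := by
  have : Nontrivial B := (algebraMap B R).domain_nontrivial
  have hrank : Module.finrank B Ω[B⁄k] = 1 := by
    rw [Module.finrank,
      Algebra.IsStandardSmoothOfRelativeDimension.rank_kaehlerDifferential (R := k) (S := B) 1]
    simp
  have : Algebra.IsStandardSmooth k B :=
    Algebra.IsStandardSmoothOfRelativeDimension.isStandardSmooth 1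
  obtain ⟨ω, -, hω⟩ := finrank_eq_one_iff'.mp hrank
  let d := (cotangentDerivation e).compAlgebraMap B
  have hd (b : B) : cotangentDerivation e (algebraMap B R b) ∈
      Submodule.span R {d.liftKaehlerDifferential ω} := by
    obtain ⟨c, hc⟩ := hω (KaehlerDifferential.D k B b)
    have h1 : cotangentDerivation e (algebraMap B R b) =
        algebraMap B R c • d.liftKaehlerDifferential ω := by
      rw [algebraMap_smul, ← map_smul, hc, Derivation.liftKaehlerDifferential_comp_D]
      rfl
    rw [h1]
    exact Submodule.smul_mem _ _ (Submodule.mem_span_singleton_self _)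
  have hp : ∀ r ∈ maximalIdeal R, ∀ hr : r ∈ maximalIdeal R,
      (maximalIdeal R).toCotangent ⟨r, hr⟩ ∈
        Submodule.span R {d.liftKaehlerDifferential ω} := by
    intro r hr
    rw [← IsLocalization.AtPrime.map_eq_maximalIdeal p R, Ideal.map] at hr
    induction hr using Submodule.span_induction with
    | mem r hr =>
      obtain ⟨b, hb, rfl⟩ := hr
      intro hr
      have := hd b
      rwa [cotangentDerivation_apply e ⟨_, hr⟩] at this
    | zero =>
      intro hr
      have h0 : (⟨0, hr⟩ : maximalIdeal R) = 0 := rfl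
      rw [h0, map_zero]
      exact Submodule.zero_mem _
    | add a b ha hb iha ihb =>
      intro hr
      rw [← Ideal.span, ← Ideal.map, IsLocalization.AtPrime.map_eq_maximalIdeal p R] at ha hb
      have h0 : (⟨a + b, hr⟩ : maximalIdeal R) = ⟨a, ha⟩ + ⟨b, hb⟩ := rfl
      rw [h0, map_add]
      exact Submodule.add_mem _ (iha ha) (ihb hb)
    | smul c a ha iha =>
      intro hr
      rw [← Ideal.span, ← Ideal.map, IsLocalization.AtPrime.map_eq_maximalIdeal p R] at ha
      have h0 : (⟨c • a, hr⟩ : maximalIdeal R) = c • ⟨a, ha⟩ := rfl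
      rw [h0, map_smul]
      exact Submodule.smul_mem _ _ (iha ha)
  have hle : Module.finrank (ResidueField R) (CotangentSpace R) ≤ 1 := by
    refine finrank_le_one (d.liftKaehlerDifferential ω) fun w => ?_
    obtain ⟨m, rfl⟩ := (maximalIdeal R).toCotangent_surjective w
    obtain ⟨c, hc⟩ := Submodule.mem_span_singleton.mp (hp m m.2 m.2)
    exact ⟨residue R c, hc⟩
  have : IsPrincipalIdealRing R :=
    ((tfae_of_isNoetherianRing_of_isLocalRing_of_isDomain R).out 5 0).mp hle
  exact { not_a_field' := fun h => hR (isField_iff_maximalIdeal_eq.mpr h) }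

end CotangentSpace

/-! ### Order of vanishing and valuation rings at points -/

namespace CurvePoints

open IsLocalRing

section Order

variable {X : Scheme.{u}} [IsIntegral X]

/-- The valuation ring of the function field given by a regular point of codimension one. -/
def valuationSubringAt (x : X) [IsDiscreteValuationRing (X.presheaf.stalk x)] :
    ValuationSubring X.functionField where
  toSubring := (algebraMap (X.presheaf.stalk x) X.functionField).range
  mem_or_inv_mem' z := by
    rcases ValuationRing.isInteger_or_isInteger (X.presheaf.stalk x) z with h | h
    · exact Or.inl h
    · exact Or.inr h

variable (x : X) [IsDiscreteValuationRing (X.presheaf.stalk x)]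

theorem algebraMap_mem_nonunits_valuationSubringAt {a : X.presheaf.stalk x} :
    algebraMap (X.presheaf.stalk x) X.functionField a ∈ (valuationSubringAt x).nonunits ↔
      ¬ IsUnit a := by
  rw [ValuationSubring.mem_nonunits_iff_exists_mem_maximalIdeal]
  constructor
  · rintro ⟨h, hm⟩ hu
    refine (mem_maximalIdeal _).mp hm ?_
    refine .of_mul_eq_one ⟨algebraMap _ _ ((hu.unit⁻¹ : (X.presheaf.stalk x)ˣ) : X.presheaf.stalk x),
      _, rfl⟩ ?_
    ext
    simpa using mul_inv_cancel₀ ((hu.map (algebraMap _ X.functionField)).ne_zero)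
  · intro hu
    refine ⟨⟨a, rfl⟩, (mem_maximalIdeal _).mpr fun h => hu ?_⟩
    obtain ⟨⟨_, b, rfl⟩, hb⟩ := h.exists_right_inv
    refine .of_mul_eq_one b (IsFractionRing.injective _ X.functionField ?_)
    simpa using congrArg Subtype.val hb

theorem isCenter_valuationSubringAt : IsCenter (valuationSubringAt x) x where
  mem a := ⟨a, rfl⟩
  isUnit a ha := by
    by_contra h
    exact ha ((algebraMap_mem_nonunits_valuationSubringAt x).mpr h)

theorem coheight_eq_one : Order.coheight x = 1 := by
  have h := ringKrullDim_stalk_eq_coheight x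
  rw [IsDiscreteValuationRing.ringKrullDim_eq_one] at h
  exact_mod_cast h.symm

variable [IsLocallyNoetherian X]

theorem ord_algebraMap {a : X.presheaf.stalk x} (ha : a ≠ 0) :
    ∃ n : ℕ, Scheme.ord (algebraMap (X.presheaf.stalk x) X.functionField a) x = n ∧
      (n = 0 ↔ IsUnit a) := by
  have hKD : Ring.KrullDimLE 1 (X.presheaf.stalk x) :=
    krullDimLE_of_coheight_le (coheight_eq_one x).le
  have ha' : algebraMap (X.presheaf.stalk x) X.functionField a ≠ 0 :=
    (map_ne_zero_iff _ (IsFractionRing.injective _ _)).mpr ha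
  obtain ⟨n, hn⟩ := ENat.ne_top_iff_exists.mp
    (Ring.ord_ne_top (mem_nonZeroDivisors_of_ne_zero ha))
  refine ⟨n, ?_, ?_⟩
  · rw [Scheme.ord_eq_iff (coheight_eq_one x) ha']
    change Ring.ordFrac (X.presheaf.stalk x) _ = _
    rw [Ring.ordFrac_eq_ord _ ha,
      Ring.ordMonoidWithZeroHom_eq_coe _ (mem_nonZeroDivisors_of_ne_zero ha) hn.symm]
  · have := Ring.ord_eq_iff_associated a (1 : X.presheaf.stalk x)
    rw [Ring.ord_one, ← hn, associated_one_iff_isUnit] at this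
    exact_mod_cast this

theorem ord_nonneg_iff {h : X.functionField} (h0 : h ≠ 0) :
    0 ≤ Scheme.ord h x ↔ h ∈ valuationSubringAt x := by
  constructor
  · intro hh
    by_contra hn
    obtain ⟨a, ha⟩ := ((valuationSubringAt x).mem_or_inv_mem h).resolve_left hn
    have ha0 : a ≠ 0 := by
      rintro rfl
      exact inv_ne_zero h0 (by rw [← ha, map_zero])
    obtain ⟨n, hn1, hn2⟩ := ord_algebraMap x ha0
    have h1 := Scheme.ord_mul (x := x) h0 (inv_ne_zero h0)
    have h2 := Scheme.ord_mul (x := x) (one_ne_zero (α := X.functionField)) one_ne_zero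
    rw [mul_one] at h2
    rw [mul_inv_cancel₀ h0, ← ha, hn1] at h1
    have hn0 : n = 0 := by omega
    have hu := hn2.mp hn0
    refine hn ⟨((hu.unit⁻¹ : (X.presheaf.stalk x)ˣ) : X.presheaf.stalk x), ?_⟩
    refine mul_left_cancel₀ (inv_ne_zero h0) ?_
    rw [inv_mul_cancel₀ h0, ← ha, ← map_mul]
    simp
  · rintro ⟨a, rfl⟩
    have ha0 : a ≠ 0 := by
      rintro rfl
      exact h0 (map_zero _)
    obtain ⟨n, hn, -⟩ := ord_algebraMap x ha0
    omega

theorem ord_pos_iff {h : X.functionField} (h0 : h ≠ 0) :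
    0 < Scheme.ord h x ↔ h ∈ (valuationSubringAt x).nonunits := by
  have key : ∀ a : X.presheaf.stalk x, algebraMap _ X.functionField a ≠ 0 →
      (0 < Scheme.ord (algebraMap _ X.functionField a) x ↔
        algebraMap _ X.functionField a ∈ (valuationSubringAt x).nonunits) := by
    intro a ha
    have ha0 : a ≠ 0 := by
      rintro rfl
      exact ha (map_zero _)
    obtain ⟨n, hn, hn2⟩ := ord_algebraMap x ha0
    rw [algebraMap_mem_nonunits_valuationSubringAt, hn, ← hn2]
    omega
  constructor
  · intro hh
    obtain ⟨a, rfl⟩ := (ord_nonneg_iff x h0).mp hh.le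
    exact (key a h0).mp hh
  · intro hh
    obtain ⟨a, rfl⟩ := ValuationSubring.nonunits_subset hh
    exact (key a h0).mpr hh

end Order

section SmoothPoint

variable {k : Type u} [Field k] {X : Scheme.{u}} [IsIntegral X] [IsLocallyNoetherian X]
  (f : X ⟶ Spec (.of k)) [SmoothOfRelativeDimension 1 f]

/-- The nonconstant function excludes the degenerate case: if the local ring were a field, a - a(P)
would be a nonunit, hence zero, for every a, and all functions would be constant. -/
theorem isDiscreteValuationRing_stalk (P : Spec (.of k) ⟶ X) (hP : P ≫ f = 𝟙 _)
    (hX : ∃ t, t ∉ (stalkHom f (genericPoint X)).hom.range) :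
    IsDiscreteValuationRing
      (X.presheaf.stalk (P (closedPoint k : PrimeSpectrum k))) := by
  set x := P (closedPoint k : PrimeSpectrum k) with hx
  have h1 : stalkHom f x ≫ Scheme.stalkClosedPointTo P = 𝟙 _ := by
    apply Spec.map_injective
    rw [Spec.map_comp, ← fromSpecStalk_comp_eq, Scheme.Spec_stalkClosedPointTo_fromSpecStalk_assoc,
      hP, Spec.map_id]
  have h1' (c : k) : (Scheme.stalkClosedPointTo P).hom ((stalkHom f x).hom c) = c :=
    congrArg (fun φ => φ.hom c) h1
  obtain ⟨U, hU, V, hV, hxV, hUV, hstd⟩ :=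
    SmoothOfRelativeDimension.exists_isStandardSmoothOfRelativeDimension (n := 1) (f := f) x
  obtain rfl : U = ⊤ := by
    rw [eq_top_iff]
    intro y _
    rw [Subsingleton.elim (α := PrimeSpectrum k) y (f x)]
    exact hUV hxV
  let φ : CommRingCat.of k ⟶ Γ(X, V) := (Scheme.ΓSpecIso (.of k)).inv ≫ f.appLE ⊤ V hUV
  have hφ : RingHom.IsStandardSmoothOfRelativeDimension 1 φ.hom :=
    RingHom.IsStandardSmoothOfRelativeDimension.comp (n := 1) (m := 0) hstd
      (.equiv (Scheme.ΓSpecIso (.of k)).symm.commRingCatIsoToRingEquiv)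
  have hgerm : φ ≫ X.presheaf.germ V x hxV = stalkHom f x := by
    simp only [φ, stalkHom, Category.assoc]
    congr 1
    rw [Scheme.Hom.appLE, Category.assoc]
    exact congrArg (f.app ⊤ ≫ ·) (X.presheaf.germ_res (homOfLE hUV) x hxV)
  let := φ.hom.toAlgebra
  let := (stalkHom f x).hom.toAlgebra
  let := X.presheaf.algebra_section_stalk ⟨x, hxV⟩
  have : IsScalarTower k Γ(X, V) (X.presheaf.stalk x) :=
    .of_algebraMap_eq fun c => (congrArg (fun φ => φ.hom c) hgerm).symm
  let e : X.presheaf.stalk x →ₐ[k] k :=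
    { (Scheme.stalkClosedPointTo P).hom with commutes' := h1' }
  have : IsLocalHom e.toRingHom := Scheme.isLocalHom_stalkClosedPointTo' P
  have : Algebra.IsStandardSmoothOfRelativeDimension 1 k Γ(X, V) := hφ.toAlgebra
  have := hV.isLocalization_stalk ⟨x, hxV⟩
  refine isDiscreteValuationRing_of_isStandardSmoothOfRelativeDimension e ?_ Γ(X, V)
    (hV.primeIdealOf ⟨x, hxV⟩).asIdeal
  intro hfield
  obtain ⟨t, ht⟩ := hX
  apply ht
  obtain ⟨a, rfl⟩ := (hfield.localization_map_bijective (M := nonZeroDivisors (X.presheaf.stalk x))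
    (Rₘ := X.functionField) zero_notMem_nonZeroDivisors).2 t
  refine ⟨e a, ?_⟩
  rw [← algebraMap_stalkHom f x]
  congr 1
  by_contra hne
  obtain ⟨b, hb⟩ := hfield.mul_inv_cancel (sub_ne_zero.mpr hne)
  have h2 := congrArg e hb
  rw [map_mul, map_sub, map_one] at h2
  have h3 : e ((stalkHom f x).hom (e a)) = e a := h1' _
  rw [h3, sub_self, zero_mul] at h2
  exact zero_ne_one h2

end SmoothPoint

end CurvePoints

/-! ### Geometric points as places of the geometric function field -/

namespace CurvePoints

open IsLocalRing

section Place

variable {X : Scheme.{u}} [IsIntegral X]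

/-- A valuation ring is maximal for domination: if t in `V` were not in the local ring, t⁻¹ would be
a nonunit there and hence in `V`. -/
theorem IsCenter.valuationSubringAt_eq {V : ValuationSubring X.functionField} {x : X}
    [IsDiscreteValuationRing (X.presheaf.stalk x)] (h : IsCenter V x) :
    V = valuationSubringAt x := by
  refine le_antisymm (fun t ht => ?_) ?_
  · by_contra hn
    obtain ⟨a, ha⟩ := ((valuationSubringAt x).mem_or_inv_mem t).resolve_left hn
    have ha' : a ∈ nonunits _ := fun hu => hn ⟨((hu.unit⁻¹ : (X.presheaf.stalk x)ˣ) :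
      X.presheaf.stalk x), by
        have := map_units_inv (algebraMap (X.presheaf.stalk x) X.functionField) hu.unit
        rw [this, IsUnit.unit_spec, ha, inv_inv]⟩
    have h1 : algebraMap (X.presheaf.stalk x) X.functionField a ∈ V.nonunits := by
      by_contra h2
      exact ha' (h.isUnit a h2)
    rw [ha] at h1
    have h0 : t ≠ 0 := by
      rintro rfl
      exact hn (zero_mem _)
    have := V.nonunits_mul_mem h1 ht
    rw [inv_mul_cancel₀ h0] at this
    exact V.one_notMem_nonunits this
  · rintro _ ⟨a, rfl⟩
    exact h.mem a

/-- A discrete valuation ring has no overring strictly between itself and its fraction field: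
inverting one nonunit a clears every denominator, since each divides a power of a. -/
theorem isCenter_of_valuationSubringAt_le {V : ValuationSubring X.functionField} {x : X}
    [IsDiscreteValuationRing (X.presheaf.stalk x)] (h : valuationSubringAt x ≤ V) (hV : V ≠ ⊤) :
    IsCenter V x where
  mem a := h ⟨a, rfl⟩
  isUnit a ha := by
    by_contra hu
    apply hV
    rw [eq_top_iff]
    rintro t -
    have ha0 : a ≠ 0 := by
      rintro rfl
      rw [map_zero] at ha
      exact ha (by simp)
    obtain ⟨b, c, hc, rfl⟩ := IsFractionRing.div_surjective (A := X.presheaf.stalk x) t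
    have hc0 := nonZeroDivisors.ne_zero hc
    obtain ⟨ϖ, hϖ⟩ := IsDiscreteValuationRing.exists_irreducible (X.presheaf.stalk x)
    obtain ⟨n, hn⟩ := IsDiscreteValuationRing.associated_pow_irreducible hc0 hϖ
    have hdvd : ϖ ∣ a := by
      rw [← Ideal.mem_span_singleton, ← (IsDiscreteValuationRing.irreducible_iff_uniformizer ϖ).mp hϖ]
      exact (mem_maximalIdeal _).mpr hu
    obtain ⟨d, hd⟩ := hn.dvd.trans (pow_dvd_pow_of_dvd hdvd n)
    have hinv : (algebraMap (X.presheaf.stalk x) X.functionField a)⁻¹ ∈ V :=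
      V.inv_mem_of_notMem_nonunits ha
    have h1 : algebraMap (X.presheaf.stalk x) X.functionField b / algebraMap _ _ c =
        algebraMap _ _ (b * d) * (algebraMap _ _ a)⁻¹ ^ n := by
      have hd0 : d ≠ 0 := by
        rintro rfl
        exact pow_ne_zero n ha0 (by simpa using hd)
      have hinj := IsFractionRing.injective (X.presheaf.stalk x) X.functionField
      have hc1 := (map_ne_zero_iff _ hinj).mpr hc0
      have ha1 := (map_ne_zero_iff _ hinj).mpr ha0
      rw [inv_pow, ← map_pow, hd, map_mul, map_mul]
      have hd1 := (map_ne_zero_iff _ hinj).mpr hd0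
      field_simp
    rw [h1]
    exact mul_mem (h ⟨_, rfl⟩) (pow_mem hinv n)

variable {k : Type u} [Field k] [IsAlgClosed k] [IsLocallyNoetherian X]
  (f : X ⟶ Spec (.of k)) [SmoothOfRelativeDimension 1 f] [IsProper f]

/-- A closed point x in the closure of the centre p has its local ring inside that of p, hence
inside `V`. As that ring is a discrete valuation ring, x is itself the centre, and over an
algebraically closed field it is rational. -/
theorem exists_isCenter_section (hX : ∃ t, t ∉ (stalkHom f (genericPoint X)).hom.range)
    (V : ValuationSubring X.functionField)
    (hV : ∀ c, (stalkHom f (genericPoint X)).hom c ∈ V) (hV' : V ≠ ⊤) :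
    ∃ P : Spec (.of k) ⟶ X, P ≫ f = 𝟙 _ ∧ IsCenter V (P (closedPoint k : PrimeSpectrum k)) := by
  obtain ⟨p, hp⟩ := exists_isCenter f V hV
  have : CompactSpace X := by
    exact QuasiCompact.compactSpace_of_compactSpace f
  obtain ⟨x, hx, hxc⟩ := (isClosed_closure (s := {p})).exists_closed_singleton ⟨p, subset_closure rfl⟩
  have hspec : p ⤳ x := specializes_iff_mem_closure.mpr hx
  refine ⟨pointOfClosedPoint f x hxc, pointOfClosedPoint_comp f x hxc, ?_⟩
  have hPx : pointOfClosedPoint f x hxc (closedPoint k : PrimeSpectrum k) = x :=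
    pointOfClosedPoint_apply f x hxc _
  have : IsDiscreteValuationRing (X.presheaf.stalk x) :=
    hPx ▸ isDiscreteValuationRing_stalk f _ (pointOfClosedPoint_comp f x hxc) hX
  rw [show pointOfClosedPoint f x hxc (closedPoint k : PrimeSpectrum k) = x from hPx]
  refine isCenter_of_valuationSubringAt_le ?_ hV'
  rintro _ ⟨a, rfl⟩
  have h1 : X.presheaf.stalkSpecializes hspec ≫
      X.presheaf.stalkSpecializes (genericPoint_specializes' X p) =
      X.presheaf.stalkSpecializes (genericPoint_specializes' X x) :=
    X.presheaf.stalkSpecializes_comp _ _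
  have h2 : algebraMap _ X.functionField ((X.presheaf.stalkSpecializes hspec).hom a) =
      algebraMap _ X.functionField a := congrArg (fun φ => φ.hom a) h1
  rw [← h2]
  exact hp.mem _

end Place

section GeometricPlace

variable {k : Type u} [Field k] {C : Scheme.{u}} (s : C ⟶ Spec (.of k))

/-- The structure morphism of the geometric fibre. -/
abbrev geometricStr : geometricFiber s ⟶ Spec (.of (AlgebraicClosure k)) :=
  pullback.snd s (specMap k (AlgebraicClosure k))

/-- The section of the geometric fibre defined by a geometric point. -/
def geometricSection (P : Points s (AlgebraicClosure k)) :
    Spec (.of (AlgebraicClosure k)) ⟶ geometricFiber s :=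
  pullback.lift P.1 (𝟙 _) (by rw [P.2, Category.id_comp])

theorem geometricSection_comp (P : Points s (AlgebraicClosure k)) :
    geometricSection s P ≫ geometricStr s = 𝟙 _ :=
  pullback.lift_snd _ _ _

theorem geometricSection_fst (P : Points s (AlgebraicClosure k)) :
    geometricSection s P ≫ pullback.fst _ _ = P.1 :=
  pullback.lift_fst _ _ _

theorem geometricPoint_eq (P : Points s (AlgebraicClosure k)) :
    geometricPoint s P =
      geometricSection s P (closedPoint (AlgebraicClosure k) : PrimeSpectrum (AlgebraicClosure k)) :=
  rfl

variable [IsCurve s]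

instance : SmoothOfRelativeDimension 1 (geometricStr s) :=
  (smoothOfRelativeDimension_isStableUnderBaseChange 1).of_isPullback
    (IsPullback.of_hasPullback s (specMap k (AlgebraicClosure k))) inferInstance

/-- The geometric function field of a curve. -/
abbrev geometricFunctionField : CommRingCat.{u} := (geometricFiber s).functionField

/-- The constants of the geometric function field. -/
def geometricConst : AlgebraicClosure k →+* geometricFunctionField s :=
  (stalkHom (geometricStr s) (genericPoint (geometricFiber s))).hom

/-- The existence of a nonconstant function. -/
def HasNonconstant : Prop := ∃ t, t ∉ (geometricConst s).range

variable {s}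

theorem HasNonconstant.isDiscreteValuationRing (hX : HasNonconstant s)
    (P : Points s (AlgebraicClosure k)) :
    IsDiscreteValuationRing ((geometricFiber s).presheaf.stalk (geometricPoint s P)) :=
  isDiscreteValuationRing_stalk _ _ (geometricSection_comp s P) hX

/-- The valuation ring of the geometric function field at a geometric point. -/
def HasNonconstant.place (hX : HasNonconstant s) (P : Points s (AlgebraicClosure k)) :
    ValuationSubring (geometricFunctionField s) :=
  haveI := hX.isDiscreteValuationRing P
  valuationSubringAt (geometricPoint s P)

theorem HasNonconstant.isCenter_place (hX : HasNonconstant s) (P : Points s (AlgebraicClosure k)) :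
    IsCenter (hX.place P) (geometricPoint s P) :=
  haveI := hX.isDiscreteValuationRing P
  isCenter_valuationSubringAt _

theorem HasNonconstant.const_mem_place (hX : HasNonconstant s) (P : Points s (AlgebraicClosure k))
    (c : AlgebraicClosure k) : geometricConst s c ∈ hX.place P := by
  rw [geometricConst, ← algebraMap_stalkHom _ (geometricPoint s P)]
  exact (hX.isCenter_place P).mem _

theorem HasNonconstant.ord_nonneg_iff (hX : HasNonconstant s) (P : Points s (AlgebraicClosure k))
    {h : geometricFunctionField s} (h0 : h ≠ 0) :
    0 ≤ Scheme.ord h (geometricPoint s P) ↔ h ∈ hX.place P :=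
  haveI := hX.isDiscreteValuationRing P
  CurvePoints.ord_nonneg_iff _ h0

theorem HasNonconstant.ord_pos_iff (hX : HasNonconstant s) (P : Points s (AlgebraicClosure k))
    {h : geometricFunctionField s} (h0 : h ≠ 0) :
    0 < Scheme.ord h (geometricPoint s P) ↔ h ∈ (hX.place P).nonunits :=
  haveI := hX.isDiscreteValuationRing P
  CurvePoints.ord_pos_iff _ h0

theorem HasNonconstant.place_injective (hX : HasNonconstant s) :
    Function.Injective hX.place := by
  intro P Q h
  have hQ := hX.isCenter_place Q
  rw [← h] at hQ
  have h1 := (hX.isCenter_place P).eq (geometricStr s) _ (hX.const_mem_place P) hQ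
  have h2 : geometricSection s P = geometricSection s Q :=
    ext_of_apply_closedPoint_eq (geometricStr s) (geometricSection_comp s P)
      (geometricSection_comp s Q) h1
  apply Subtype.ext
  rw [← geometricSection_fst, h2, geometricSection_fst]

theorem HasNonconstant.exists_place_eq (hX : HasNonconstant s)
    (V : ValuationSubring (geometricFunctionField s)) (hV : ∀ c, geometricConst s c ∈ V)
    (hV' : V ≠ ⊤) : ∃ P, hX.place P = V := by
  obtain ⟨S, hS, hSV⟩ := exists_isCenter_section (geometricStr s) hX V hV hV'
  let P : Points s (AlgebraicClosure k) := ⟨S ≫ pullback.fst _ _, by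
    rw [Category.assoc, pullback.condition, reassoc_of% hS]⟩
  have hP : geometricSection s P = S := by
    apply pullback.hom_ext
    · exact geometricSection_fst s P
    · exact (geometricSection_comp s P).trans hS.symm
  have := hX.isDiscreteValuationRing P
  have h1 : IsCenter V (geometricPoint s P) := by
    rw [geometricPoint_eq, hP]
    exact hSV
  exact ⟨P, h1.valuationSubringAt_eq.symm⟩

end GeometricPlace

end CurvePoints

/-! ### Descent of points and values of functions at conjugate points -/

namespace CurvePoints

open IsLocalRing

section LocalPoint

theorem exists_eq_map_fromSpecStalk {X : Scheme.{u}} {R : Type u} [CommRing R] [IsLocalRing R]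
    (T : Spec (.of R) ⟶ X) : ∃ (c : X) (g : X.presheaf.stalk c ⟶ .of R), IsLocalHom g.hom ∧
      T = Spec.map g ≫ X.fromSpecStalk c :=
  ⟨_, Scheme.stalkClosedPointTo T, Scheme.isLocalHom_stalkClosedPointTo' T,
    (Scheme.Spec_stalkClosedPointTo_fromSpecStalk T).symm⟩

theorem map_fromSpecStalk_closedPoint {X : Scheme.{u}} {R : Type u} [CommRing R] [IsLocalRing R]
    {c : X} (g : X.presheaf.stalk c ⟶ .of R) [IsLocalHom g.hom] :
    (Spec.map g ≫ X.fromSpecStalk c) (closedPoint R : PrimeSpectrum R) = c :=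
  (congrArg (X.fromSpecStalk c) (comap_closedPoint g.hom)).trans Scheme.fromSpecStalk_closedPoint

variable {k : Type u} [Field k] {C : Scheme.{u}} {s : C ⟶ Spec (.of k)}

theorem exists_points_map_eq {K : Type u} [Field K] [Algebra k K] (P : Points s K)
    (E : IntermediateField k K) {c : C} (g : C.presheaf.stalk c ⟶ .of K)
    (hP : P.1 = Spec.map g ≫ C.fromSpecStalk c) (hE : ∀ a, g.hom a ∈ E) :
    ∃ P' : Points s E, Points.map s E.val P' = P := by
  let g' : C.presheaf.stalk c ⟶ .of E := CommRingCat.ofHom (g.hom.codRestrict E.toSubfield hE)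
  have hg' : g' ≫ CommRingCat.ofHom E.val.toRingHom = g := rfl
  have h1 : Spec.map (stalkHom s c ≫ g) = Spec.map (CommRingCat.ofHom (algebraMap k K)) := by
    rw [Spec.map_comp, ← fromSpecStalk_comp_eq, ← Category.assoc, ← hP, P.2]
    rfl
  have h2 := Spec.map_injective h1
  refine ⟨⟨Spec.map g' ≫ C.fromSpecStalk c, ?_⟩, ?_⟩
  · rw [Category.assoc, fromSpecStalk_comp_eq, ← Spec.map_comp, specMap]
    congr 1
    refine CommRingCat.hom_ext (RingHom.ext fun z => Subtype.ext ?_)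
    exact congrArg (fun φ => φ.hom z) h2
  · apply Subtype.ext
    change Spec.map (CommRingCat.ofHom E.val.toRingHom) ≫ Spec.map g' ≫ C.fromSpecStalk c = P.1
    rw [hP, ← Spec.map_comp_assoc, hg']

/-- If all the pairs agree on P, they agree on every value of a local function at P, so these values
lie in E and P factors through Spec E. -/
theorem exists_points_map_eq_of_forall {K : Type u} [Field K] [Algebra k K] (P : Points s K)
    (E : IntermediateField k K) {ι : Type*} {L : Type u} [Field L] [Algebra k L]
    (φ ψ : ι → K →ₐ[k] L) (h : ∀ i, Points.map s (φ i) P = Points.map s (ψ i) P)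
    (hE : ∀ z, (∀ i, φ i z = ψ i z) → z ∈ E) :
    ∃ P' : Points s E, Points.map s E.val P' = P := by
  obtain ⟨c, g, -, hP⟩ := exists_eq_map_fromSpecStalk P.1
  refine exists_points_map_eq P E g hP fun a => hE _ fun i => ?_
  have h1 : Spec.map (CommRingCat.ofHom (φ i).toRingHom) ≫ P.1 =
      Spec.map (CommRingCat.ofHom (ψ i).toRingHom) ≫ P.1 := congrArg Subtype.val (h i)
  rw [hP, ← Spec.map_comp_assoc, ← Spec.map_comp_assoc, cancel_mono] at h1
  exact congrArg (fun φ => φ.hom a) (Spec.map_injective h1)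

theorem points_map_comp {R S T : Type u} [CommRing R] [CommRing S] [CommRing T] [Algebra k R]
    [Algebra k S] [Algebra k T] (φ : R →ₐ[k] S) (ψ : S →ₐ[k] T) (P : Points s R) :
    Points.map s ψ (Points.map s φ P) = Points.map s (ψ.comp φ) P := by
  apply Subtype.ext
  change Spec.map _ ≫ Spec.map _ ≫ P.1 = Spec.map _ ≫ P.1
  rw [← Spec.map_comp_assoc]
  rfl

theorem points_map_id {R : Type u} [CommRing R] [Algebra k R] (P : Points s R) :
    Points.map s (AlgHom.id k R) P = P := by
  apply Subtype.ext
  change Spec.map (𝟙 _) ≫ P.1 = P.1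
  rw [Spec.map_id, Category.id_comp]

end LocalPoint

section FunctionFieldMap

variable {k : Type u} [Field k] {C : Scheme.{u}} (s : C ⟶ Spec (.of k))

/-- The projection from the geometric fibre to the curve. -/
abbrev geometricProj : geometricFiber s ⟶ C := pullback.fst s (specMap k (AlgebraicClosure k))

theorem stalkHom_comp_stalkSpecializes {k : Type u} [Field k] {X : Scheme.{u}}
    (f : X ⟶ Spec (.of k)) {x y : X} (h : x ⤳ y) :
    stalkHom f y ≫ X.presheaf.stalkSpecializes h = stalkHom f x := by
  simp only [stalkHom, Category.assoc]
  congr 2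
  exact X.presheaf.germ_stalkSpecializes _ _

theorem stalkHom_stalkMap (x : geometricFiber s) :
    stalkHom s (geometricProj s x) ≫ (geometricProj s).stalkMap x =
      CommRingCat.ofHom (algebraMap k (AlgebraicClosure k)) ≫ stalkHom (geometricStr s) x := by
  apply Spec.map_injective
  rw [Spec.map_comp, Spec.map_comp, ← fromSpecStalk_comp_eq, ← fromSpecStalk_comp_eq,
    Scheme.SpecMap_stalkMap_fromSpecStalk_assoc, Category.assoc, pullback.condition]
  rfl

variable [IsCurve s] [IsIntegral C]

theorem surjective_specMap (R : Type u) [CommRing R] [Nontrivial R] [Algebra k R] :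
    Surjective (specMap k R) :=
  ⟨fun _ => ⟨(Classical.arbitrary (PrimeSpectrum R) : PrimeSpectrum R),
    Subsingleton.elim (α := PrimeSpectrum k) _ _⟩⟩

theorem geometricProj_genericPoint :
    geometricProj s (genericPoint (geometricFiber s)) = genericPoint C := by
  have : Surjective (specMap k (AlgebraicClosure k)) := surjective_specMap _
  have : Surjective (geometricProj s) := inferInstance
  have h := (genericPoint_spec (geometricFiber s)).image (geometricProj s).continuous
  rw [Set.image_univ, this.surj.range_eq, closure_univ] at h
  exact h.eq (genericPoint_spec C)

/-- The homomorphism from the function field of a curve to its geometric function field. -/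
def functionFieldMap : C.functionField →+* geometricFunctionField s :=
  (C.presheaf.stalkSpecializes (specializes_of_eq (geometricProj_genericPoint s)) ≫
    (geometricProj s).stalkMap (genericPoint (geometricFiber s))).hom

theorem algebraMap_stalkMap (x : geometricFiber s) (a : C.presheaf.stalk (geometricProj s x)) :
    algebraMap _ (geometricFiber s).functionField ((geometricProj s).stalkMap x a) =
      functionFieldMap s (algebraMap _ C.functionField a) := by
  have h1 := Scheme.Hom.stalkSpecializes_stalkMap (geometricProj s) _ x
    (genericPoint_specializes' (geometricFiber s) x)
  have h2 : C.presheaf.stalkSpecializes (genericPoint_specializes' C (geometricProj s x)) ≫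
      C.presheaf.stalkSpecializes (specializes_of_eq (geometricProj_genericPoint s)) =
      C.presheaf.stalkSpecializes ((geometricProj s).base.hom.map_specializes
        (genericPoint_specializes' (geometricFiber s) x)) :=
    C.presheaf.stalkSpecializes_comp _ _
  rw [← h2, Category.assoc] at h1
  exact (congrArg (fun φ => φ.hom a) h1).symm

/-- The homomorphism of constants into the function field of a curve. -/
def functionFieldConst : k →+* C.functionField := (stalkHom s (genericPoint C)).hom

theorem functionFieldMap_const (c : k) :
    functionFieldMap s (functionFieldConst s c) =
      geometricConst s (algebraMap k (AlgebraicClosure k) c) := by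
  have h1 : stalkHom s (genericPoint C) ≫
      C.presheaf.stalkSpecializes (specializes_of_eq (geometricProj_genericPoint s)) ≫
        (geometricProj s).stalkMap (genericPoint (geometricFiber s)) =
      CommRingCat.ofHom (algebraMap k (AlgebraicClosure k)) ≫
        stalkHom (geometricStr s) (genericPoint (geometricFiber s)) := by
    rw [← Category.assoc, stalkHom_comp_stalkSpecializes, stalkHom_stalkMap]
  exact congrArg (fun φ => φ.hom c) h1

/-- The two inclusions into E define, by the universal property of the fibre product, an E-point
through which the generic point factors. So the identity of the function field factors through E. -/
theorem eq_top_of_forall_mem (E : Subfield (geometricFunctionField s))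
    (hc : ∀ c, geometricConst s c ∈ E) (hF : ∀ h, functionFieldMap s h ∈ E) : E = ⊤ := by
  let X := geometricFiber s
  let η := genericPoint X
  let ι : CommRingCat.of E ⟶ X.functionField := CommRingCat.ofHom E.subtype
  let a : C.functionField ⟶ .of E :=
    CommRingCat.ofHom ((functionFieldMap s).codRestrict E hF)
  let b : CommRingCat.of (AlgebraicClosure k) ⟶ .of E :=
    CommRingCat.ofHom ((geometricConst s).codRestrict E hc)
  have ha : a ≫ ι = CommRingCat.ofHom (functionFieldMap s) := rfl
  have hb : b ≫ ι = stalkHom (geometricStr s) η := rfl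
  have hF : Spec.map (CommRingCat.ofHom (functionFieldMap s)) ≫ C.fromSpecStalk (genericPoint C) =
      X.fromSpecStalk η ≫ geometricProj s := by
    rw [← Scheme.SpecMap_stalkMap_fromSpecStalk, ← Scheme.SpecMap_stalkSpecializes_fromSpecStalk
      (specializes_of_eq (geometricProj_genericPoint s)), ← Spec.map_comp_assoc]
    rfl
  let T : Spec (.of E) ⟶ X :=
    pullback.lift (Spec.map a ≫ C.fromSpecStalk (genericPoint C)) (Spec.map b) (by
      rw [Category.assoc, fromSpecStalk_comp_eq, ← Spec.map_comp, specMap, ← Spec.map_comp]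
      congr 1
      refine CommRingCat.hom_ext (RingHom.ext fun c => Subtype.ext ?_)
      exact functionFieldMap_const s c)
  have hT : Spec.map ι ≫ T = X.fromSpecStalk η := by
    apply pullback.hom_ext
    · rw [Category.assoc, pullback.lift_fst, ← Spec.map_comp_assoc, ha, hF]
    · rw [Category.assoc, pullback.lift_snd, ← Spec.map_comp, hb, ← fromSpecStalk_comp_eq]
  obtain ⟨c, g, hg, hTg⟩ := exists_eq_map_fromSpecStalk T
  have hι : Spec.map ι (closedPoint X.functionField) = (closedPoint E : PrimeSpectrum E) :=
    Subsingleton.elim (α := PrimeSpectrum E) _ _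
  obtain rfl : η = c := by
    have h1 : X.fromSpecStalk η (closedPoint X.functionField) = η :=
      Scheme.fromSpecStalk_closedPoint
    rw [← h1, ← hT]
    refine (congrArg T hι).trans ?_
    rw [hTg]
    exact map_fromSpecStalk_closedPoint g
  rw [hTg, ← Spec.map_comp_assoc] at hT
  have h1 : Spec.map (g ≫ ι) = 𝟙 _ := by
    rw [← cancel_mono (X.fromSpecStalk η), hT, Category.id_comp]
  rw [← Spec.map_id] at h1
  have h2 := Spec.map_injective h1
  rw [eq_top_iff]
  intro z _
  have h3 : ι.hom (g.hom z) = z := congrArg (fun φ => φ.hom z) h2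
  rw [← h3]
  exact (g.hom z : E).2

/-- The morphism Q factors both through P and through the local ring of the geometric fibre;
comparing the two factorizations identifies the value at Q of a local function. -/
theorem sub_mem_nonunits_place (hX : HasNonconstant s) {K : Type u} [Field K] [Algebra k K]
    (P : Points s K) {c : C} (g : C.presheaf.stalk c ⟶ .of K) [IsLocalHom g.hom]
    (hP : P.1 = Spec.map g ≫ C.fromSpecStalk c) (b : C.presheaf.stalk c)
    (ψ : K →ₐ[k] AlgebraicClosure k) :
    functionFieldMap s (algebraMap _ C.functionField b) - geometricConst s (ψ (g.hom b)) ∈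
      (hX.place (Points.map s ψ P)).nonunits := by
  set Q := Points.map s ψ P
  have hQ : Q.1 = Spec.map (g ≫ CommRingCat.ofHom ψ.toRingHom) ≫ C.fromSpecStalk c := by
    rw [Spec.map_comp, Category.assoc, ← hP]
    rfl
  obtain ⟨x, e, he, hx⟩ := exists_eq_map_fromSpecStalk (geometricSection s Q)
  have hcen : IsCenter (hX.place Q) x := by
    have h1 := hX.isCenter_place Q
    rw [geometricPoint_eq, hx] at h1
    rwa [show (Spec.map e ≫ (geometricFiber s).fromSpecStalk x)
      (closedPoint (AlgebraicClosure k) : PrimeSpectrum (AlgebraicClosure k)) = x from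
        map_fromSpecStalk_closedPoint e] at h1
  have he1 : stalkHom (geometricStr s) x ≫ e = 𝟙 _ := by
    apply Spec.map_injective
    rw [Spec.map_comp, ← fromSpecStalk_comp_eq, ← Category.assoc, ← hx, geometricSection_comp,
      Spec.map_id]
  have hfst : Q.1 = Spec.map ((geometricProj s).stalkMap x ≫ e) ≫ C.fromSpecStalk _ := by
    rw [← geometricSection_fst, hx, Category.assoc, ← Scheme.SpecMap_stalkMap_fromSpecStalk,
      Spec.map_comp, Category.assoc]
  have hl1 : IsLocalHom ((geometricProj s).stalkMap x ≫ e).hom :=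
    inferInstanceAs (IsLocalHom (e.hom.comp ((geometricProj s).stalkMap x).hom))
  have hl2 : IsLocalHom (g ≫ CommRingCat.ofHom ψ.toRingHom).hom :=
    inferInstanceAs (IsLocalHom (ψ.toRingHom.comp g.hom))
  obtain rfl : geometricProj s x = c := by
    rw [← map_fromSpecStalk_closedPoint ((geometricProj s).stalkMap x ≫ e), ← hfst, hQ,
      map_fromSpecStalk_closedPoint]
  rw [hQ, cancel_mono] at hfst
  have h2 := congrArg (fun φ => φ.hom b) (Spec.map_injective hfst)
  have h2 : ψ (g.hom b) = e.hom ((geometricProj s).stalkMap x b) := h2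
  rw [← algebraMap_stalkMap, geometricConst, ← algebraMap_stalkHom _ x, ← map_sub]
  by_contra hn
  have hu := (hcen.isUnit _ hn).map e.hom
  refine hu.ne_zero ?_
  rw [map_sub, ← h2, sub_eq_zero]
  exact (congrArg (fun φ => φ.hom (ψ (g.hom b))) he1).symm

/-- Regularity descends along the faithfully flat map of local rings: if u/w is regular upstairs,
then u lies in the extension of the ideal (w), hence in (w) itself. -/
theorem exists_algebraMap_eq (hX : HasNonconstant s) {K : Type u} [Field K] [Algebra k K]
    (P : Points s K) {c : C} (g : C.presheaf.stalk c ⟶ .of K) [IsLocalHom g.hom]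
    (hP : P.1 = Spec.map g ≫ C.fromSpecStalk c) (φ : K →ₐ[k] AlgebraicClosure k)
    {h : C.functionField} (hh : functionFieldMap s h ∈ hX.place (Points.map s φ P)) :
    ∃ b : C.presheaf.stalk c, algebraMap _ C.functionField b = h := by
  have := hX.isDiscreteValuationRing (Points.map s φ P)
  obtain ⟨a, ha⟩ : ∃ a, algebraMap ((geometricFiber s).presheaf.stalk
    (geometricPoint s (Points.map s φ P))) (geometricFiber s).functionField a =
      functionFieldMap s h := hh
  have hQ : (Points.map s φ P).1 =
      Spec.map (g ≫ CommRingCat.ofHom φ.toRingHom) ≫ C.fromSpecStalk c := by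
    rw [Spec.map_comp, Category.assoc, ← hP]
    rfl
  have hl : IsLocalHom (g ≫ CommRingCat.ofHom φ.toRingHom).hom :=
    inferInstanceAs (IsLocalHom (φ.toRingHom.comp g.hom))
  have hproj : geometricProj s (geometricPoint s (Points.map s φ P)) = c := by
    have h1 : geometricProj s (geometricPoint s (Points.map s φ P)) =
        (geometricSection s (Points.map s φ P) ≫ geometricProj s)
          (closedPoint (AlgebraicClosure k) : PrimeSpectrum (AlgebraicClosure k)) := rfl
    rw [h1, geometricSection_fst, hQ]
    exact map_fromSpecStalk_closedPoint _
  clear hQ hl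
  generalize geometricPoint s (Points.map s φ P) = x at a ha hproj
  subst hproj
  obtain ⟨u, w, hw, rfl⟩ := IsFractionRing.div_surjective
    (A := C.presheaf.stalk (geometricProj s x)) h
  have hw0 : algebraMap (C.presheaf.stalk (geometricProj s x)) C.functionField w ≠ 0 :=
    (map_ne_zero_iff _ (IsFractionRing.injective _ _)).mpr (nonZeroDivisors.ne_zero hw)
  have h1 : a * (geometricProj s).stalkMap x w = (geometricProj s).stalkMap x u := by
    apply IsFractionRing.injective _ (geometricFiber s).functionField
    rw [map_mul, ha, algebraMap_stalkMap, algebraMap_stalkMap, ← map_mul, div_mul_cancel₀ _ hw0]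
  have : Flat (specMap k (AlgebraicClosure k)) := by
    rw [specMap, Flat.SpecMap_iff]
    exact RingHom.flat_algebraMap_iff.mpr inferInstance
  have hflat := Flat.stalkMap (geometricProj s) x
  let := ((geometricProj s).stalkMap x).hom.toAlgebra
  have : Module.Flat (C.presheaf.stalk (geometricProj s x))
    ((geometricFiber s).presheaf.stalk x) := hflat
  have : IsLocalHom (algebraMap (C.presheaf.stalk (geometricProj s x))
    ((geometricFiber s).presheaf.stalk x)) :=
      inferInstanceAs (IsLocalHom ((geometricProj s).stalkMap x).hom)
  have : Module.FaithfullyFlat (C.presheaf.stalk (geometricProj s x))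
    ((geometricFiber s).presheaf.stalk x) := .of_flat_of_isLocalHom
  have h2 : u ∈ Ideal.span {w} := by
    rw [← Ideal.comap_map_eq_self_of_faithfullyFlat (B := (geometricFiber s).presheaf.stalk x)
      (Ideal.span {w}), Ideal.mem_comap, Ideal.map_span, Set.image_singleton,
      Ideal.mem_span_singleton']
    exact ⟨a, h1⟩
  obtain ⟨b, rfl⟩ := Ideal.mem_span_singleton'.mp h2
  exact ⟨b, by rw [map_mul, mul_div_cancel_right₀ _ hw0]⟩

/-- The values of a rational function at the conjugates of a point. -/
theorem exists_value (hX : HasNonconstant s) {K : Type u} [Field K] [Algebra k K]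
    (P : Points s K) (φ : K →ₐ[k] AlgebraicClosure k)
    {h : C.functionField} (hh : functionFieldMap s h ∈ hX.place (Points.map s φ P)) :
    ∃ z : K, ∀ ψ : K →ₐ[k] AlgebraicClosure k,
      functionFieldMap s h - geometricConst s (ψ z) ∈ (hX.place (Points.map s ψ P)).nonunits := by
  obtain ⟨c, g, hg, hP⟩ := exists_eq_map_fromSpecStalk P.1
  obtain ⟨b, rfl⟩ := exists_algebraMap_eq s hX P g hP φ hh
  exact ⟨g.hom b, sub_mem_nonunits_place s hX P g hP b⟩

end FunctionFieldMap

end CurvePoints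

/-! ### Residue fields of the projective line -/

namespace CurvePoints

open IsLocalRing

section ProjectiveLine

attribute [local instance] MvPolynomial.gradedAlgebra

open HomogeneousLocalization

theorem adjoin_range_X_eq_top {σ k : Type*} [Field k] :
    Algebra.adjoin (MvPolynomial.homogeneousSubmodule σ k 0)
      (Set.range (MvPolynomial.X : σ → MvPolynomial σ k)) = ⊤ := by
  rw [eq_top_iff]
  rintro p -
  have hp : p ∈ Algebra.adjoin k (Set.range (MvPolynomial.X : σ → MvPolynomial σ k)) := by
    rw [MvPolynomial.adjoin_range_X]
    trivial
  induction hp using Algebra.adjoin_induction with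
  | mem x hx => exact Algebra.subset_adjoin hx
  | algebraMap r =>
    exact Subalgebra.algebraMap_mem _
      (algebraMap k (MvPolynomial.homogeneousSubmodule σ k 0) r)
  | add x y _ _ hx hy => exact add_mem hx hy
  | mul x y _ _ hx hy => exact mul_mem hx hy

theorem away_mk_prod_pow {R A ι : Type*} [CommRing R] [CommRing A] [Algebra R A] [Fintype ι]
    (𝒜 : ℕ → Submodule R A) [GradedAlgebra 𝒜] {f : A} (hf : f ∈ 𝒜 1) {v : ι → A}
    (hv : ∀ i, v i ∈ 𝒜 1) {m : ι → ℕ} {n : ℕ} (hn : n = ∑ i, m i) (h) :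
    Away.mk 𝒜 hf n (∏ i, v i ^ m i) h =
      ∏ i, (Away.mk 𝒜 hf 1 (v i) (hv i)) ^ m i := by
  apply val_injective
  have hv (i : ι) : algebraMap (Away 𝒜 f) (Localization.Away f)
      (Away.mk 𝒜 hf 1 (v i) (hv i)) = Localization.mk (v i) (⟨f ^ 1, by use 1⟩ : Submonoid.powers f) := rfl
  change Localization.mk _ _ = algebraMap (Away 𝒜 f) (Localization.Away f) _
  simp only [map_prod, map_pow, hv, Localization.mk_pow, Localization.mk_prod]
  congr 1
  apply Subtype.ext
  simp [hn, Finset.prod_pow_eq_pow_sum]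

theorem away_mem_subfield {R A ι : Type*} [CommRing R] [CommRing A] [Algebra R A] [Fintype ι]
    (𝒜 : ℕ → Submodule R A) [GradedAlgebra 𝒜] {f : A} (hf : f ∈ 𝒜 1) {v : ι → A}
    (hv : ∀ i, v i ∈ 𝒜 1) (hgen : Algebra.adjoin (𝒜 0) (Set.range v) = ⊤)
    {K : Type*} [Field K] (θ : Away 𝒜 f →+* K) (E : Subfield K)
    (hc : ∀ c : 𝒜 0, θ (fromZeroRingHom _ _ c) ∈ E)
    (ht : ∀ j, θ (Away.mk _ hf 1 (v j) (hv j)) ∈ E) (a) : θ a ∈ E := by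
  have ha : a ∈ Algebra.adjoin _ _ := (Away.adjoin_mk_prod_pow_eq_top
    (𝒜 := 𝒜) hf ι v hgen (fun _ => 1) hv).ge (Algebra.mem_top (x := a))
  induction ha using Algebra.adjoin_induction with
  | mem x hx =>
    obtain ⟨n, m, hm, -, rfl⟩ := hx
    rw [away_mk_prod_pow 𝒜 hf hv (by simpa using hm.symm), map_prod]
    refine prod_mem fun j _ => ?_
    rw [map_pow]
    exact pow_mem (ht j) (m j)
  | algebraMap r => exact hc r
  | add x y _ _ hx hy => rw [map_add]; exact add_mem hx hy
  | mul x y _ _ hx hy => rw [map_mul]; exact mul_mem hx hy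

theorem exists_algebraMap_eq_homogeneousSubmodule_zero {σ k : Type*} [Field k]
    (r : MvPolynomial.homogeneousSubmodule σ k 0) : ∃ c : k, algebraMap k _ c = r := by
  have h0 : r.1.IsHomogeneous 0 := r.2
  refine ⟨MvPolynomial.coeff 0 r.1, Subtype.ext ?_⟩
  have h1 := MvPolynomial.totalDegree_eq_zero_iff_eq_C.mp (Nat.le_zero.mp h0.totalDegree_le)
  exact h1.symm

/-- The generator is the value of the affine coordinate. A subfield containing it contains all
values on the chart, the constants being rational numbers, so the point factors through that
subfield. Closed points need no separate treatment. -/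
theorem exists_generator_residueField (q : Proj (MvPolynomial.homogeneousSubmodule (Fin 2) ℚ)) :
    ∃ t : (Proj (MvPolynomial.homogeneousSubmodule (Fin 2) ℚ)).residueField q,
      ∀ E : Subfield ((Proj (MvPolynomial.homogeneousSubmodule (Fin 2) ℚ)).residueField q),
        t ∈ E → E = ⊤ := by
  let 𝒜 := MvPolynomial.homogeneousSubmodule (Fin 2) ℚ
  have hX (i : Fin 2) : MvPolynomial.X i ∈ 𝒜 1 := MvPolynomial.isHomogeneous_X ℚ i
  obtain ⟨i, hi⟩ : ∃ i : Fin 2, q ∈ Proj.basicOpen 𝒜 (MvPolynomial.X i) := by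
    have := Proj.iSup_basicOpen_eq_top' 𝒜 (MvPolynomial.X : Fin 2 → MvPolynomial (Fin 2) ℚ)
      (fun i => ⟨1, hX i⟩) adjoin_range_X_eq_top
    have hq : q ∈ (⊤ : (Proj 𝒜).Opens) := trivial
    rwa [← this, TopologicalSpace.Opens.mem_iSup] at hq
  have hrange : Set.range ((Proj 𝒜).fromSpecResidueField q) ⊆
      Set.range (Proj.awayι 𝒜 _ (hX i) one_pos) := by
    rw [Scheme.range_fromSpecResidueField, Set.singleton_subset_iff]
    change q ∈ (Proj.awayι 𝒜 _ (hX i) one_pos).opensRange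
    rwa [Proj.opensRange_awayι]
  let θ := Spec.preimage (IsOpenImmersion.lift (Proj.awayι 𝒜 _ (hX i) one_pos)
    ((Proj 𝒜).fromSpecResidueField q) hrange)
  have hθ : Spec.map θ ≫ Proj.awayι 𝒜 _ (hX i) one_pos = (Proj 𝒜).fromSpecResidueField q := by
    rw [Spec.map_preimage, IsOpenImmersion.lift_fac]
  -- In `Fin 2`, `1 - i` is the index other than `i`.
  refine ⟨θ.hom (Away.mk 𝒜 (hX i) 1 (MvPolynomial.X (1 - i)) (hX (1 - i))), fun E hE => ?_⟩
  have hmem : ∀ a, θ.hom a ∈ E := by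
    refine away_mem_subfield 𝒜 (hX i) hX adjoin_range_X_eq_top θ.hom E (fun c => ?_) fun j => ?_
    · obtain ⟨c, rfl⟩ := exists_algebraMap_eq_homogeneousSubmodule_zero c
      have h1 := eq_ratCast (θ.hom.comp ((fromZeroRingHom 𝒜 _).comp (algebraMap ℚ (𝒜 0)))) c
      have h2 : θ.hom (fromZeroRingHom 𝒜 _ (algebraMap ℚ (𝒜 0) c)) = c := h1
      rw [h2]
      exact SubfieldClass.ratCast_mem E c
    · by_cases hj : j = i
      · subst hj
        have h1 : Away.mk 𝒜 (hX j) 1 (MvPolynomial.X j) (hX j) = 1 := by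
          apply val_injective
          rw [Away.val_mk, val_one]
          simpa only [pow_one] using Localization.mk_self_mk (S := Submonoid.powers _) (MvPolynomial.X j) ⟨1, pow_one _⟩
        rw [h1, map_one]
        exact one_mem E
      · have h1 : j = 1 - i := by
          fin_cases i <;> fin_cases j <;> simp_all
        subst h1
        exact hE
  let ι : CommRingCat.of E ⟶ (Proj 𝒜).residueField q := CommRingCat.ofHom E.subtype
  let θ' : CommRingCat.of (Away 𝒜 (MvPolynomial.X i)) ⟶ .of E :=
    CommRingCat.ofHom (θ.hom.codRestrict E hmem)
  have hθ' : θ' ≫ ι = θ := rfl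
  obtain ⟨c, g, hg, hT⟩ := exists_eq_map_fromSpecStalk
    (Spec.map θ' ≫ Proj.awayι 𝒜 _ (hX i) one_pos)
  rw [← hθ', Spec.map_comp, Category.assoc, hT] at hθ
  have hι : Spec.map ι (closedPoint ((Proj 𝒜).residueField q)) =
      (closedPoint E : PrimeSpectrum E) := Subsingleton.elim (α := PrimeSpectrum E) _ _
  obtain rfl : q = c := by
    have h1 : (Proj 𝒜).fromSpecResidueField q (closedPoint ((Proj 𝒜).residueField q)) = q :=
      Scheme.fromSpecResidueField_apply q _
    rw [← h1, ← hθ]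
    refine (congrArg (Spec.map g ≫ (Proj 𝒜).fromSpecStalk c) hι).trans ?_
    exact map_fromSpecStalk_closedPoint g
  rw [Scheme.fromSpecResidueField, ← Spec.map_comp_assoc, cancel_mono] at hθ
  have h2 := Spec.map_injective hθ
  rw [eq_top_iff]
  intro z _
  obtain ⟨a, rfl⟩ := (Proj 𝒜).residue_surjective q z
  have h3 : ι.hom (g.hom a) = ((Proj 𝒜).residue q).hom a := congrArg (fun φ => φ.hom a) h2
  rw [← h3]
  exact (g.hom a : E).2

end ProjectiveLine

end CurvePoints

/-! ### From a degree two morphism to a model with n ≥ 3 -/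

namespace CurvePoints

section DegreeTwo

theorem finrank_adjoin_singleton_eq {F κ κ' : Type*} [Field F] [Algebra ℚ F] [Field κ] [Field κ']
    [Algebra κ κ'] (e : F ≃+* κ') (t : κ) (ht : ∀ E : Subfield κ, t ∈ E → E = ⊤) :
    Module.finrank (IntermediateField.adjoin ℚ {e.symm (algebraMap κ κ' t)}) F =
      Module.finrank κ κ' := by
  set x := e.symm (algebraMap κ κ' t)
  let r : κ →+* F := (e.symm : κ' →+* F).comp (algebraMap κ κ')
  have h1 : ∀ z, r z ∈ IntermediateField.adjoin ℚ {x} := by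
    have : (IntermediateField.adjoin ℚ {x}).toSubfield.comap r = ⊤ :=
      ht _ (IntermediateField.mem_adjoin_simple_self ℚ x)
    intro z
    exact this.ge (Subfield.mem_top z)
  let i : κ →+* IntermediateField.adjoin ℚ {x} :=
    r.codRestrict (IntermediateField.adjoin ℚ {x}).toSubfield h1
  have hi : Function.Bijective i := by
    refine ⟨i.injective, fun z => ?_⟩
    have hle : IntermediateField.adjoin ℚ {x} ≤
        r.fieldRange.toIntermediateField (fun c => by
          rw [eq_ratCast]
          exact SubfieldClass.ratCast_mem _ c) := by
      rw [IntermediateField.adjoin_simple_le_iff]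
      exact ⟨t, rfl⟩
    obtain ⟨w, hw⟩ := hle z.2
    exact ⟨w, Subtype.ext hw⟩
  refine (Algebra.finrank_eq_of_equiv_equiv (RingEquiv.ofBijective i hi) e.symm ?_).symm
  rfl

variable {C : Scheme.{0}} (s : C ⟶ Spec (.of ℚ)) [IsIntegral C]

attribute [local instance] MvPolynomial.gradedAlgebra

theorem exists_finrank_adjoin_eq_residueDegree (π : C ⟶ projectiveLine ℚ) :
    letI := stalkAlgebra s (genericPoint C)
    ∃ x : C.functionField, Module.finrank (IntermediateField.adjoin ℚ {x}) C.functionField =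
      π.residueDegree (genericPoint C) := by
  let := stalkAlgebra s (genericPoint C)
  obtain ⟨t, ht⟩ : ∃ t : (projectiveLine ℚ).residueField (π (genericPoint C)),
      ∀ E : Subfield ((projectiveLine ℚ).residueField (π (genericPoint C))), t ∈ E → E = ⊤ :=
    exists_generator_residueField (π (genericPoint C))
  let e : C.functionField ≃+* C.residueField (genericPoint C) :=
    RingEquiv.ofBijective (C.residue (genericPoint C)).hom
      ⟨RingHom.injective (R := C.functionField) _, C.residue_surjective _⟩
  let := (π.residueFieldMap (genericPoint C)).hom.toAlgebra
  exact ⟨_, finrank_adjoin_singleton_eq e t ht⟩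

/-- If x were algebraic, F would be finite and separable over k, and its differentials would vanish.
-/
theorem transcendental_of_finrank_pos {k F : Type*} [Field k] [CharZero k] [Field F] [Algebra k F]
    (h0 : ¬ Subsingleton Ω[F⁄k]) {x : F}
    (hx : 0 < Module.finrank (IntermediateField.adjoin k {x}) F) : Transcendental k x := by
  intro hx'
  apply h0
  have h1 : FiniteDimensional k (IntermediateField.adjoin k {x}) :=
    IntermediateField.adjoin.finiteDimensional hx'.isIntegral
  have h2 : FiniteDimensional (IntermediateField.adjoin k {x}) F := Module.finite_of_finrank_pos hx
  have : FiniteDimensional k F := FiniteDimensional.trans k (IntermediateField.adjoin k {x}) F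
  have : Algebra.FormallyUnramified k F := .of_isSeparable k F
  infer_instance

variable [IsCurve s]

/-- Regularity at the centre of `V` on the proper curve gives regularity at `V`. -/
theorem regularDifferentials_mem {ω} (hω : ω ∈ regularDifferentials s)
    (V : ValuationSubring C.functionField)
    (hV : letI := stalkAlgebra s (genericPoint C); ∀ c, algebraMap ℚ C.functionField c ∈ V) :
    letI := stalkAlgebra s (genericPoint C)
    ω ∈ Submodule.span ℚ {ω : Ω[C.functionField⁄ℚ] | ∃ a ∈ V, ∃ b ∈ V,
      ω = a • KaehlerDifferential.D ℚ C.functionField b} := by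
  let := stalkAlgebra s (genericPoint C)
  obtain ⟨x, hx⟩ := exists_isCenter s V hV
  refine Submodule.span_mono ?_ ((Submodule.mem_iInf _).mp hω x)
  rintro _ ⟨a, b, rfl⟩
  exact ⟨_, hx.mem a, _, hx.mem b, rfl⟩

theorem IsHyperelliptic.exists_model (h : IsHyperelliptic s) :
    letI := stalkAlgebra s (genericPoint C)
    ∃ (x y : C.functionField) (f : Polynomial ℚ) (n : ℕ), HyperellipticModel ℚ x y f ∧
      f.natDegree = 2 * n ∧ 3 ≤ n := by
  let := stalkAlgebra s (genericPoint C)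
  obtain ⟨hg, π, -, hπ⟩ := h
  have hg' : 2 ≤ Module.finrank ℚ (regularDifferentials s) := hg
  obtain ⟨x, hx⟩ := exists_finrank_adjoin_eq_residueDegree s π
  rw [hπ] at hx
  have hΩ : ¬ Subsingleton Ω[C.functionField⁄ℚ] := by
    intro h
    rw [Module.finrank_zero_of_subsingleton] at hg'
    omega
  obtain ⟨x, y, f, n, m, hn⟩ := HyperellipticModel.exists_of_finrank_eq_two
    (transcendental_of_finrank_pos hΩ (by omega)) hx
  refine ⟨x, y, f, n, m, hn, ?_⟩
  by_contra! hn2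
  obtain ⟨η, hη⟩ := m.exists_forall_mem_span_singleton hn (by omega)
  have hle : regularDifferentials s ≤ Submodule.span ℚ {η} :=
    fun ω hω => hη ω fun V hV => regularDifferentials_mem s hω V hV
  have := (Submodule.finrank_mono hle).trans (finrank_span_le_card {η})
  simp at this
  omega

end DegreeTwo

end CurvePoints

/-! ### Fibres of x and functions with poles at infinity, in terms of places -/

/-- A family of valuation rings which are exactly the nontrivial ones over the ground field. -/
structure IsPlaceFamily (L : Type*) {F ι : Type*} [Field L] [Field F] [Algebra L F]
    (v : ι → ValuationSubring F) : Prop where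
  injective : Function.Injective v
  algebraMap_mem (i : ι) (c : L) : algebraMap L F c ∈ v i
  exists_eq (V : ValuationSubring F) (hV : ∀ c : L, algebraMap L F c ∈ V) (hV' : V ≠ ⊤) :
    ∃ i, v i = V

namespace IsPlaceFamily

open Polynomial

variable {L F ι : Type*} [Field L] [Field F] [Algebra L F] {v : ι → ValuationSubring F}

theorem exists_eq_of_notMem (hv : IsPlaceFamily L v) {V : ValuationSubring F}
    (hV : ∀ c : L, algebraMap L F c ∈ V) {z : F} (hz : z ∉ V) : ∃ i, v i = V :=
  hv.exists_eq V hV fun h => hz (h ▸ ValuationSubring.mem_top z)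

theorem exists_eq_of_mem_nonunits (hv : IsPlaceFamily L v) {V : ValuationSubring F}
    (hV : ∀ c : L, algebraMap L F c ∈ V) {z : F} (hz0 : z ≠ 0) (hz : z ∈ V.nonunits) :
    ∃ i, v i = V :=
  hv.exists_eq_of_notMem hV (z := z⁻¹) fun h => V.one_notMem_nonunits <| by
    simpa [hz0] using V.nonunits_mul_mem hz h

theorem _root_.ValuationSubring.exists_sub_mem_nonunits_of_sq [IsAlgClosed L]
    (V : ValuationSubring F) {y : F} {c : L}
    (h : y ^ 2 - algebraMap L F c ∈ V.nonunits) :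
    ∃ y₀ : L, y₀ ^ 2 = c ∧ y - algebraMap L F y₀ ∈ V.nonunits := by
  obtain ⟨r, hr⟩ := IsAlgClosed.exists_pow_nat_eq c two_pos
  by_cases h1 : y - algebraMap L F r ∈ V.nonunits
  · exact ⟨r, hr, h1⟩
  · refine ⟨-r, by rw [neg_sq, hr], V.mem_nonunits_of_mul_mem h1 ?_⟩
    convert h using 1
    rw [← hr, map_neg, map_pow]
    ring

variable [CharZero L] {x y : F} {f : L[X]}

omit [CharZero L] in
theorem exists_index (hv : IsPlaceFamily L v) (m : HyperellipticModel L x y f) (x₀ : L) :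
    ∃ i, x - algebraMap L F x₀ ∈ (v i).nonunits := by
  obtain ⟨V, hV, -, h⟩ := m.transcendental.exists_valuationSubring_aeval_mem_nonunits
    (not_isUnit_X_sub_C x₀)
  have h1 : aeval x (X - C x₀) ≠ 0 := m.aeval_ne_zero (X_sub_C_ne_zero x₀)
  obtain ⟨i, rfl⟩ := hv.exists_eq_of_mem_nonunits hV h1 h
  exact ⟨i, by simpa using h⟩

theorem eq_of_sub_mem_nonunits (hv : IsPlaceFamily L v) (m : HyperellipticModel L x y f)
    {x₀ y₀ : L} {i j : ι} (hi : x - algebraMap L F x₀ ∈ (v i).nonunits)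
    (hi' : y - algebraMap L F y₀ ∈ (v i).nonunits) (hj : x - algebraMap L F x₀ ∈ (v j).nonunits)
    (hj' : y - algebraMap L F y₀ ∈ (v j).nonunits) : i = j :=
  hv.injective (m.valuationSubring_eq (hv.algebraMap_mem i) (hv.algebraMap_mem j) hi hi' hj hj')

/-- The pole bound gives 2 deg b + 2n ≤ 2j when b ≠ 0, so j < n leaves no room for a term in y. -/
theorem eq_aeval_of_pole_le (hv : IsPlaceFamily L v) (m : HyperellipticModel L x y f) {n j : ℕ}
    (hn : f.natDegree = 2 * n) (hj : j < n) {h : F} (hfin : ∀ i, x ∈ v i → h ∈ v i)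
    (hinf : ∀ i, x ∉ v i → h * x⁻¹ ^ j ∈ v i) :
    ∃ a : L[X], h = aeval x a ∧ a.natDegree ≤ j := by
  obtain ⟨a, b, hab, ha, hb⟩ := m.eq_aeval_add_of_pole_le (h := h) (j := j)
    (fun V hV hx => by
      by_cases hV' : V = ⊤
      · exact hV' ▸ ValuationSubring.mem_top h
      · obtain ⟨i, rfl⟩ := hv.exists_eq V hV hV'
        exact hfin i hx)
    (fun V hV hx => by
      obtain ⟨i, rfl⟩ := hv.exists_eq_of_notMem hV hx
      exact hinf i hx)
  have hb0 : b = 0 := by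
    by_contra h0
    have := hb h0
    omega
  exact ⟨a, by simpa [hb0] using hab, ha⟩

variable [IsAlgClosed L]

omit [CharZero L] in
theorem exists_sub_mem_nonunits (hv : IsPlaceFamily L v) (m : HyperellipticModel L x y f) {x₀ : L}
    {i : ι} (hi : x - algebraMap L F x₀ ∈ (v i).nonunits) :
    ∃ y₀ : L, y₀ ^ 2 = f.eval x₀ ∧ y - algebraMap L F y₀ ∈ (v i).nonunits := by
  refine (v i).exists_sub_mem_nonunits_of_sq ?_
  rw [m.y_sq]
  exact (v i).aeval_sub_mem_nonunits (hv.algebraMap_mem i) hi f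

/-- A place over x₀ is determined by the value of y, which is one of the two square roots of f(x₀).
-/
theorem encard_le_two (hv : IsPlaceFamily L v) (m : HyperellipticModel L x y f) (x₀ : L) :
    {i | x - algebraMap L F x₀ ∈ (v i).nonunits}.encard ≤ 2 := by
  obtain ⟨i, hi⟩ := hv.exists_index m x₀
  obtain ⟨y₀, hy₀, -⟩ := hv.exists_sub_mem_nonunits m hi
  have hsub (y₁ : L) : {i | x - algebraMap L F x₀ ∈ (v i).nonunits ∧
      y - algebraMap L F y₁ ∈ (v i).nonunits}.encard ≤ 1 :=
    Set.encard_le_one_iff.mpr fun i j hi hj => hv.eq_of_sub_mem_nonunits m hi.1 hi.2 hj.1 hj.2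
  refine (Set.encard_le_encard (t := _ ∪ _) ?_).trans ((Set.encard_union_le _ _).trans
    ((add_le_add (hsub y₀) (hsub (-y₀))).trans (by norm_num)))
  intro j hj
  obtain ⟨y₁, hy₁, hj'⟩ := hv.exists_sub_mem_nonunits m hj
  rcases sq_eq_sq_iff_eq_or_eq_neg.mp (hy₁.trans hy₀.symm) with rfl | rfl
  · exact Or.inl ⟨hj, hj'⟩
  · exact Or.inr ⟨hj, hj'⟩

/-- The involution turns a place with value y₀ into one with value -y₀, and these differ since y₀ ≠
0. -/
theorem two_le_encard (hv : IsPlaceFamily L v) (m : HyperellipticModel L x y f) {x₀ : L}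
    (hx₀ : f.eval x₀ ≠ 0) :
    2 ≤ {i | x - algebraMap L F x₀ ∈ (v i).nonunits}.encard := by
  obtain ⟨i, hi⟩ := hv.exists_index m x₀
  obtain ⟨y₀, hy₀, hi'⟩ := hv.exists_sub_mem_nonunits m hi
  have hy0 : y₀ ≠ 0 := by
    rintro rfl
    exact hx₀ (by rw [← hy₀]; simp)
  obtain ⟨σ, hσx, hσy⟩ := m.exists_involution
  set V := (v i).comap σ.toAlgHom.toRingHom
  have hV := HyperellipticModel.comap_involution_mem σ (v i) (hv.algebraMap_mem i)
  have hmem (z : F) : z ∈ V.nonunits ↔ σ z ∈ (v i).nonunits := by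
    rw [ValuationSubring.mem_nonunits_iff_or, ValuationSubring.mem_nonunits_iff_or,
      ValuationSubring.mem_comap, map_eq_zero_iff _ σ.injective, ← map_inv₀]
    rfl
  have hxV : x - algebraMap L F x₀ ∈ V.nonunits := by
    rwa [hmem, map_sub, hσx, AlgEquiv.commutes]
  have hyV : y - algebraMap L F (-y₀) ∈ V.nonunits := by
    rw [hmem, map_sub, hσy, AlgEquiv.commutes, map_neg, ← neg_sub', ← neg_one_mul, mul_comm]
    exact (v i).nonunits_mul_mem hi' (neg_mem (one_mem _))
  have h1 : x - algebraMap L F x₀ ≠ 0 := by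
    simpa using m.aeval_ne_zero (X_sub_C_ne_zero x₀)
  obtain ⟨j, hj⟩ := hv.exists_eq_of_mem_nonunits hV h1 hxV
  rw [show V = v j from hj.symm] at hxV hyV
  have hij : i ≠ j := by
    rintro rfl
    have := (v i).algebraMap_eq_of_sub_mem (hv.algebraMap_mem i) hi' hyV
    exact hy0 (self_eq_neg.mp this)
  rw [← Set.encard_pair hij]
  refine Set.encard_le_encard ?_
  rintro l (rfl | rfl)
  · exact hi
  · exact hxV

/-- The poles of x are the zeros of x⁻¹ in the reversed model, where the fibre is unramified because
f.reverse(0) is the leading coefficient of f. -/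
theorem exists_pair_at_infinity (hv : IsPlaceFamily L v) (m : HyperellipticModel L x y f) {n : ℕ}
    (hn : f.natDegree = 2 * n) : ∃ i j, i ≠ j ∧ ∀ l, x ∉ v l ↔ l = i ∨ l = j := by
  have hm := m.reverse hn
  have hlc : f.reverse.eval 0 ≠ 0 := by
    rw [← coeff_zero_eq_eval_zero, coeff_zero_reverse]
    exact leadingCoeff_ne_zero.mpr m.ne_zero
  obtain ⟨i, j, hij, h⟩ :=
    Set.encard_eq_two.mp (le_antisymm (hv.encard_le_two hm 0) (hv.two_le_encard hm hlc))
  refine ⟨i, j, hij, fun l => ?_⟩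
  have hl : l ∈ {i | x⁻¹ - algebraMap L F 0 ∈ (v i).nonunits} ↔ l = i ∨ l = j := by
    rw [h]
    rfl
  rw [← hl, Set.mem_ofPred_eq, map_zero, sub_zero, ValuationSubring.inv_mem_nonunits_iff]
  simp [m.x_ne_zero]

end IsPlaceFamily

/-! ### Conjugate divisors and the geometric model -/

namespace CurvePoints

open Polynomial

theorem ord_pow {X : Scheme.{u}} [IsIntegral X] [IsLocallyNoetherian X] {h : X.functionField}
    (h0 : h ≠ 0) (x : X) (n : ℕ) : Scheme.ord (h ^ n) x = n * Scheme.ord h x := by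
  induction n with
  | zero =>
    have h2 := Scheme.ord_mul (x := x) (one_ne_zero (α := X.functionField)) one_ne_zero
    rw [mul_one] at h2
    rw [pow_zero]
    push_cast
    omega
  | succ n ih =>
    rw [pow_succ, Scheme.ord_mul (pow_ne_zero n h0) h0, ih]
    push_cast
    ring

section Conjugates

variable {k : Type u} [Field k] {C : Scheme.{u}} {s : C ⟶ Spec (.of k)}
  {K : Type u} [Field K] [Algebra k K] [FiniteDimensional k K]

/-- The sum of the conjugates of a point. -/
def conjugateDivisor (P : Points s K) : GeometricDivisor s :=
  ∑ ψ : K →ₐ[k] AlgebraicClosure k, Finsupp.single (Points.map s ψ P) 1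

theorem degree_conjugateDivisor [CharZero k] (P : Points s K) :
    (conjugateDivisor P).degree = Module.finrank k K := by
  rw [conjugateDivisor, map_sum]
  simp [AlgHom.card]

theorem galoisAct_conjugateDivisor (P : Points s K)
    (σ : AlgebraicClosure k ≃ₐ[k] AlgebraicClosure k) :
    galoisAct s σ (conjugateDivisor P) = conjugateDivisor P := by
  rw [conjugateDivisor, map_sum]
  have h (ψ : K →ₐ[k] AlgebraicClosure k) :
      galoisAct s σ (Finsupp.single (Points.map s ψ P) 1) =
        Finsupp.single (Points.map s (σ.toAlgHom.comp ψ) P) 1 := by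
    rw [← points_map_comp]
    exact Finsupp.mapDomain_single
  simp_rw [h]
  let e : (K →ₐ[k] AlgebraicClosure k) ≃ (K →ₐ[k] AlgebraicClosure k) :=
    { toFun := fun ψ => σ.toAlgHom.comp ψ
      invFun := fun ψ => σ.symm.toAlgHom.comp ψ
      left_inv := fun ψ => by ext; simp
      right_inv := fun ψ => by ext; simp }
  exact e.sum_comp (fun ψ => Finsupp.single (Points.map s ψ P) (1 : ℤ))

theorem conjugateDivisor_nonneg (P : Points s K) (Q) : 0 ≤ conjugateDivisor P Q := by
  classical
  rw [conjugateDivisor, Finsupp.finsetSum_apply]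
  refine Finset.sum_nonneg fun ψ _ => ?_
  rw [Finsupp.single_apply]
  split_ifs <;> norm_num

theorem conjugateDivisor_pos (P : Points s K) (ψ : K →ₐ[k] AlgebraicClosure k) :
    0 < conjugateDivisor P (Points.map s ψ P) := by
  classical
  rw [conjugateDivisor, Finsupp.finsetSum_apply]
  refine Finset.sum_pos' (fun φ _ => ?_) ⟨ψ, Finset.mem_univ _, ?_⟩
  · rw [Finsupp.single_apply]
    split_ifs <;> norm_num
  · rw [Finsupp.single_eq_same]
    norm_num

end Conjugates

section Geometric

variable {k : Type u} [Field k] {C : Scheme.{u}} {s : C ⟶ Spec (.of k)} [IsCurve s]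

theorem hasNonconstant_of_transcendental {t : geometricFunctionField s}
    (h : letI := (geometricConst s).toAlgebra; Transcendental (AlgebraicClosure k) t) :
    HasNonconstant s := by
  let := (geometricConst s).toAlgebra
  refine ⟨t, ?_⟩
  rintro ⟨c, rfl⟩
  exact h (isAlgebraic_algebraMap c)

theorem HasNonconstant.isPlaceFamily (hX : HasNonconstant s) :
    letI := (geometricConst s).toAlgebra
    IsPlaceFamily (AlgebraicClosure k) hX.place :=
  letI := (geometricConst s).toAlgebra
  ⟨hX.place_injective, hX.const_mem_place, hX.exists_place_eq⟩

theorem mem_principalDivisors_of_subsingleton [CharZero k] (hJ : Subsingleton (jacobianPoints s))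
    {D : GeometricDivisor s} (hD : D.degree = 0)
    (hσ : ∀ σ : AlgebraicClosure k ≃ₐ[k] AlgebraicClosure k, galoisAct s σ D = D) :
    D ∈ principalDivisors s := by
  have hmem : QuotientAddGroup.mk' (principalDivisors s) D ∈ jacobianPoints s := by
    refine ⟨D, ⟨hD, AddSubgroup.mem_iInf.mpr fun σ => ?_⟩, rfl⟩
    rw [AddMonoidHom.mem_ker, AddMonoidHom.sub_apply, AddMonoidHom.comp_apply, hσ, sub_self]
  have h0 := congrArg Subtype.val (hJ.elim ⟨_, hmem⟩ 0)
  exact (QuotientAddGroup.eq_zero_iff D).mp h0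

theorem HasNonconstant.mem_place_of_sub_mem (hX : HasNonconstant s)
    {Q : Points s (AlgebraicClosure k)} {h : geometricFunctionField s} {c : AlgebraicClosure k}
    (hc : h - geometricConst s c ∈ (hX.place Q).nonunits) : h ∈ hX.place Q := by
  have := add_mem (ValuationSubring.nonunits_subset hc) (hX.const_mem_place _ c)
  rwa [sub_add_cancel] at this

variable [IsIntegral C]

theorem geometric_model [CharZero k] {x y : C.functionField} {f : k[X]} {n : ℕ}
    (hn : f.natDegree = 2 * n) (hn0 : 0 < n) (m : letI := stalkAlgebra s (genericPoint C);
      HyperellipticModel k x y f) :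
    letI := (geometricConst s).toAlgebra
    HyperellipticModel (AlgebraicClosure k) (functionFieldMap s x) (functionFieldMap s y)
      (f.map (algebraMap k (AlgebraicClosure k))) := by
  let := stalkAlgebra s (genericPoint C)
  let := (geometricConst s).toAlgebra
  let := (functionFieldMap s).toAlgebra
  let : Algebra k (geometricFunctionField s) :=
    ((geometricConst s).comp (algebraMap k (AlgebraicClosure k))).toAlgebra
  have : IsScalarTower k C.functionField (geometricFunctionField s) :=
    .of_algebraMap_eq fun c => (functionFieldMap_const s c).symm
  have : IsScalarTower k (AlgebraicClosure k) (geometricFunctionField s) :=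
    .of_algebraMap_eq fun c => rfl
  refine m.baseChange (F' := geometricFunctionField s) (by omega) ?_
  rw [← IntermediateField.toSubfield_injective.eq_iff]
  refine eq_top_of_forall_mem s _ (fun c => IntermediateField.algebraMap_mem _ c) fun h => ?_
  exact IntermediateField.subset_adjoin _ _ ⟨h, rfl⟩

/-- A function defined over k is regular at all conjugates of a point or at none; in particular its
set of poles is Galois-stable. -/
theorem HasNonconstant.mem_place_map (hX : HasNonconstant s) {K : Type u} [Field K] [Algebra k K]
    (P : Points s K) (φ ψ : K →ₐ[k] AlgebraicClosure k) {h : C.functionField}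
    (hh : functionFieldMap s h ∈ hX.place (Points.map s φ P)) :
    functionFieldMap s h ∈ hX.place (Points.map s ψ P) := by
  obtain ⟨z, hz⟩ := exists_value s hX P φ hh
  exact hX.mem_place_of_sub_mem (hz ψ)

theorem HasNonconstant.mem_place_galois_iff (hX : HasNonconstant s)
    (P : Points s (AlgebraicClosure k)) (σ : AlgebraicClosure k ≃ₐ[k] AlgebraicClosure k)
    {h : C.functionField} :
    functionFieldMap s h ∈ hX.place (Points.map s σ.toAlgHom P) ↔
      functionFieldMap s h ∈ hX.place P := by
  constructor
  · intro hh
    have := hX.mem_place_map P σ.toAlgHom (AlgHom.id k _) hh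
    rwa [points_map_id] at this
  · intro hh
    refine hX.mem_place_map P (AlgHom.id k _) σ.toAlgHom ?_
    rwa [points_map_id]

omit [IsCurve s] [IsIntegral C] in
theorem points_map_galois_injective (σ : AlgebraicClosure k ≃ₐ[k] AlgebraicClosure k) :
    Function.Injective (Points.map s σ.toAlgHom) := by
  have h (P : Points s (AlgebraicClosure k)) :
      Points.map s σ.symm.toAlgHom (Points.map s σ.toAlgHom P) = P := by
    rw [points_map_comp]
    convert points_map_id P
    ext z
    exact σ.symm_apply_apply z
  exact Function.LeftInverse.injective h

end Geometric

end CurvePoints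

/-- The intermediate field on which two homomorphisms agree. -/
def AlgHom.equalizerField {k K L : Type*} [Field k] [Field K] [Field L] [Algebra k K]
    [Algebra k L] (φ ψ : K →ₐ[k] L) : IntermediateField k K :=
  (AlgHom.equalizer φ ψ).toIntermediateField fun x hx => by
    rw [AlgHom.mem_equalizer] at hx ⊢
    rw [map_inv₀, map_inv₀, hx]

theorem AlgHom.mem_equalizerField {k K L : Type*} [Field k] [Field K] [Field L] [Algebra k K]
    [Algebra k L] {φ ψ : K →ₐ[k] L} {x : K} : x ∈ φ.equalizerField ψ ↔ φ x = ψ x :=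
  Iff.rfl

theorem AlgHom.ext_of_adjoin_singleton_eq_top {k K L : Type*} [Field k] [Field K] [Field L]
    [Algebra k K] [Algebra k L] {φ ψ : K →ₐ[k] L} {z : K}
    (hz : IntermediateField.adjoin k {z} = ⊤) (h : φ z = ψ z) : φ = ψ := by
  ext w
  have h1 : IntermediateField.adjoin k {z} ≤ φ.equalizerField ψ :=
    IntermediateField.adjoin_simple_le_iff.mpr h
  rw [hz] at h1
  exact h1 (IntermediateField.mem_top (x := w))

/-! ### Trivial Jacobian: no new points over primitive quartic extensions -/

namespace CurvePoints

open Polynomial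

section Conjugates

variable {k : Type u} [Field k] [CharZero k] {C : Scheme.{u}} {s : C ⟶ Spec (.of k)} [IsCurve s]
  [IsIntegral C]

/-- The conjugates of P minus j times the two points at infinity form a Galois-invariant divisor of
degree 2j - 2j = 0, hence a principal one. The function has poles only at infinity, of order at most
j < n, so it is a polynomial in x; its zeros at the conjugates of P are the stated roots. -/
theorem exists_polynomial_of_subsingleton (hJ : Subsingleton (jacobianPoints s))
    (hX : HasNonconstant s) {x y : C.functionField} {f : (AlgebraicClosure k)[X]} {n j : ℕ}
    (hn : f.natDegree = 2 * n) (hj : j < n)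
    (m : letI := (geometricConst s).toAlgebra
      HyperellipticModel (AlgebraicClosure k) (functionFieldMap s x) (functionFieldMap s y) f)
    {K : Type u} [Field K] [Algebra k K] [FiniteDimensional k K]
    (hK : Module.finrank k K = 2 * j) (P : Points s K) {z : K}
    (hz : ∀ ψ : K →ₐ[k] AlgebraicClosure k, functionFieldMap s x - geometricConst s (ψ z) ∈
      (hX.place (Points.map s ψ P)).nonunits) :
    ∃ a : (AlgebraicClosure k)[X], a ≠ 0 ∧ a.natDegree ≤ j ∧
      ∀ ψ : K →ₐ[k] AlgebraicClosure k, a.eval (ψ z) = 0 := by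
  classical
  let := (geometricConst s).toAlgebra
  have hv := hX.isPlaceFamily
  obtain ⟨A, B, hAB, hinf⟩ := hv.exists_pair_at_infinity m hn
  have hx0 : functionFieldMap s x ≠ 0 := m.x_ne_zero
  have hmem (Q) : functionFieldMap s x ∈ hX.place Q ↔ Q ≠ A ∧ Q ≠ B := by
    rw [← not_iff_not, hinf]
    tauto
  let D : GeometricDivisor s :=
    conjugateDivisor P - j • (Finsupp.single A 1 + Finsupp.single B 1)
  have hD0 : D.degree = 0 := by
    simp only [D, map_sub, map_nsmul, map_add, degree_conjugateDivisor, hK,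
      Finsupp.degree_single]
    push_cast
    simp only [nsmul_eq_mul]
    ring
  -- A and B need not be rational individually: σ permutes the poles of x, so A + B is invariant.
  have hDσ (σ : AlgebraicClosure k ≃ₐ[k] AlgebraicClosure k) : galoisAct s σ D = D := by
    have hs (Q) : galoisAct s σ (Finsupp.single Q 1) =
        Finsupp.single (Points.map s σ.toAlgHom Q) 1 := Finsupp.mapDomain_single
    have hp {Q} (hQ : Q = A ∨ Q = B) :
        Points.map s σ.toAlgHom Q = A ∨ Points.map s σ.toAlgHom Q = B := by
      rwa [← hinf, hX.mem_place_galois_iff, hinf]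
    have hne := (points_map_galois_injective (s := s) σ).ne hAB
    simp only [D, map_sub, map_nsmul, map_add, galoisAct_conjugateDivisor, hs]
    congr 2
    rcases hp (.inl rfl) with h1 | h1 <;> rcases hp (.inr rfl) with h2 | h2
    · exact absurd (h1.trans h2.symm) hne
    · rw [h1, h2]
    · rw [h1, h2, add_comm]
    · exact absurd (h1.trans h2.symm) hne
  obtain ⟨h, h0, hD⟩ := mem_principalDivisors_of_subsingleton hJ hD0 hDσ
  have hDapp (Q) : D Q = conjugateDivisor P Q -
      j * ((if A = Q then 1 else 0) + (if B = Q then 1 else 0)) := by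
    simp only [D, Finsupp.sub_apply, Finsupp.smul_apply, Finsupp.add_apply, Finsupp.single_apply,
      nsmul_eq_mul]
  have hDfin {Q} (hQ : functionFieldMap s x ∈ hX.place Q) : D Q = conjugateDivisor P Q := by
    rw [hDapp, if_neg ((hmem Q).mp hQ).1.symm, if_neg ((hmem Q).mp hQ).2.symm]
    ring
  obtain ⟨a, rfl, ha⟩ := hv.eq_aeval_of_pole_le m hn hj (h := h)
    (fun Q hQ => by
      rw [← hX.ord_nonneg_iff Q h0, ← hD, hDfin hQ]
      exact conjugateDivisor_nonneg P Q)
    -- At a pole of x the order of h is at least -j, since A and B are distinct and Q equals at most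
    -- one of them; x⁻¹ has order at least 1, which compensates.
    (fun Q hQ => by
      have h1 := (hX.ord_pos_iff Q (inv_ne_zero hx0)).mpr
        (ValuationSubring.inv_mem_nonunits_of_notMem _ hQ)
      have hx1 := pow_ne_zero j (inv_ne_zero hx0)
      rw [← hX.ord_nonneg_iff Q (mul_ne_zero h0 hx1), Scheme.ord_mul h0 hx1,
        ord_pow (inv_ne_zero hx0), ← hD, hDapp]
      have h2 := conjugateDivisor_nonneg P Q
      have h3 : ((if A = Q then 1 else 0) + (if B = Q then 1 else 0) : ℤ) ≤ 1 := by
        split_ifs with hA hB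
        · exact absurd (hA.trans hB.symm) hAB
        all_goals norm_num
      have h4 : (0 : ℤ) ≤ j := Int.natCast_nonneg j
      nlinarith)
  refine ⟨a, fun ha0 => h0 (by rw [ha0, map_zero]), ha, fun ψ => ?_⟩
  have hQ : functionFieldMap s x ∈ hX.place (Points.map s ψ P) :=
    hX.mem_place_of_sub_mem (hz ψ)
  have hpos : aeval (functionFieldMap s x) a ∈ (hX.place (Points.map s ψ P)).nonunits := by
    rw [← hX.ord_pos_iff _ h0, ← hD, hDfin hQ]
    exact conjugateDivisor_pos P ψ
  by_contra hc
  refine ValuationSubring.algebraMap_notMem_nonunits _ (hv.algebraMap_mem (Points.map s ψ P)) hc ?_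
  have h1 := (hX.place (Points.map s ψ P)).aeval_sub_mem_nonunits
    (hv.algebraMap_mem (Points.map s ψ P)) (hz ψ) a
  have h2 := sub_mem hpos h1
  rwa [sub_sub_cancel] at h2

/-- If z generated K, its 2j conjugates would be distinct roots of a nonzero polynomial of degree at
most j. -/
theorem adjoin_value_ne_top (hJ : Subsingleton (jacobianPoints s))
    (hX : HasNonconstant s) {x y : C.functionField} {f : (AlgebraicClosure k)[X]} {n j : ℕ}
    (hn : f.natDegree = 2 * n) (hj : j < n)
    (m : letI := (geometricConst s).toAlgebra
      HyperellipticModel (AlgebraicClosure k) (functionFieldMap s x) (functionFieldMap s y) f)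
    {K : Type u} [Field K] [Algebra k K] [FiniteDimensional k K]
    (hK : Module.finrank k K = 2 * j) (P : Points s K) {z : K}
    (hz : ∀ ψ : K →ₐ[k] AlgebraicClosure k, functionFieldMap s x - geometricConst s (ψ z) ∈
      (hX.place (Points.map s ψ P)).nonunits) :
    IntermediateField.adjoin k {z} ≠ ⊤ := by
  classical
  intro htop
  obtain ⟨a, ha0, ha, haz⟩ := exists_polynomial_of_subsingleton hJ hX hn hj m hK P hz
  have hinj : Function.Injective fun ψ : K →ₐ[k] AlgebraicClosure k => ψ z := by
    exact fun φ ψ h => φ.ext_of_adjoin_singleton_eq_top htop h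
  have h1 := Finset.card_le_card (s := Finset.univ.image
    fun ψ : K →ₐ[k] AlgebraicClosure k => ψ z) (t := a.roots.toFinset) fun w hw => by
      obtain ⟨ψ, -, rfl⟩ := Finset.mem_image.mp hw
      simpa [ha0] using haz ψ
  rw [Finset.card_image_of_injective _ hinj, Finset.card_univ, AlgHom.card] at h1
  have h2 := (Multiset.toFinset_card_le a.roots).trans (card_roots' a)
  have := Module.finrank_pos (R := k) (M := K)
  omega

omit [CharZero k] [IsCurve s] [IsIntegral C] in
theorem exists_map_ofId_eq_map_val {K : Type u} [Field K] [Algebra k K]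
    (P : Points s (⊥ : IntermediateField k K)) :
    ∃ P' : Points s k, Points.map s (Algebra.ofId k K) P' =
      Points.map s (⊥ : IntermediateField k K).val P := by
  refine ⟨Points.map s (IntermediateField.botEquiv k K).toAlgHom P, ?_⟩
  rw [points_map_comp]
  congr 1
  ext w
  obtain ⟨c, rfl⟩ := (IntermediateField.botEquiv k K).symm.surjective w
  simp

omit [IsCurve s] [IsIntegral C] in
theorem not_forall_map_mem_of_encard_le_two {K : Type u} [Field K] [Algebra k K]
    [FiniteDimensional k K] (hK : Module.finrank k K = 4) {P : Points s K}
    (hP : Function.Injective fun ψ : K →ₐ[k] AlgebraicClosure k => Points.map s ψ P)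
    {S : Set (Points s (AlgebraicClosure k))} (hS : S.encard ≤ 2) :
    ¬ ∀ ψ, Points.map s ψ P ∈ S := by
  intro h
  have h1 : Set.range (fun ψ : K →ₐ[k] AlgebraicClosure k => Points.map s ψ P) ⊆ S := by
    rintro _ ⟨ψ, rfl⟩
    exact h ψ
  have h2 := (Set.encard_le_encard h1).trans hS
  rw [← Set.image_univ, hP.encard_image, Set.encard_univ, ENat.card_eq_coe_fintype_card,
    AlgHom.card, hK] at h2
  exact absurd h2 (by norm_num)

/-- If the Jacobian of a hyperelliptic curve has no nonzero rational points, then a primitive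
quartic extension produces no new points. -/
theorem pointsEqBase_of_forall_intermediateField (hJ : Subsingleton (jacobianPoints s))
    (hX : HasNonconstant s) {x y : C.functionField} {f : (AlgebraicClosure k)[X]} {n : ℕ}
    (hn : f.natDegree = 2 * n) (hn3 : 3 ≤ n)
    (m : letI := (geometricConst s).toAlgebra
      HyperellipticModel (AlgebraicClosure k) (functionFieldMap s x) (functionFieldMap s y) f)
    {K : Type u} [Field K] [Algebra k K] (hK : Module.finrank k K = 4)
    (hprim : ∀ E : IntermediateField k K, E = ⊥ ∨ E = ⊤) : PointsEqBase s K := by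
  let := (geometricConst s).toAlgebra
  have hv := hX.isPlaceFamily
  have : FiniteDimensional k K := .of_finrank_pos (by omega)
  intro P
  by_contra hP
  -- If two embeddings agree on P, then P is defined over the field where they coincide. Primitivity
  -- leaves k, which is excluded by assumption, or K, where the embeddings are equal.
  have hinj : Function.Injective fun ψ : K →ₐ[k] AlgebraicClosure k => Points.map s ψ P := by
    intro φ ψ h
    rcases hprim (φ.equalizerField ψ) with hE | hE
    · obtain ⟨P', rfl⟩ := exists_points_map_eq_of_forall P ⊥ (fun _ : Unit => φ) (fun _ => ψ)
        (fun _ => h) fun z hz => hE ▸ hz ()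
      exact absurd (exists_map_ofId_eq_map_val P') hP
    · ext w
      exact AlgHom.mem_equalizerField.mp (hE ▸ IntermediateField.mem_top)
  let φ : K →ₐ[k] AlgebraicClosure k := IsAlgClosed.lift
  by_cases hφ : functionFieldMap s x ∈ hX.place (Points.map s φ P)
  · obtain ⟨z, hz⟩ := exists_value s hX P φ hφ
    rcases hprim (IntermediateField.adjoin k {z}) with hE | hE
    -- Here x(P) = c lies in k, so the four conjugates share the fibre of x over c.
    · obtain ⟨c, rfl⟩ := IntermediateField.mem_bot.mp
        (IntermediateField.adjoin_simple_eq_bot_iff.mp hE)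
      refine not_forall_map_mem_of_encard_le_two hK hinj
        (hv.encard_le_two m (algebraMap k _ c)) fun ψ => ?_
      have := hz ψ
      rwa [AlgHom.commutes] at this
    · exact adjoin_value_ne_top hJ hX hn (j := 2) (by omega) m hK P hz hE
  -- Here P is at infinity, and the four conjugates lie among the two poles of x.
  · obtain ⟨A, B, hAB, hinf⟩ := hv.exists_pair_at_infinity m hn
    refine not_forall_map_mem_of_encard_le_two hK hinj (Set.encard_pair hAB).le fun ψ => ?_
    exact (hinf _).mp fun h => hφ (hX.mem_place_map P ψ φ h)

end Conjugates

end CurvePoints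

/-! ### Independent square roots and finitely many extensions -/

section Quadratic

open Polynomial

theorem IntermediateField.finrank_adjoin_simple_eq_two {k K : Type*} [Field k] [Field K]
    [Algebra k K] {y : K} (hy : y ∉ (algebraMap k K).range) {c : k}
    (hc : y ^ 2 = algebraMap k K c) : Module.finrank k (IntermediateField.adjoin k {y}) = 2 := by
  have h0 : (X ^ 2 - C c : k[X]).Monic := monic_X_pow_sub_C c two_ne_zero
  have h1 : aeval y (X ^ 2 - C c : k[X]) = 0 := by simp [hc]
  have hint : IsIntegral k y := ⟨_, h0, h1⟩
  rw [IntermediateField.adjoin.finrank hint]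
  refine le_antisymm ?_ ((minpoly.two_le_natDegree_iff hint).mpr hy)
  have := natDegree_le_of_dvd (minpoly.dvd k y h1) h0.ne_zero
  rwa [natDegree_X_pow_sub_C] at this

/-- An infinite family of square roots of independent elements does not lie in finitely many
finite extensions. -/
theorem IntermediateField.infinite_of_forall_exists_sq {k L ι : Type*} [Field k] [Field L]
    [Algebra k L] [IsGalois k L] [Infinite ι] {d : ι → k}
    (hd : ∀ i, ¬ IsSquare (d i)) (hd' : ∀ i j, i ≠ j → ¬ IsSquare (d i * d j))
    {S : Set (IntermediateField k L)} (hS : ∀ K ∈ S, FiniteDimensional k K)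
    (h : ∀ i, ∃ K ∈ S, ∃ x ∈ K, x ^ 2 = algebraMap k L (d i)) : S.Infinite := by
  intro hfin
  have := hfin.to_subtype
  choose K hK x hxK hx using h
  have (K : S) : FiniteDimensional k K.1 := hS K.1 K.2
  have : Algebra.IsSeparable k L := inferInstance
  have (K : S) : Finite (IntermediateField k K.1) :=
    Field.finite_intermediateField_of_exists_primitive_element k K.1
      (Field.exists_primitive_element k K.1)
  -- Pigeonhole: finitely many finite separable extensions have finitely many subfields in all, so
  -- two indices generate the same quadratic field.
  let Φ (i : ι) : Σ K : S, IntermediateField k K.1 :=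
    ⟨⟨K i, hK i⟩, IntermediateField.adjoin k {(⟨x i, hxK i⟩ : K i)}⟩
  obtain ⟨i, j, hij, hΦ⟩ := Finite.exists_ne_map_eq_of_infinite Φ
  have hE : IntermediateField.adjoin k {x i} = IntermediateField.adjoin k {x j} := by
    have := congrArg (fun E => IntermediateField.lift E.2) hΦ
    simpa only [Φ, IntermediateField.lift_adjoin_simple] using this
  have hx0 (l) : x l ≠ 0 := fun h0 => hd l <| by
    have := hx l
    rw [h0, zero_pow two_ne_zero, eq_comm, map_eq_zero] at this
    rw [this]
    exact IsSquare.zero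
  have hσ (l) (σ : L ≃ₐ[k] L) : σ (x l) = x l ∨ σ (x l) = - x l := by
    rw [← sq_eq_sq_iff_eq_or_eq_neg, ← map_pow, hx, AlgEquiv.commutes]
  have hfix (σ : L ≃ₐ[k] L) {l l'} (hE : IntermediateField.adjoin k {x l} =
      IntermediateField.adjoin k {x l'}) (h : σ (x l) = x l) : σ (x l') = x l' := by
    have h1 : IntermediateField.adjoin k {x l} ≤
        σ.toAlgHom.equalizerField (AlgHom.id k L) :=
      IntermediateField.adjoin_simple_le_iff.mpr h
    rw [hE] at h1
    exact IntermediateField.adjoin_simple_le_iff.mp h1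
  -- Each automorphism fixes both roots or negates both, so it fixes their product; thus dᵢdⱼ is a
  -- square in k.
  have hmul : x i * x j ∈ Set.range (algebraMap k L) := by
    rw [InfiniteGalois.mem_range_algebraMap_iff_fixed]
    intro σ
    rcases hσ i σ with h1 | h1
    · rw [map_mul, h1, hfix σ hE h1]
    · rcases hσ j σ with h2 | h2
      · rw [map_mul, h2, hfix σ hE.symm h2]
      · rw [map_mul, h1, h2, neg_mul_neg]
  obtain ⟨c, hc⟩ := hmul
  refine hd' i j hij ⟨c, (algebraMap k L).injective ?_⟩
  rw [map_mul, map_mul, hc, ← hx, ← hx]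
  ring

end Quadratic

/-! ### New points over imprimitive quartic extensions -/

namespace CurvePoints

open Polynomial

variable {k : Type u} [Field k] [CharZero k] {C : Scheme.{u}} {s : C ⟶ Spec (.of k)} [IsCurve s]
  [IsIntegral C]

-- The value at one conjugate determines the element of K, because embeddings are injective; the
-- values at the other conjugates follow.
omit [CharZero k] in
theorem HasNonconstant.sub_mem_nonunits_place_map (hX : HasNonconstant s) {K : Type u} [Field K]
    [Algebra k K] (P : Points s K) (φ ψ : K →ₐ[k] AlgebraicClosure k) {h : C.functionField} {z : K}
    (hz : functionFieldMap s h - geometricConst s (φ z) ∈ (hX.place (Points.map s φ P)).nonunits) :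
    functionFieldMap s h - geometricConst s (ψ z) ∈ (hX.place (Points.map s ψ P)).nonunits := by
  let := (geometricConst s).toAlgebra
  obtain ⟨w, hw⟩ := exists_value s hX P φ (hX.mem_place_of_sub_mem hz)
  obtain rfl : z = w := φ.injective <|
    (hX.place _).algebraMap_eq_of_sub_mem (hX.const_mem_place _) hz (hw φ)
  exact hw ψ

variable {x y : C.functionField} {f : k[X]} {n : ℕ}

/-- A geometric point of a hyperelliptic curve is defined over any field which contains its
coordinates. -/
theorem exists_points_map_val_eq (hX : HasNonconstant s) {f : (AlgebraicClosure k)[X]}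
    (m : letI := (geometricConst s).toAlgebra
      HyperellipticModel (AlgebraicClosure k) (functionFieldMap s x) (functionFieldMap s y) f)
    {Q : Points s (AlgebraicClosure k)} {x₀ y₀ : AlgebraicClosure k}
    (hx : functionFieldMap s x - geometricConst s x₀ ∈ (hX.place Q).nonunits)
    (hy : functionFieldMap s y - geometricConst s y₀ ∈ (hX.place Q).nonunits)
    {E : IntermediateField k (AlgebraicClosure k)} (hxE : x₀ ∈ E) (hyE : y₀ ∈ E) :
    ∃ P : Points s E, Points.map s E.val P = Q := by
  let := (geometricConst s).toAlgebra
  have hv := hX.isPlaceFamily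
  -- An automorphism fixing E preserves both coordinates, hence the point; Galois descent then
  -- brings Q down to E.
  refine exists_points_map_eq_of_forall Q E (fun σ : E.fixingSubgroup => σ.1.toAlgHom)
    (fun _ => AlgHom.id k _) (fun σ => ?_) fun z hz => ?_
  · have key {h : C.functionField} {c : AlgebraicClosure k} (hc : c ∈ E)
        (hh : functionFieldMap s h - geometricConst s c ∈ (hX.place Q).nonunits) :
        functionFieldMap s h - geometricConst s c ∈
          (hX.place (Points.map s σ.1.toAlgHom Q)).nonunits := by
      have h1 := hX.sub_mem_nonunits_place_map Q (AlgHom.id k _) σ.1.toAlgHom (h := h) (z := c)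
        (by rwa [points_map_id])
      have h2 : σ.1.toAlgHom c = c := σ.2 ⟨c, hc⟩
      rwa [h2] at h1
    rw [points_map_id]
    exact hv.eq_of_sub_mem_nonunits m (key hxE hx) (key hyE hy) hx hy
  · rw [← InfiniteGalois.fixedField_fixingSubgroup E, IntermediateField.mem_fixedField_iff]
    exact fun σ hσ => hz ⟨σ, hσ⟩

/-- If the Jacobian of a hyperelliptic curve has no nonzero rational points, then the points whose
`x`-coordinate is a square root of a nonsquare are new points over imprimitive quartic
extensions. -/
theorem exists_quartic_not_pointsEqBase (hJ : Subsingleton (jacobianPoints s))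
    (hX : HasNonconstant s) (hn : f.natDegree = 2 * n) (hn3 : 3 ≤ n)
    (m : letI := (geometricConst s).toAlgebra
      HyperellipticModel (AlgebraicClosure k) (functionFieldMap s x) (functionFieldMap s y)
        (f.map (algebraMap k (AlgebraicClosure k))))
    {d : k} (hd : ¬ IsSquare d) :
    ∃ K : IntermediateField k (AlgebraicClosure k), Module.finrank k K = 4 ∧
      (∃ x₀ ∈ K, x₀ ^ 2 = algebraMap k (AlgebraicClosure k) d) ∧
      (¬ ∀ E : IntermediateField k K, E = ⊥ ∨ E = ⊤) ∧ ¬ PointsEqBase s K := by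
  let := (geometricConst s).toAlgebra
  have hv := hX.isPlaceFamily
  have hn' : (f.map (algebraMap k (AlgebraicClosure k))).natDegree = 2 * n := by
    rw [natDegree_map, hn]
  obtain ⟨x₀, hx₀⟩ := IsAlgClosed.exists_pow_nat_eq (algebraMap k (AlgebraicClosure k) d) two_pos
  have hx₀k : x₀ ∉ (algebraMap k (AlgebraicClosure k)).range := by
    rintro ⟨c, rfl⟩
    rw [← map_pow] at hx₀
    exact hd ⟨c, by rw [← sq]; exact ((algebraMap k (AlgebraicClosure k)).injective hx₀).symm⟩
  obtain ⟨Q, hQ⟩ := hv.exists_index m x₀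
  obtain ⟨y₀, hy₀, hQ'⟩ := hv.exists_sub_mem_nonunits m hQ
  let E := IntermediateField.adjoin k {x₀}
  have hxE : x₀ ∈ E := IntermediateField.mem_adjoin_simple_self k x₀
  have hE : Module.finrank k E = 2 := IntermediateField.finrank_adjoin_simple_eq_two hx₀k hx₀
  have : FiniteDimensional k E := .of_finrank_pos (by omega)
  -- Otherwise Q would be a point over the quadratic field E whose x-coordinate generates E,
  -- contrary to the case j = 1.
  have hyE : y₀ ∉ (algebraMap E (AlgebraicClosure k)).range := by
    rintro ⟨w, rfl⟩
    obtain ⟨P, rfl⟩ := exists_points_map_val_eq hX m hQ hQ' hxE w.2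
    refine adjoin_value_ne_top hJ hX hn' (j := 1) (by omega) m hE P (z := ⟨x₀, hxE⟩)
      (fun ψ => hX.sub_mem_nonunits_place_map P E.val ψ hQ) ?_
    refine IntermediateField.lift_injective E ?_
    rw [IntermediateField.lift_adjoin_simple, IntermediateField.lift_top]
  have hyc : y₀ ^ 2 = algebraMap E (AlgebraicClosure k) (aeval (⟨x₀, hxE⟩ : E) f) := by
    rw [hy₀, eval_map_algebraMap, ← aeval_algebraMap_apply]
    rfl
  let K₁ := IntermediateField.adjoin E {y₀}
  have hK₁ : Module.finrank E K₁ = 2 := IntermediateField.finrank_adjoin_simple_eq_two hyE hyc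
  let K := K₁.restrictScalars k
  have hK : Module.finrank k K = 4 := by
    have := Module.finrank_mul_finrank k E K₁
    rw [hE, hK₁] at this
    exact this.symm
  have hxK : x₀ ∈ K := K₁.algebraMap_mem ⟨x₀, hxE⟩
  have hyK : y₀ ∈ K := IntermediateField.mem_adjoin_simple_self E y₀
  refine ⟨K, hK, ⟨x₀, hxK, hx₀⟩, fun hprim => ?_, fun hpts => ?_⟩
  · have h2 : Module.finrank k (IntermediateField.adjoin k {(⟨x₀, hxK⟩ : K)}) = 2 := by
      refine IntermediateField.finrank_adjoin_simple_eq_two (c := d) ?_ (Subtype.ext hx₀)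
      rintro ⟨c, hc⟩
      exact hx₀k ⟨c, congrArg Subtype.val hc⟩
    rcases hprim (IntermediateField.adjoin k {(⟨x₀, hxK⟩ : K)}) with h | h
    · rw [h, IntermediateField.finrank_bot] at h2
      omega
    · rw [h, IntermediateField.finrank_top', hK] at h2
      omega
  -- The point is defined over K. If it came from a k-point, its x-coordinate x₀ would lie in k.
  · obtain ⟨P, rfl⟩ := exists_points_map_val_eq hX m hQ hQ' hxK hyK
    obtain ⟨P₀, rfl⟩ := hpts P
    rw [points_map_comp] at hQ
    obtain ⟨c, hc⟩ := exists_value s hX P₀ _ (hX.mem_place_of_sub_mem hQ)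
    refine hx₀k ⟨c, ?_⟩
    have := (hX.place _).algebraMap_eq_of_sub_mem (hX.const_mem_place _) hQ (hc _)
    rw [this]
    exact (AlgHom.commutes _ c).symm

theorem infinite_quartic_not_pointsEqBase (hJ : Subsingleton (jacobianPoints s))
    (hX : HasNonconstant s) (hn : f.natDegree = 2 * n) (hn3 : 3 ≤ n)
    (m : letI := (geometricConst s).toAlgebra
      HyperellipticModel (AlgebraicClosure k) (functionFieldMap s x) (functionFieldMap s y)
        (f.map (algebraMap k (AlgebraicClosure k))))
    {ι : Type*} [Infinite ι] {d : ι → k} (hd : ∀ i, ¬ IsSquare (d i))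
    (hd' : ∀ i j, i ≠ j → ¬ IsSquare (d i * d j)) :
    {K : IntermediateField k (AlgebraicClosure k) | Module.finrank k K = 4 ∧
      (¬ ∀ E : IntermediateField k K, E = ⊥ ∨ E = ⊤) ∧ ¬ PointsEqBase s K}.Infinite := by
  refine IntermediateField.infinite_of_forall_exists_sq hd hd' ?_ fun i => ?_
  · rintro K ⟨hK, -⟩
    exact .of_finrank_pos (by omega)
  · obtain ⟨K, hK, hx, h⟩ := exists_quartic_not_pointsEqBase hJ hX hn hn3 m (hd i)
    exact ⟨K, ⟨hK, h⟩, hx⟩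

end CurvePoints

end

/-! ### The main theorem over the rationals -/

theorem mainTheorem1 {C : Scheme.{0}} (s : C ⟶ Spec (.of ℚ)) [CurvePoints.IsCurve s]
    (hC : CurvePoints.IsHyperelliptic s)
    (hg : CurvePoints.genus s = 2 ∨ CurvePoints.genus s = 3)
    (hJ : Subsingleton (CurvePoints.jacobianPoints s)) :
    (∀ (K : Type) [Field K] [NumberField K], Module.finrank ℚ K = 4 →
      CurvePoints.IsPrimitiveField K → CurvePoints.PointsEqBase s K) ∧
    {K : IntermediateField ℚ (AlgebraicClosure ℚ) | ∃ _ : NumberField K,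
      Module.finrank ℚ K = 4 ∧ ¬ CurvePoints.IsPrimitiveField K ∧
        ¬ CurvePoints.PointsEqBase s K}.Infinite := by
  have := CurvePoints.isIntegral_of_isCurve s
  let := CurvePoints.stalkAlgebra s (genericPoint C)
  obtain ⟨x, y, f, n, m, hn, hn3⟩ := CurvePoints.IsHyperelliptic.exists_model s hC
  have m' := CurvePoints.geometric_model (s := s) hn (by omega) m
  let := (CurvePoints.geometricConst s).toAlgebra
  have hX : CurvePoints.HasNonconstant s :=
    CurvePoints.hasNonconstant_of_transcendental m'.transcendental
  refine ⟨fun K _ _ hK hprim => ?_, ?_⟩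
  · exact CurvePoints.pointsEqBase_of_forall_intermediateField hJ hX
      ((Polynomial.natDegree_map _).trans hn) hn3 m' hK hprim
  -- The primes serve as the independent family d: neither a prime nor a product of two distinct
  -- primes is a rational square.
  · have hp (p : Nat.Primes) : ¬ IsSquare ((p : ℕ) : ℚ) := by
      rw [Rat.isSquare_natCast_iff]
      exact (Nat.prime_iff.mp p.2).not_isSquare
    have hpq (p q : Nat.Primes) (hne : p ≠ q) : ¬ IsSquare (((p : ℕ) : ℚ) * ((q : ℕ) : ℚ)) := by
      rw [← Nat.cast_mul, Rat.isSquare_natCast_iff]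
      rintro ⟨r, hr⟩
      obtain ⟨t, rfl⟩ : (p : ℕ) ∣ r := by
        have h : (p : ℕ) ∣ r * r := ⟨q, hr.symm⟩
        exact (or_self _).mp ((Nat.Prime.dvd_mul p.2).mp h)
      have h1 : (q : ℕ) = t * (p * t) :=
        Nat.eq_of_mul_eq_mul_left p.2.pos (by rw [hr]; ring)
      have h2 : (p : ℕ) ∣ q := ⟨t * t, by rw [h1]; ring⟩
      exact hne (Subtype.ext ((Nat.prime_dvd_prime_iff_eq p.2 q.2).mp h2))
    refine (CurvePoints.infinite_quartic_not_pointsEqBase hJ hX hn hn3 m' hp hpq).mono ?_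
    rintro K ⟨hK, h⟩
    have hfin : FiniteDimensional ℚ K := .of_finrank_pos (by rw [hK]; norm_num)
    exact ⟨{ to_charZero := inferInstance, to_finiteDimensional := hfin }, hK, h⟩
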